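/- Let $G$ be a finite connected bridgeless cubic planar multigraph with $n$ vertices (parallel edges are allowed; loops cannot occur, since a loop in a cubic graph forces a bridge). A circuit of $G$ is a connected 2-regular subgraph of $G$ (two parallel edges form a circuit of length 2), and a circuit double cover of $G$ is a multiset of circuits of $G$ such that every edge of $G$ belongs to exactly two of its members, counted with multiplicity. Then $G$ has at least $$\left(\tfrac{5}{2}\right)^{n/4-1/2}$$ circuit double covers. -/

import Mathlib

/-! Finite multigraphs are Mathlib's `Graph α β` (vertices in `α`, edges in `β`; parallel edges and
loops are allowed). Connectivity, degrees, circuits, double covers and planarity follow. -/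

namespace Graph

/-- Two vertices are joined by a (possibly trivial) walk. -/
def Reachable {α β : Type*} (G : Graph α β) (x y : α) : Prop :=
  Relation.ReflTransGen G.Adj x y

/-- A graph is connected if it has a vertex and any two of its vertices are joined by a walk. -/
def IsConnected {α β : Type*} (G : Graph α β) : Prop :=
  G.vertexSet.Nonempty ∧ ∀ x ∈ G.vertexSet, ∀ y ∈ G.vertexSet, G.Reachable x y

/-- The number of edge ends at a vertex: every incident edge counts once, and loops once more. -/
noncomputable def eDegree {α β : Type*} (G : Graph α β) (x : α) : ℕ∞ :=
  (G.incidenceSet x).encard + (G.loopSet x).encard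

/-- All vertices have degree `k`. -/
def IsRegular {α β : Type*} (G : Graph α β) (k : ℕ) : Prop :=
  ∀ x ∈ G.vertexSet, G.eDegree x = k

/-- A bridge: an edge whose deletion separates its two ends. -/
def IsBridge {α β : Type*} (G : Graph α β) (e : β) : Prop :=
  ∃ x y, G.IsLink e x y ∧ ¬ (G.deleteEdges {e}).Reachable x y

/-- A graph without bridges. -/
def IsBridgeless {α β : Type*} (G : Graph α β) : Prop :=
  ∀ e, ¬ G.IsBridge e

/-- A circuit of `G`: a connected 2-regular subgraph (two parallel edges form a circuit). -/
def IsCircuitOf {α β : Type*} (C G : Graph α β) : Prop :=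
  C ≤ G ∧ C.IsConnected ∧ C.IsRegular 2

open Classical in
/-- A circuit double cover: a multiset of circuits such that each edge is contained in exactly
two of its members, counted with multiplicity. -/
def IsCircuitDoubleCover {α β : Type*} (G : Graph α β) (𝒞 : Multiset (Graph α β)) : Prop :=
  (∀ C ∈ 𝒞, C.IsCircuitOf G) ∧ ∀ e ∈ G.edgeSet, 𝒞.countP (fun C => e ∈ C.edgeSet) = 2

/-- The number `ν(G)` of circuit double covers. -/
noncomputable def numCircuitDoubleCovers {α β : Type*} (G : Graph α β) : ℕ :=
  {𝒞 : Multiset (Graph α β) | G.IsCircuitDoubleCover 𝒞}.ncard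

/-- The darts of `G`: each edge has two, one for each of its orientations. -/
abbrev Darts {α β : Type*} (G : Graph α β) : Type _ := G.edgeSet × Bool

/-- Reversing a dart. -/
def flip {α β : Type*} (G : Graph α β) : Equiv.Perm G.Darts :=
  Equiv.prodCongr (Equiv.refl G.edgeSet) Equiv.boolNot

/-- A rotation system: a cyclic order of the darts leaving each vertex. It is the combinatorial
description of a cellular embedding of (each component of) `G` in a closed oriented surface. -/
structure RotationSystem {α β : Type*} (G : Graph α β) where
  /-- The vertex from which a dart leaves. -/
  tail : G.Darts → α
  isLink : ∀ e : G.edgeSet, G.IsLink e (tail (e, false)) (tail (e, true))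
  /-- The next dart in the cyclic order around the same vertex. -/
  rot : Equiv.Perm G.Darts
  sameCycle_iff : ∀ d d' : G.Darts, rot.SameCycle d d' ↔ tail d = tail d'

/-- The number of cycles of a permutation, fixed points included. -/
noncomputable def numCycles {D : Type*} (f : Equiv.Perm D) : ℕ :=
  Nat.card (Quotient (Equiv.Perm.SameCycle.setoid f))

namespace RotationSystem

/-- Face tracing: after walking along a dart, leave its head along the dart that follows the
reversed dart in the rotation. The cycles of this permutation are the faces of the embedding. -/
def face {α β : Type*} {G : Graph α β} (R : G.RotationSystem) : Equiv.Perm G.Darts :=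
  R.rot * G.flip

/-- The number of connected components that contain an edge. -/
noncomputable def numComponents {α β : Type*} {G : Graph α β} (R : G.RotationSystem) : ℕ :=
  Nat.card (MulAction.orbitRel.Quotient (Subgroup.closure {R.rot, G.flip}) G.Darts)

/-- The embedding lies in the sphere (in one sphere for each component): `V - E + F = 2 c`, where
`c` is the number of components and isolated vertices, which have no darts, are left out. The cycles
of `rot` are the non-isolated vertices and the cycles of `face` the faces. For a connected graph
with an edge this reads `V - E + F = 2`. -/
def IsPlane {α β : Type*} {G : Graph α β} (R : G.RotationSystem) : Prop :=
  numCycles R.rot + numCycles R.face = numCycles G.flip + 2 * R.numComponents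

end RotationSystem

/-- A (finite) graph is planar if it has an embedding in the sphere, given by a rotation system. -/
def IsPlanar {α β : Type*} (G : Graph α β) : Prop :=
  ∃ R : G.RotationSystem, R.IsPlane

end Graph

/-!
An embedded cubic graph is encoded by its darts: three at every vertex, numbered along the rotation,
together with the reversal. Assign to every edge a twist, flat or crossed. Following the corners
along the edges, and changing sides at the crossed ones, yields closed strands that pass along every
edge twice. If no strand passes twice through a vertex, the strands are circuits and form a circuit
double cover, from which the twists can be recovered. It therefore suffices to count the valid
twists.

This is done by induction on the number `n` of vertices. Among the vertex sets with at least two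
elements that are left by at most three edges, take a minimal one. By Euler's formula it contains a
face of length `k ∈ {2, 3, 4, 5}`, and by minimality the boundary of the face is an induced cycle.
Replacing this cycle by an edge (`k = 2`), a claw (`k = 3`), two edges (`k = 4`) or an edge and a
claw (`k = 5`) that fit into the disc gives smaller bridgeless planar maps. What a twist does
outside the cycle matters only through the way in which the outer strands connect the `2 k` strand
ends at the cycle, and through the pairs of outer strands that meet at a vertex and must not be
joined. There are finitely many such situations, and in each of them the valid continuations to the
cycle and to its replacements are counted. With `ν` the number of valid twists, the outcome is
`ν ≥ 2 ν'` for `k ≤ 3`, `ν ≥ 2 (ν₁ + ν₂)` for `k = 4` and `2 ν ≥ ν₁ + ⋯ + ν₅` for `k = 5`. The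
replacements have `n - 2` vertices for `k ≤ 3` and `n - 4` for `k ≥ 4`, and `(5/2)^(n/4 - 1/2)`
grows by a factor of at most two with two further vertices and by exactly `5/2` with four.
-/

namespace CircuitDoubleCover

/-! ### Counting the classes generated by a relation -/

section Classes

open Relation

variable {D E : Type*} {r s : D → D → Prop}

theorem eqvGen_map {s : E → E → Prop} {f : D → E} (hf : ∀ x y, r x y → EqvGen s (f x) (f y))
    {x y : D} (h : EqvGen r x y) : EqvGen s (f x) (f y) := by
  induction h with
  | rel x y hxy => exact hf x y hxy
  | refl x => exact .refl _
  | symm x y _ ih => exact ih.symm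
  | trans x y z _ _ ihxy ihyz => exact ihxy.trans _ _ _ ihyz

theorem apply_eq_of_eqvGen {f : D → E} (hf : ∀ x y, r x y → f x = f y) {x y : D}
    (h : EqvGen r x y) : f x = f y :=
  congrArg (Quot.lift f hf) (Quot.eqvGen_sound h)

/-- The number of classes of the equivalence relation generated by `r`. -/
noncomputable def numClasses (r : D → D → Prop) : ℕ := Nat.card (Quot r)

theorem numClasses_anti [Finite D] (h : ∀ x y, r x y → EqvGen s x y) :
    numClasses s ≤ numClasses r := by
  refine Nat.card_le_card_of_surjective
    (Quot.lift (Quot.mk s) fun x y hxy => Quot.eqvGen_sound (h x y hxy)) ?_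
  rintro ⟨x⟩
  exact ⟨Quot.mk r x, rfl⟩

theorem numClasses_congr [Finite D] (hrs : ∀ x y, r x y → EqvGen s x y)
    (hsr : ∀ x y, s x y → EqvGen r x y) : numClasses r = numClasses s :=
  (numClasses_anti hsr).antisymm (numClasses_anti hrs)

theorem card_image_le_numClasses [Fintype D] [DecidableEq E] (f : D → E)
    (hf : ∀ x y, r x y → f x = f y) : (Finset.univ.image f).card ≤ numClasses r := by
  classical
  have : Fintype (Quot r) := Fintype.ofFinite _
  have himage : Finset.univ.image f = Finset.univ.image (Quot.lift f hf) := by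
    ext e
    simp only [Finset.mem_image, Finset.mem_univ, true_and]
    exact (Quot.mk_surjective.exists (p := fun q => Quot.lift f hf q = e)).symm
  rw [himage, numClasses, Nat.card_eq_fintype_card]
  exact Finset.card_image_le

theorem numClasses_le_card (f : D → E) (S : Finset E) (hS : ∀ x, f x ∈ S)
    (hf : ∀ x y, f x = f y → EqvGen r x y) : numClasses r ≤ S.card := by
  rw [numClasses, ← Nat.card_eq_finsetCard]
  refine Nat.card_le_card_of_injective (fun q : Quot r => (⟨f q.out, hS _⟩ : S)) fun p q hpq => ?_
  rw [← Quot.out_eq p, ← Quot.out_eq q]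
  exact Quot.eqvGen_sound (hf _ _ (congrArg Subtype.val hpq))

/-- The relation `r` together with finitely many further pairs. -/
def withPairs (r : D → D → Prop) (l : List (D × D)) (x y : D) : Prop := r x y ∨ (x, y) ∈ l

variable {l : List (D × D)} {a b : D}

theorem eqvGen_withPairs_of_eqvGen {x y : D} (h : EqvGen r x y) : EqvGen (withPairs r l) x y :=
  EqvGen.mono (fun _ _ => Or.inl) _ _ h

theorem eqvGen_withPairs_cons {x y : D} (h : withPairs r l x y) :
    EqvGen (withPairs r ((a, b) :: l)) x y :=
  .rel _ _ (h.imp_right (List.mem_cons_of_mem _))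

theorem eqvGen_withPairs_cons_self : EqvGen (withPairs r ((a, b) :: l)) a b :=
  .rel _ _ (Or.inr List.mem_cons_self)

theorem eqvGen_or_of_withPairs_cons {x y : D} (h : EqvGen (withPairs r ((a, b) :: l)) x y) :
    EqvGen (withPairs r l) x y ∨
      (EqvGen (withPairs r l) x a ∨ EqvGen (withPairs r l) x b) ∧
        (EqvGen (withPairs r l) y a ∨ EqvGen (withPairs r l) y b) := by
  have hequiv := EqvGen.is_equivalence (withPairs r l)
  induction h with
  | rel x y hxy =>
    rcases hxy with hxy | hxy
    · exact Or.inl (.rel _ _ (Or.inl hxy))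
    · rcases List.mem_cons.1 hxy with hxy | hxy
      · obtain ⟨rfl, rfl⟩ := Prod.mk.inj hxy
        exact Or.inr ⟨Or.inl (.refl _), Or.inr (.refl _)⟩
      · exact Or.inl (.rel _ _ (Or.inr hxy))
  | refl x => exact Or.inl (.refl _)
  | symm x y _ ih => exact ih.imp hequiv.symm And.symm
  | trans x y z _ _ ihxy ihyz =>
    rcases ihxy with hxy | ⟨hx, hy⟩ <;> rcases ihyz with hyz | ⟨hy', hz⟩
    · exact Or.inl (hequiv.trans hxy hyz)
    · exact Or.inr ⟨hy'.imp (hequiv.trans hxy) (hequiv.trans hxy), hz⟩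
    · exact Or.inr ⟨hx, hy.imp (hequiv.trans (hequiv.symm hyz)) (hequiv.trans (hequiv.symm hyz))⟩
    · exact Or.inr ⟨hx, hz⟩

theorem numClasses_withPairs_le_cons_add_one [Finite D] :
    numClasses (withPairs r l) ≤ numClasses (withPairs r ((a, b) :: l)) + 1 := by
  classical
  let project (q : Quot (withPairs r l)) : Option (Quot (withPairs r ((a, b) :: l))) :=
    if q = Quot.mk _ a then none else some (Quot.map id (fun _ _ h => Or.imp_right
      (List.mem_cons_of_mem _) h) q)
  rw [numClasses, numClasses, ← Finite.card_option]
  refine Nat.card_le_card_of_injective project ?_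
  rintro ⟨x⟩ ⟨y⟩ hxy
  by_cases hx : Quot.mk (withPairs r l) x = Quot.mk _ a <;>
    by_cases hy : Quot.mk (withPairs r l) y = Quot.mk _ a
  · rw [hx, hy]
  · simp [project, hx, hy] at hxy
  · simp [project, hx, hy] at hxy
  · simp only [project, hx, hy, if_false, Option.some.injEq] at hxy
    rcases eqvGen_or_of_withPairs_cons (Quot.eqvGen_exact hxy) with h | ⟨hxab, hyab⟩
    · exact Quot.eqvGen_sound h
    · have hxb := hxab.resolve_left fun h => hx (Quot.eqvGen_sound h)
      have hyb := hyab.resolve_left fun h => hy (Quot.eqvGen_sound h)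
      exact (Quot.eqvGen_sound hxb).trans (Quot.eqvGen_sound hyb).symm

theorem numClasses_withPairs_cons_of_eqvGen [Finite D] (h : EqvGen (withPairs r l) a b) :
    numClasses (withPairs r ((a, b) :: l)) = numClasses (withPairs r l) := by
  refine numClasses_congr (fun x y hxy => ?_) fun _ _ => eqvGen_withPairs_cons
  rcases hxy with hxy | hxy
  · exact .rel _ _ (Or.inl hxy)
  · rcases List.mem_cons.1 hxy with hxy | hxy
    · obtain ⟨rfl, rfl⟩ := Prod.mk.inj hxy
      exact h
    · exact .rel _ _ (Or.inr hxy)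

theorem numClasses_withPairs_cons_lt [Finite D] (h : ¬ EqvGen (withPairs r l) a b) :
    numClasses (withPairs r ((a, b) :: l)) < numClasses (withPairs r l) := by
  let project : Quot (withPairs r l) → Quot (withPairs r ((a, b) :: l)) :=
    Quot.map id fun _ _ h => Or.imp_right (List.mem_cons_of_mem _) h
  have hsurj : project.Surjective := by
    rintro ⟨x⟩
    exact ⟨Quot.mk _ x, rfl⟩
  refine (Nat.card_le_card_of_surjective project hsurj).lt_of_ne fun hcard => h ?_
  have hinj := ((Nat.bijective_iff_surjective_and_card project).2 ⟨hsurj, hcard.symm⟩).injective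
  exact Quot.eqvGen_exact (hinj (Quot.eqvGen_sound eqvGen_withPairs_cons_self))

end Classes

/-! ### An Euler inequality for permutations -/

section Euler

open Relation Equiv Equiv.Perm Graph

variable {D E : Type*} {f : Perm D}

theorem apply_eq_of_sameCycle {g : D → E} (hg : ∀ x, g (f x) = g x) {x y : D}
    (h : f.SameCycle x y) : g x = g y := by
  have hpow (n : ℕ) (z : D) : g ((f ^ n) z) = g z := by
    induction n with
    | zero => rfl
    | succ n ih => rw [pow_succ', mul_apply, hg, ih]
  obtain ⟨n | n, rfl⟩ := h
  · exact (hpow n x).symm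
  · nth_rw 1 [← (f ^ (n + 1)).apply_symm_apply x]
    exact hpow _ _

theorem eqvGen_of_sameCycle {r : D → D → Prop} (hr : ∀ x, EqvGen r x (f x)) {x y : D}
    (h : f.SameCycle x y) : EqvGen r x y :=
  Quot.eqvGen_exact (apply_eq_of_sameCycle (fun z => (Quot.eqvGen_sound (hr z)).symm) h)

theorem numCycles_eq_numClasses_withPairs_nil [Finite D] :
    numCycles f = numClasses (withPairs f.SameCycle []) :=
  numClasses_congr (r := f.SameCycle) (fun _ _ h => .rel _ _ (Or.inl h))
    fun _ _ h => .rel _ _ (h.resolve_right List.not_mem_nil)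

theorem eqvGen_withPairs_nil_sameCycle {x y : D} :
    EqvGen (withPairs f.SameCycle []) x y ↔ f.SameCycle x y := by
  have hnil : withPairs f.SameCycle [] = f.SameCycle := by
    ext
    simp [withPairs]
  rw [hnil, (SameCycle.equivalence f).eqvGen_iff]

variable [DecidableEq D]

theorem eqvGen_withPairs_of_sameCycle_mul_swap {l : List (D × D)} {a b x y : D}
    (h : (f * swap a b).SameCycle x y) : EqvGen (withPairs f.SameCycle ((a, b) :: l)) x y := by
  refine eqvGen_of_sameCycle (fun z => ?_) h
  refine EqvGen.trans _ (swap a b z) _ ?_ (.rel _ _ (Or.inl ⟨1, rfl⟩))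
  rcases eq_or_ne z a with rfl | hza
  · rw [swap_apply_left]
    exact eqvGen_withPairs_cons_self
  rcases eq_or_ne z b with rfl | hzb
  · rw [swap_apply_right]
    exact eqvGen_withPairs_cons_self.symm
  rw [swap_apply_of_ne_of_ne hza hzb]
  exact .refl _

theorem numClasses_withPairs_mul_swap [Finite D] (f : Perm D) (a b : D) (l : List (D × D)) :
    numClasses (withPairs (f * swap a b).SameCycle ((a, b) :: l)) =
      numClasses (withPairs f.SameCycle ((a, b) :: l)) := by
  have hle (g : Perm D) : numClasses (withPairs g.SameCycle ((a, b) :: l)) ≤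
      numClasses (withPairs (g * swap a b).SameCycle ((a, b) :: l)) :=
    numClasses_anti fun x y h =>
      h.elim eqvGen_withPairs_of_sameCycle_mul_swap fun hmem => .rel _ _ (Or.inr hmem)
  refine le_antisymm ?_ (hle f)
  simpa [mul_assoc] using hle (f * swap a b)

theorem numCycles_mul_swap_le [Finite D] (f : Perm D) (a b : D) :
    numCycles (f * swap a b) ≤ numCycles f + 1 := by
  rw [numCycles_eq_numClasses_withPairs_nil, numCycles_eq_numClasses_withPairs_nil]
  calc numClasses (withPairs (f * swap a b).SameCycle [])
      ≤ numClasses (withPairs (f * swap a b).SameCycle [(a, b)]) + 1 :=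
        numClasses_withPairs_le_cons_add_one
    _ = numClasses (withPairs f.SameCycle [(a, b)]) + 1 := by rw [numClasses_withPairs_mul_swap]
    _ ≤ numClasses (withPairs f.SameCycle []) + 1 :=
        Nat.add_le_add_right (numClasses_anti fun _ _ => eqvGen_withPairs_cons) 1

/- The `f`-cycle through `b` avoids `a`, and `f * swap a b` follows it from `a` until it closes up
at `b`. -/
theorem sameCycle_mul_swap_of_not_sameCycle [Finite D] {a b : D} (h : ¬ f.SameCycle a b) :
    (f * swap a b).SameCycle a b := by
  by_contra hab
  have hreach (n : ℕ) : (f * swap a b).SameCycle a ((f ^ (n + 1)) b) := by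
    induction n with
    | zero => exact ⟨1, by simp⟩
    | succ n ih =>
      have hne_a : (f ^ (n + 1)) b ≠ a := fun ha => h (SameCycle.symm ⟨(n + 1 : ℕ), ha⟩)
      have hne_b : (f ^ (n + 1)) b ≠ b := fun hb => hab (by rwa [hb] at ih)
      have hstep : (f * swap a b) ((f ^ (n + 1)) b) = (f ^ (n + 2)) b := by
        rw [mul_apply, swap_apply_of_ne_of_ne hne_a hne_b, ← mul_apply, ← pow_succ']
      exact hstep ▸ sameCycle_apply_right.2 ih
  have horder : (f ^ (orderOf f - 1 + 1)) b = b := by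
    rw [Nat.sub_add_cancel (orderOf_pos f), pow_orderOf_eq_one, one_apply]
  have hclosed := hreach (orderOf f - 1)
  rw [horder] at hclosed
  exact hab hclosed

theorem numCycles_mul_swap_lt [Finite D] {a b : D} (h : ¬ f.SameCycle a b) :
    numCycles (f * swap a b) < numCycles f := by
  rw [numCycles_eq_numClasses_withPairs_nil, numCycles_eq_numClasses_withPairs_nil,
    ← numClasses_withPairs_cons_of_eqvGen
      (eqvGen_withPairs_nil_sameCycle.2 (sameCycle_mul_swap_of_not_sameCycle h)),
    numClasses_withPairs_mul_swap]
  exact numClasses_withPairs_cons_lt (eqvGen_withPairs_nil_sameCycle.not.2 h)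

/-- The product of the transpositions in a list of pairs. -/
def swapProd (l : List (D × D)) : Perm D := (l.map fun p => swap p.1 p.2).prod

/- With `rot`, the transpositions and `face` this is `V + F ≤ E + 2 c`: the genus of every component
is nonnegative. -/
theorem numCycles_add_numCycles_mul_swapProd_le [Finite D] (f : Perm D) (l : List (D × D)) :
    numCycles f + numCycles (f * swapProd l) ≤
      l.length + 2 * numClasses (withPairs f.SameCycle l) := by
  induction l generalizing f with
  | nil =>
    have h := numCycles_eq_numClasses_withPairs_nil (f := f)
    simp only [swapProd, List.map_nil, List.prod_nil, mul_one, List.length_nil]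
    omega
  | cons p l ih =>
    obtain ⟨a, b⟩ := p
    have hprod : f * swapProd ((a, b) :: l) = f * swap a b * swapProd l := by
      simp [swapProd, mul_assoc]
    have hcancel : f * swap a b * swap a b = f := by simp [mul_assoc]
    have hswap := ih (f * swap a b)
    have hcons := numClasses_withPairs_mul_swap f a b l
    rw [hprod, List.length_cons]
    by_cases hjoin : EqvGen (withPairs (f * swap a b).SameCycle l) a b
    · have hsame := numClasses_withPairs_cons_of_eqvGen hjoin
      have hle := numCycles_mul_swap_le (f * swap a b) a b
      rw [hcancel] at hle
      omega
    · have hle := numClasses_withPairs_le_cons_add_one (r := (f * swap a b).SameCycle)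
        (l := l) (a := a) (b := b)
      have hlt := numCycles_mul_swap_lt (f := f * swap a b) (a := a) (b := b)
        fun h => hjoin (.rel _ _ (Or.inl h))
      rw [hcancel] at hlt
      omega

theorem exists_swapProd_eq_of_involutive {a : D → D} (ha : a.Involutive) (s : Finset D)
    (hmaps : ∀ d ∈ s, a d ∈ s) (hne : ∀ d ∈ s, a d ≠ d) :
    ∃ l : List (D × D), 2 * l.length = s.card ∧ (∀ d ∈ s, (d, a d) ∈ l ∨ (a d, d) ∈ l) ∧
      ∀ d, swapProd l d = if d ∈ s then a d else d := by
  induction s using Finset.strongInduction with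
  | _ s ih =>
    rcases s.eq_empty_or_nonempty with rfl | ⟨x, hx⟩
    · exact ⟨[], by simp [swapProd]⟩
    have hax : a x ∈ s.erase x := Finset.mem_erase.2 ⟨hne x hx, hmaps x hx⟩
    obtain ⟨l, hlength, hmem, hprod⟩ := ih ((s.erase x).erase (a x))
      ((Finset.erase_ssubset hax).trans (Finset.erase_ssubset hx))
      (fun d hd => by
        simp only [Finset.mem_erase] at hd ⊢
        exact ⟨ha.injective.ne hd.2.1, fun h => hd.1 (by rw [← h, ha]), hmaps d hd.2.2⟩)
      fun d hd => hne d (Finset.mem_of_mem_erase (Finset.mem_of_mem_erase hd))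
    have hcard := Finset.card_erase_add_one hx
    have hcard' := Finset.card_erase_add_one hax
    refine ⟨l ++ [(x, a x)], ?_, fun d hd => ?_, fun d => ?_⟩
    · rw [List.length_append, List.length_singleton]
      omega
    · rcases eq_or_ne d x with rfl | hdx
      · simp
      rcases eq_or_ne d (a x) with rfl | hdax
      · simp [ha x]
      exact (hmem d (by simp [hd, hdx, hdax])).imp (List.mem_append_left _)
        (List.mem_append_left _)
    · have hsnoc : swapProd (l ++ [(x, a x)]) d = swapProd l (swap x (a x) d) := by
        simp [swapProd]
      rw [hsnoc, hprod]
      rcases eq_or_ne d x with rfl | hdx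
      · simp [hx]
      rcases eq_or_ne d (a x) with rfl | hdax
      · simp [ha x, hmaps x hx]
      simp [swap_apply_of_ne_of_ne hdx hdax, hdx, hdax]

end Euler

/-! ### Cubic maps -/

/-- A cubic map: the darts are `V × Fin 3`, the rotation at a vertex is `(v, i) ↦ (v, i + 1)`, and
the edges are the orbits of a fixed point free involution of the darts. -/
structure CubicMap (V : Type*) where
  /-- Reversing a dart. -/
  inv : V × Fin 3 → V × Fin 3
  inv_inv : ∀ d, inv (inv d) = d
  inv_ne : ∀ d, inv d ≠ d

/-- The corner on the side `b` of the dart `d`. The corner `(v, i)` is the one at `v` opposite to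
the dart `(v, i)`. -/
def crn {V : Type*} (d : V × Fin 3) (b : Bool) : V × Fin 3 :=
  (d.1, bif b then d.2 + 2 else d.2 + 1)

theorem crn_false_surjective {V : Type*} :
    Function.Surjective fun d : V × Fin 3 => crn d false := by
  rintro ⟨v, i⟩
  refine ⟨(v, i + 2), ?_⟩
  simp only [crn, cond_false, Prod.mk.injEq, true_and]
  fin_cases i <;> rfl

namespace CubicMap

open Finset Relation

variable {V : Type*} (M : CubicMap V)

theorem inv_involutive : Function.Involutive M.inv := M.inv_inv

/-- The face permutation: walk along a dart, then turn to the next dart in the rotation. -/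
def face : Equiv.Perm (V × Fin 3) :=
  M.inv_involutive.toPerm.trans (Equiv.prodCongr (Equiv.refl V) (Equiv.addRight 1))

theorem face_apply (d : V × Fin 3) : M.face d = ((M.inv d).1, (M.inv d).2 + 1) := rfl

theorem face_inv (d : V × Fin 3) : M.face (M.inv d) = (d.1, d.2 + 1) := by
  rw [face_apply, M.inv_inv]

theorem crn_face (d : V × Fin 3) : crn (M.face d) false = crn (M.inv d) true := by
  simp only [crn, face_apply, cond_true, cond_false, add_assoc]
  rfl

/-- A labelling of the corners is a labelling of the faces if the corners on the same side of an
edge have the same label. -/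
def IsFaceLabelling {ι : Type*} (L : V × Fin 3 → ι) : Prop :=
  ∀ d b, L (crn d b) = L (crn (M.inv d) (!b))

section Cut

variable [Fintype V] [DecidableEq V]

/-- The number of edges leaving a set of vertices. -/
def cut (X : Finset V) : ℕ := #{d : V × Fin 3 | d.1 ∈ X ∧ (M.inv d).1 ∉ X}

/-- Connected and without bridges: every proper nonempty vertex set is left by two edges. -/
def TwoConn : Prop := ∀ X : Finset V, X.Nonempty → X ≠ univ → 2 ≤ M.cut X

/-- A planar map, given by a labelling of the faces with as many labels as a spherical embedding
has faces. -/
def Planar : Prop :=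
  ∃ L : V × Fin 3 → ℕ, M.IsFaceLabelling L ∧ Fintype.card V + 4 ≤ 2 * #(univ.image L)

theorem card_filter_fst_mem (X : Finset V) : #{d : V × Fin 3 | d.1 ∈ X} = 3 * #X := by
  have hprod : ({d : V × Fin 3 | d.1 ∈ X} : Finset _) = X ×ˢ univ := by
    ext
    simp
  rw [hprod, card_product, card_univ, Fintype.card_fin, mul_comm]

theorem cut_univ : M.cut univ = 0 := by simp [cut]

theorem cut_compl (X : Finset V) : M.cut Xᶜ = M.cut X := by
  refine card_nbij' M.inv M.inv ?_ ?_ (fun d _ => M.inv_inv d) fun d _ => M.inv_inv d <;>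
  · intro d hd
    simp only [coe_filter, mem_univ, true_and, Set.mem_ofPred_eq, mem_compl, not_not, M.inv_inv]
      at hd ⊢
    exact hd.symm

theorem cut_inter_add_cut_union_le (X Y : Finset V) :
    M.cut (X ∩ Y) + M.cut (X ∪ Y) ≤ M.cut X + M.cut Y := by
  simp only [cut, card_filter, ← sum_add_distrib]
  refine sum_le_sum fun d _ => ?_
  by_cases d.1 ∈ X <;> by_cases d.1 ∈ Y <;> by_cases (M.inv d).1 ∈ X <;>
    by_cases (M.inv d).1 ∈ Y <;> simp [*]

theorem cut_sdiff_add_cut_sdiff_le (X Y : Finset V) :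
    M.cut (X \ Y) + M.cut (Y \ X) ≤ M.cut X + M.cut Y := by
  have hcompl : (X ∪ Yᶜ)ᶜ = Y \ X := by
    ext
    simp [and_comm]
  have h := M.cut_inter_add_cut_union_le X Yᶜ
  rwa [M.cut_compl Y, ← M.cut_compl (X ∪ Yᶜ), hcompl, ← sdiff_eq_inter_compl] at h

theorem even_cut_add_card (X : Finset V) : Even (M.cut X + #X) := by
  have hinner : Even #{d : V × Fin 3 | d.1 ∈ X ∧ (M.inv d).1 ∈ X} := by
    obtain ⟨l, hl, -⟩ := exists_swapProd_eq_of_involutive M.inv_involutive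
      {d : V × Fin 3 | d.1 ∈ X ∧ (M.inv d).1 ∈ X}
      (fun d hd => by simpa [M.inv_inv, and_comm] using hd) fun d _ => M.inv_ne d
    exact hl ▸ even_two_mul _
  have hsplit : #{d : V × Fin 3 | d.1 ∈ X ∧ (M.inv d).1 ∈ X} + M.cut X = 3 * #X := by
    rw [← card_filter_fst_mem, cut, ← filter_filter, ← filter_filter,
      card_filter_add_card_filter_not]
  rw [Nat.even_iff] at hinner ⊢
  omega

/-- A minimal vertex set with at least two elements that is left by at most three edges. -/
structure IsAtom (A : Finset V) : Prop where
  two_le_card : 2 ≤ #A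
  cut_le : M.cut A ≤ 3
  four_le_cut : ∀ B, B ⊂ A → 2 ≤ #B → 4 ≤ M.cut B

theorem exists_isAtom (h : 2 ≤ Fintype.card V) : ∃ A, M.IsAtom A := by
  obtain ⟨A, hA⟩ := (Set.toFinite {A : Finset V | 2 ≤ #A ∧ M.cut A ≤ 3}).exists_minimal
    ⟨univ, by simpa [cut_univ] using h⟩
  refine ⟨A, hA.1.1, hA.1.2, fun B hB hcard => ?_⟩
  by_contra hcut
  exact hB.2 (hA.2 ⟨hcard, by omega⟩ hB.1)

variable {M}

/- By sub- and posimodularity, `A ∪ X` and `X \ A` are left by exactly two edges, and `A ∩ X` by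
exactly four; the parity of `cut X` then contradicts `cut X = 3`. -/
theorem IsAtom.card_inter_le_one_or_card_sdiff_le_one {A : Finset V} (hA : M.IsAtom A)
    (hM : M.TwoConn) {X : Finset V} (hX : M.cut X ≤ 3) : #(A ∩ X) ≤ 1 ∨ #(A \ X) ≤ 1 := by
  by_contra! ⟨hinter, hsdiff⟩
  have hcut_inter : 4 ≤ M.cut (A ∩ X) := by
    refine hA.four_le_cut _ (inter_subset_left.ssubset_of_ne fun h => ?_) hinter
    rw [inter_eq_left, ← sdiff_eq_empty_iff_subset] at h
    simp [h] at hsdiff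
  have hcut_sdiff : 4 ≤ M.cut (A \ X) := by
    refine hA.four_le_cut _ (sdiff_subset.ssubset_of_ne fun h => ?_) hsdiff
    rw [Finset.sdiff_eq_self_iff_disjoint, disjoint_iff_inter_eq_empty] at h
    simp [h] at hinter
  have hcut_union : 2 ≤ M.cut (A ∪ X) := by
    refine hM _ ((card_pos.1 (by omega)).mono (inter_subset_union (t := X))) fun h => ?_
    have hcompl : A \ X = Xᶜ := by
      rw [compl_eq_univ_sdiff, ← h, union_sdiff_right]
    rw [hcompl, cut_compl] at hcut_sdiff
    omega
  have hcut_sdiff' : 2 ≤ M.cut (X \ A) := by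
    refine hM _ (nonempty_iff_ne_empty.2 fun h => ?_) fun h => ?_
    · rw [sdiff_eq_empty_iff_subset, ← inter_eq_right] at h
      rw [h] at hcut_inter
      omega
    · obtain ⟨v, hv⟩ := card_pos.1 (by omega : 0 < #(A ∩ X))
      exact (mem_sdiff.1 (h ▸ mem_univ v)).2 (mem_inter.1 hv).1
  have hle_A := hA.cut_le
  have hsub := M.cut_inter_add_cut_union_le A X
  have hpos := M.cut_sdiff_add_cut_sdiff_le A X
  have hcard := card_inter_add_card_sdiff X A
  rw [inter_comm] at hcard
  have hparity_X := Nat.even_iff.1 (M.even_cut_add_card X)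
  have hparity_inter := Nat.even_iff.1 (M.even_cut_add_card (A ∩ X))
  have hparity_sdiff := Nat.even_iff.1 (M.even_cut_add_card (X \ A))
  omega

end Cut

end CubicMap

/-! ### Short faces in planar maps -/

theorem mul_card_image_mk_sameCycle_le_card {D : Type*} {f : Equiv.Perm D}
    [DecidableEq (Quot f.SameCycle)] {s : Finset D} (hs : ∀ x ∈ s, f x ∈ s) {n : ℕ}
    (hn : ∀ x ∈ s, ∀ k, 0 < k → k < n → (f ^ k) x ≠ x) :
    n * (s.image (Quot.mk f.SameCycle)).card ≤ s.card := by
  classical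
  refine Finset.mul_card_image_le_card _ _ fun q hq => ?_
  obtain ⟨x, hx, rfl⟩ := Finset.mem_image.1 hq
  have hmem (k : ℕ) : (f ^ k) x ∈ s := by
    induction k with
    | zero => exact hx
    | succ k ih => exact pow_succ' f k ▸ hs _ ih
  have hne {i j : ℕ} (hij : i < j) (hj : j < n) : (f ^ i) x ≠ (f ^ j) x := fun h => by
    refine hn x hx (j - i) (by omega) (by omega) ((f ^ i).injective ?_)
    rw [← Equiv.Perm.mul_apply, ← pow_add, Nat.add_sub_cancel' hij.le, h]
  have hinj : Set.InjOn (fun k : ℕ => (f ^ k) x) (Finset.range n) := fun i hi j hj hij => by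
    rw [Finset.coe_range, Set.mem_Iio] at hi hj
    rcases lt_trichotomy i j with h | h | h
    exacts [(hne h hj hij).elim, h, (hne h hi hij.symm).elim]
  rw [← Finset.card_range n, ← Finset.card_image_of_injOn hinj]
  refine Finset.card_le_card fun y hy => ?_
  obtain ⟨k, -, rfl⟩ := Finset.mem_image.1 hy
  exact Finset.mem_filter.2 ⟨hmem k, (Quot.sound ⟨k, rfl⟩).symm⟩

namespace CubicMap

open Finset Relation Graph
open Equiv.Perm (SameCycle sameCycle_apply_left)

variable {V : Type*}

theorem forall_snd_mem_of_rot_mem {v : V} {C : Finset (V × Fin 3)}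
    (hrot : ∀ d ∈ C, (d.1, d.2 + 1) ∈ C) {i : Fin 3} (hv : (v, i) ∈ C) (j : Fin 3) :
    (v, j) ∈ C := by
  have hv1 : (v, i + 1) ∈ C := hrot _ hv
  have hv2 : (v, i + 1 + 1) ∈ C := hrot _ hv1
  have hj : j = i ∨ j = i + 1 ∨ j = i + 1 + 1 := by
    clear * -
    revert i j
    decide
  rcases hj with rfl | rfl | rfl
  exacts [hv, hv1, hv2]

variable [Fintype V] {M : CubicMap V}

theorem Planar.card_add_four_le (h : M.Planar) : Fintype.card V + 4 ≤ 2 * numCycles M.face := by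
  obtain ⟨L, hL, hcard⟩ := h
  have himage : univ.image L = univ.image fun d => L (crn d false) := by
    ext x
    simpa using crn_false_surjective.exists (p := fun d => L d = x)
  refine hcard.trans (Nat.mul_le_mul_left 2 (himage ▸ card_image_le_numClasses _ fun x y h => ?_))
  refine apply_eq_of_sameCycle (g := fun d => L (crn d false)) (fun d => ?_) h
  rw [crn_face, hL d false]
  rfl

variable [DecidableEq V] {A : Finset V}

variable (M A) in
open Classical in
/-- The darts on faces all of whose vertices lie in `A`. -/
noncomputable def innerDarts : Finset (V × Fin 3) := {d | ∀ x, M.face.SameCycle d x → x.1 ∈ A}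

variable (M A) in
open Classical in
/-- The faces all of whose vertices lie in `A`. -/
noncomputable def innerFaces : Finset (Quot M.face.SameCycle) :=
  (M.innerDarts A).image (Quot.mk _)

theorem mem_innerDarts {d : V × Fin 3} :
    d ∈ M.innerDarts A ↔ ∀ x, M.face.SameCycle d x → x.1 ∈ A := by
  simp [innerDarts]

theorem face_mem_innerDarts {d : V × Fin 3} : M.face d ∈ M.innerDarts A ↔ d ∈ M.innerDarts A := by
  simp only [mem_innerDarts, sameCycle_apply_left]

theorem fst_mem_of_mem_innerDarts {d : V × Fin 3} (h : d ∈ M.innerDarts A) : d.1 ∈ A :=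
  mem_innerDarts.1 h d (SameCycle.refl _ _)

theorem inv_fst_mem_of_mem_innerDarts {d : V × Fin 3} (h : d ∈ M.innerDarts A) :
    (M.inv d).1 ∈ A :=
  fst_mem_of_mem_innerDarts (d := M.face d) (face_mem_innerDarts.2 h)

theorem rot_notMem_innerDarts {d : V × Fin 3} (h : (M.inv d).1 ∉ A) :
    (d.1, d.2 + 1) ∉ M.innerDarts A := by
  rw [← M.face_inv, face_mem_innerDarts]
  exact fun hd => h (fst_mem_of_mem_innerDarts hd)

variable (M A) in
/-- The darts of the edges that do not join two vertices of `A`. -/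
def outerDarts : Finset (V × Fin 3) := {d | ¬ (d.1 ∈ A ∧ (M.inv d).1 ∈ A)}

theorem mem_outerDarts {d : V × Fin 3} :
    d ∈ M.outerDarts A ↔ ¬ (d.1 ∈ A ∧ (M.inv d).1 ∈ A) := by
  simp [outerDarts]

theorem inv_mem_outerDarts {d : V × Fin 3} (h : d ∈ M.outerDarts A) :
    M.inv d ∈ M.outerDarts A := by
  rw [mem_outerDarts, M.inv_inv, and_comm]
  exact mem_outerDarts.1 h

theorem card_outerDarts : #(M.outerDarts A) = 3 * #Aᶜ + M.cut A := by
  have hdisj : Disjoint ({d : V × Fin 3 | d.1 ∈ Aᶜ} : Finset _)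
      ({d : V × Fin 3 | d.1 ∈ A ∧ (M.inv d).1 ∉ A} : Finset _) :=
    disjoint_filter.2 fun d _ hd hd' => mem_compl.1 hd hd'.1
  rw [← card_filter_fst_mem, cut, ← card_union_of_disjoint hdisj, ← filter_or, outerDarts]
  congr 1
  ext d
  simp only [mem_filter, mem_univ, true_and, mem_compl]
  tauto

/- A separation of the complement of `A` would split the at most three edges leaving `A` among two
sides, each of which needs two. -/
theorem rel_of_notMem_of_cut_le_three (hM : M.TwoConn) (hcut : M.cut A ≤ 3) {r : V → V → Prop}
    (hr : Equivalence r) (hadj : ∀ d, d.1 ∉ A → (M.inv d).1 ∉ A → r d.1 (M.inv d).1) {u v : V}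
    (hu : u ∉ A) (hv : v ∉ A) : r u v := by
  classical
  by_contra huv
  let Y : Finset V := {w | w ∉ A ∧ r u w}
  let Z : Finset V := {w | w ∉ A ∧ ¬ r u w}
  have hcut_add : M.cut Y + M.cut Z ≤ M.cut A := by
    rw [← M.cut_compl A]
    simp only [cut, card_filter, ← sum_add_distrib]
    refine sum_le_sum fun d _ => ?_
    have hiff (h : d.1 ∉ A) (h' : (M.inv d).1 ∉ A) : r u d.1 ↔ r u (M.inv d).1 :=
      ⟨(hr.trans · (hadj d h h')), (hr.trans · (hr.symm (hadj d h h')))⟩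
    by_cases d.1 ∈ A <;> by_cases (M.inv d).1 ∈ A <;> by_cases r u d.1 <;> simp_all [Y, Z]
  have huY : u ∈ Y := by simp [Y, hu, hr.refl u]
  have hvZ : v ∈ Z := by simp [Z, hv, huv]
  have hY := hM Y ⟨u, huY⟩ fun h => huv (mem_filter.1 (h.symm ▸ mem_univ v :)).2.2
  have hZ := hM Z ⟨v, hvZ⟩ fun h => (mem_filter.1 (h.symm ▸ mem_univ u :)).2.2 (hr.refl u)
  omega

variable (M A) in
open Classical in
/-- The vertex, face or outer region to which a dart belongs once the outer edges are undone:
outside `A` the vertex, and inside `A` the inner face or else the outer region `none`. -/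
noncomputable def region (d : V × Fin 3) : V ⊕ Option (Quot M.face.SameCycle) :=
  if d.1 ∈ A then .inr (if d ∈ M.innerDarts A then some (Quot.mk _ d) else none) else .inl d.1

theorem region_face_mul_apply {τ : Equiv.Perm (V × Fin 3)}
    (hτ : ∀ d, τ d = if d ∈ M.outerDarts A then M.inv d else d) (d : V × Fin 3) :
    M.region A ((M.face * τ) d) = M.region A d := by
  rw [Equiv.Perm.mul_apply, hτ]
  split_ifs with hd
  · rw [face_inv]
    by_cases hdA : d.1 ∈ A
    · have hinv : (M.inv d).1 ∉ A := fun h => mem_outerDarts.1 hd ⟨hdA, h⟩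
      have hinner : d ∉ M.innerDarts A := fun h => hinv (inv_fst_mem_of_mem_innerDarts h)
      simp only [region, hdA, if_true, hinner, rot_notMem_innerDarts hinv, if_false]
    · simp only [region, hdA, if_false]
  · rw [mem_outerDarts, not_not] at hd
    have hface : (M.face d).1 ∈ A := hd.2
    have hclass : Quot.mk M.face.SameCycle (M.face d) = Quot.mk _ d :=
      Quot.sound (sameCycle_apply_left.2 (SameCycle.refl _ _))
    simp only [region, hface, hd.1, if_true, face_mem_innerDarts, hclass]

theorem card_compl_add_card_innerFaces_add_one_le {τ : Equiv.Perm (V × Fin 3)}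
    (hτ : ∀ d, τ d = if d ∈ M.outerDarts A then M.inv d else d) (hpos : 0 < M.cut A) :
    #Aᶜ + (#(M.innerFaces A) + 1) ≤ numCycles (M.face * τ) := by
  classical
  obtain ⟨d₀, hd₀⟩ := card_pos.1 hpos
  rw [mem_filter_univ] at hd₀
  have hd₀' : d₀ ∉ M.innerDarts A := fun h => hd₀.2 (inv_fst_mem_of_mem_innerDarts h)
  refine le_trans ?_ (card_image_le_numClasses (M.region A) fun _ _ =>
    apply_eq_of_sameCycle (region_face_mul_apply hτ))
  rw [← card_insertNone, ← card_disjSum]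
  refine card_le_card fun z hz => mem_image.2 ?_
  rcases mem_disjSum.1 hz with ⟨v, hv, rfl⟩ | ⟨_ | q, hq, rfl⟩
  · exact ⟨(v, 0), mem_univ _, by simp [region, mem_compl.1 hv]⟩
  · exact ⟨d₀, mem_univ _, by simp [region, hd₀.1, hd₀']⟩
  · obtain ⟨d, hd, rfl⟩ := mem_image.1 (some_mem_insertNone.1 hq)
    exact ⟨d, mem_univ _, by simp [region, hd, fst_mem_of_mem_innerDarts hd]⟩

theorem eqvGen_of_fst_notMem (hM : M.TwoConn) (hcut : M.cut A ≤ 3)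
    {r : V × Fin 3 → V × Fin 3 → Prop} (hface : ∀ d, EqvGen r d (M.face d))
    (hinv : ∀ d ∈ M.outerDarts A, EqvGen r d (M.inv d)) {x y : V × Fin 3} (hx : x.1 ∉ A)
    (hy : y.1 ∉ A) : EqvGen r x y := by
  have hequiv := EqvGen.is_equivalence r
  have hinv' {d : V × Fin 3} (hd : d.1 ∉ A) : EqvGen r d (M.inv d) :=
    hinv d (mem_outerDarts.2 fun h => hd h.1)
  have hrot {d : V × Fin 3} (hd : d.1 ∉ A) : EqvGen r d (d.1, d.2 + 1) :=
    hequiv.trans (hinv' hd) (M.face_inv d ▸ hface _)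
  have hvertex {d : V × Fin 3} (hd : d.1 ∉ A) : EqvGen r (d.1, 0) d := by
    obtain ⟨v, i⟩ := d
    have h01 : EqvGen r (v, 0) (v, 1) := hrot (d := (v, 0)) hd
    have h12 : EqvGen r (v, 1) (v, 2) := hrot (d := (v, 1)) hd
    fin_cases i
    exacts [.refl _, h01, hequiv.trans h01 h12]
  have hzero : EqvGen r (x.1, 0) (y.1, 0) :=
    rel_of_notMem_of_cut_le_three (r := fun u v => EqvGen r (u, 0) (v, 0)) hM hcut
      (hequiv.comap fun v => (v, 0)) (fun d hd hd' =>
        hequiv.trans (hvertex hd) (hequiv.trans (hinv' hd) (hequiv.symm (hvertex hd')))) hx hy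
  exact hequiv.trans (hequiv.symm (hvertex hx)) (hequiv.trans hzero (hvertex hy))

theorem numClasses_le_card_innerFaces_add_one (hM : M.TwoConn) (hcut : M.cut A ≤ 3)
    {r : V × Fin 3 → V × Fin 3 → Prop} (hface : ∀ d, EqvGen r d (M.face d))
    (hinv : ∀ d ∈ M.outerDarts A, EqvGen r d (M.inv d)) :
    numClasses r ≤ #(M.innerFaces A) + 1 := by
  classical
  have hout {d : V × Fin 3} (hd : d ∉ M.innerDarts A) : ∃ x, x.1 ∉ A ∧ EqvGen r d x := by
    rw [mem_innerDarts] at hd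
    push Not at hd
    obtain ⟨x, hdx, hx⟩ := hd
    exact ⟨x, hx, eqvGen_of_sameCycle hface hdx⟩
  rw [← card_insertNone]
  refine numClasses_le_card
    (fun d => if d ∈ M.innerDarts A then some (Quot.mk M.face.SameCycle d) else none) _
    (fun d => ?_) fun x y hxy => ?_
  · by_cases hd : d ∈ M.innerDarts A
    · rw [if_pos hd, some_mem_insertNone]
      exact mem_image_of_mem _ hd
    · rw [if_neg hd]
      exact none_mem_insertNone
  · by_cases hx : x ∈ M.innerDarts A <;> by_cases hy : y ∈ M.innerDarts A
    · simp only [hx, hy, if_true, Option.some.injEq] at hxy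
      exact eqvGen_of_sameCycle hface (Quotient.exact (s := SameCycle.setoid M.face) hxy)
    · simp [hx, hy] at hxy
    · simp [hx, hy] at hxy
    · obtain ⟨u, hu, hxu⟩ := hout hx
      obtain ⟨v, hv, hyv⟩ := hout hy
      exact hxu.trans _ _ _ ((eqvGen_of_fst_notMem hM hcut hface hinv hu hv).trans _ _ _ hyv.symm)

/- Euler's inequality for the map obtained from `face` by undoing the outer edges. -/
theorem card_add_two_le_cut_add_card_innerFaces (hM : M.TwoConn) (hP : M.Planar)
    (hcut : M.cut A ≤ 3) (hpos : 0 < M.cut A) :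
    #A + 2 ≤ M.cut A + 2 * #(M.innerFaces A) := by
  obtain ⟨l, hlength, hmem, hprod⟩ := exists_swapProd_eq_of_involutive M.inv_involutive
    (M.outerDarts A) (fun _ => inv_mem_outerDarts) fun d _ => M.inv_ne d
  have hEuler := numCycles_add_numCycles_mul_swapProd_le M.face l
  have hplanar := hP.card_add_four_le
  have hlower := card_compl_add_card_innerFaces_add_one_le hprod hpos
  have hupper : numClasses (withPairs M.face.SameCycle l) ≤ #(M.innerFaces A) + 1 :=
    numClasses_le_card_innerFaces_add_one hM hcut (fun d => .rel _ _ (Or.inl ⟨1, rfl⟩))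
      fun d hd => (hmem d hd).elim (fun h => .rel _ _ (Or.inr h))
        fun h => .symm _ _ (.rel _ _ (Or.inr h))
  have hcard := card_add_card_compl A
  rw [card_outerDarts] at hlength
  omega

theorem numCycles_face_le_card_innerFaces_univ : numCycles M.face ≤ #(M.innerFaces univ) := by
  classical
  exact numClasses_le_card (r := M.face.SameCycle) (Quot.mk _) _
    (fun x => mem_image_of_mem _ (mem_innerDarts.2 fun _ _ => mem_univ _))
    fun x y h => Quot.eqvGen_exact h

theorem cut_erase_eq_zero {v : V} (hcut : M.cut A ≤ 3)
    (hv : ∀ j, (v, j) ∈ ({d | d.1 ∈ A ∧ (M.inv d).1 ∉ A} : Finset (V × Fin 3))) :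
    M.cut (A.erase v) = 0 := by
  have himage : univ.image (fun j => (v, j)) =
      ({d | d.1 ∈ A ∧ (M.inv d).1 ∉ A} : Finset (V × Fin 3)) := by
    refine eq_of_subset_of_card_le (image_subset_iff.2 fun j _ => hv j) ?_
    rwa [card_image_of_injective _ (Prod.mk_right_injective v), card_univ, Fintype.card_fin]
  rw [cut, card_eq_zero, filter_eq_empty_iff]
  rintro d - ⟨hd, hinv⟩
  rw [mem_erase] at hd
  have hinvA : (M.inv d).1 ∈ A := by
    by_contra hinvA
    have hmem := mem_filter_univ (p := fun d => d.1 ∈ A ∧ (M.inv d).1 ∉ A) d |>.2 ⟨hd.2, hinvA⟩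
    rw [← himage] at hmem
    obtain ⟨j, -, rfl⟩ := mem_image.1 hmem
    exact hd.1 rfl
  have hinvv : (M.inv d).1 = v := by
    by_contra hne
    exact hinv (mem_erase.2 ⟨hne, hinvA⟩)
  have hback := (mem_filter.1 (hv (M.inv d).2)).2.2
  rw [← hinvv, Prod.mk.eta, M.inv_inv] at hback
  exact hback hd.2

theorem card_innerDarts_lt_of_cut_pos (hM : M.TwoConn) (hcard : 2 ≤ #A) (hcut : M.cut A ≤ 3)
    (hpos : 0 < M.cut A) : M.cut A + #(M.innerDarts A) < 3 * #A := by
  classical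
  let C : Finset (V × Fin 3) := {d | d.1 ∈ A ∧ (M.inv d).1 ∉ A}
  let N := ({d | d.1 ∈ A} : Finset (V × Fin 3)) \ M.innerDarts A
  have hN : #N + #(M.innerDarts A) = 3 * #A := by
    rw [← card_filter_fst_mem]
    exact card_sdiff_add_card_eq_card fun d hd =>
      mem_filter.2 ⟨mem_univ _, fst_mem_of_mem_innerDarts hd⟩
  have hCN : C ⊆ N := fun d hd => by
    have hd := (mem_filter.1 hd).2
    exact mem_sdiff.2 ⟨by simpa using hd.1, fun h => hd.2 (inv_fst_mem_of_mem_innerDarts h)⟩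
  have hrot : ∀ d ∈ C, (d.1, d.2 + 1) ∈ N := fun d hd => by
    have hd := (mem_filter.1 hd).2
    exact mem_sdiff.2 ⟨by simpa using hd.1, rot_notMem_innerDarts hd.2⟩
  suffices C ≠ N from hN ▸ Nat.add_lt_add_right (card_lt_card (hCN.ssubset_of_ne this)) _
  intro hCN
  obtain ⟨⟨v, i⟩, hv⟩ := card_pos.1 hpos
  have hstar := forall_snd_mem_of_rot_mem (C := C) (fun d hd => hCN ▸ hrot d hd) hv
  have hvA : v ∈ A := (mem_filter.1 hv).2.1
  have hzero := cut_erase_eq_zero hcut hstar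
  have htwo := hM (A.erase v) (card_pos.1 (by rw [card_erase_of_mem hvA]; omega))
    fun h => notMem_erase v A (h ▸ mem_univ v)
  omega

/- Otherwise every face inside `A` has at least six darts, against Euler's formula for `A`. -/
theorem IsAtom.exists_short_face (hA : M.IsAtom A) (hM : M.TwoConn) (hP : M.Planar) :
    ∃ d ∈ M.innerDarts A, ∃ k, 0 < k ∧ k < 6 ∧ (M.face ^ k) d = d := by
  classical
  by_contra! hlong
  have hsix : 6 * #(M.innerFaces A) ≤ #(M.innerDarts A) :=
    mul_card_image_mk_sameCycle_le_card (fun x => face_mem_innerDarts.2) hlong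
  have hcard := hA.two_le_card
  have hcut := hA.cut_le
  rcases Nat.eq_zero_or_pos (M.cut A) with hzero | hpos
  · have hAuniv : A = univ := by
      by_contra hne
      have := hM A (card_pos.1 (by omega)) hne
      omega
    subst hAuniv
    have hplanar := hP.card_add_four_le
    have hfaces := numCycles_face_le_card_innerFaces_univ (M := M)
    have hdarts : #(M.innerDarts univ) ≤ Fintype.card (V × Fin 3) := card_le_univ _
    rw [Fintype.card_prod, Fintype.card_fin] at hdarts
    omega
  · have hEuler := card_add_two_le_cut_add_card_innerFaces hM hP hcut hpos
    have hdarts := card_innerDarts_lt_of_cut_pos hM hcard hcut hpos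
    omega

end CubicMap

/-! ### Pairs of involutions -/

section Involutions

open Relation Function Equiv.Perm

variable {F : Type*}

theorem zpow_apply_eq_zpow_apply_iff (f : Equiv.Perm F) (x : F) (j k : ℤ) :
    (f ^ j) x = (f ^ k) x ↔ (minimalPeriod f x : ℤ) ∣ j - k := by
  have hdvd : (f ^ (j - k)) x = x ↔ (minimalPeriod f x : ℤ) ∣ j - k :=
    MulAction.zpow_smul_eq_iff_minimalPeriod_dvd (a := f) (b := x)
  rw [← hdvd, sub_eq_neg_add, zpow_add, mul_apply, zpow_neg, inv_eq_iff_eq]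

variable {a b : F → F}

theorem apply_zpow_toPerm_mul_left (ha : Involutive a) (hb : Involutive b) (k : ℤ) (x : F) :
    a (((ha.toPerm * hb.toPerm) ^ k) x) = ((ha.toPerm * hb.toPerm) ^ (-k)) (a x) := by
  have hconj : SemiconjBy ha.toPerm (ha.toPerm * hb.toPerm) (ha.toPerm * hb.toPerm)⁻¹ := by
    ext y
    rw [mul_apply, mul_apply _ ha.toPerm, eq_inv_iff_eq]
    simp only [mul_apply, Involutive.coe_toPerm, ha _, hb _]
  have h := hconj.zpow_right k
  rw [inv_zpow'] at h
  exact congrArg (fun g : Equiv.Perm F => g x) h.eq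

theorem apply_zpow_toPerm_mul_right (ha : Involutive a) (hb : Involutive b) (k : ℤ) (x : F) :
    b (((ha.toPerm * hb.toPerm) ^ k) x) = ((ha.toPerm * hb.toPerm) ^ (-(k + 1))) (a x) := by
  rw [← apply_zpow_toPerm_mul_left ha hb, add_comm, zpow_one_add]
  exact (ha _).symm

theorem not_sameCycle_toPerm_mul_apply (ha : Involutive a) (hb : Involutive b)
    (ha' : ∀ x, a x ≠ x) (hb' : ∀ x, b x ≠ x) (x : F) :
    ¬ (ha.toPerm * hb.toPerm).SameCycle x (a x) := by
  rintro ⟨n, hn⟩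
  rcases Int.even_or_odd' n with ⟨k, rfl | rfl⟩
  · refine ha' (((ha.toPerm * hb.toPerm) ^ k) x) ?_
    rw [apply_zpow_toPerm_mul_left ha hb, ← hn, ← mul_apply, ← zpow_add, two_mul,
      neg_add_cancel_left]
  · refine hb' (((ha.toPerm * hb.toPerm) ^ k) x) ?_
    rw [apply_zpow_toPerm_mul_right ha hb, ← hn, ← mul_apply, ← zpow_add]
    congr 2
    ring

theorem exists_coloring_of_involutive (ha : Involutive a) (ha' : ∀ x, a x ≠ x) :
    ∃ col : F → Bool, ∀ x, col (a x) = !col x := by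
  classical
  obtain ⟨_, -⟩ := exists_wellFoundedLT F
  refine ⟨fun x => decide (x < a x), fun x => ?_⟩
  change decide (a x < a (a x)) = !decide (x < a x)
  rw [ha, ← decide_not, decide_eq_decide, not_lt, (ha' x).le_iff_lt]

/- The orbits of `a ∘ b` are permuted by `a` and by `b` in the same way, without fixed points. -/
theorem exists_common_coloring_of_involutive (ha : Involutive a) (hb : Involutive b)
    (ha' : ∀ x, a x ≠ x) (hb' : ∀ x, b x ≠ x) :
    ∃ col : F → Bool, (∀ x, col (a x) = !col x) ∧ ∀ x, col (b x) = !col x := by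
  let π := ha.toPerm * hb.toPerm
  have hmaps (x y : F) (h : π.SameCycle x y) : π.SameCycle (a x) (a y) := by
    obtain ⟨k, rfl⟩ := h
    exact ⟨-k, (apply_zpow_toPerm_mul_left ha hb k x).symm⟩
  have hab (x : F) : Quot.mk π.SameCycle (b x) = Quot.mk _ (a x) :=
    Quot.sound (SameCycle.symm ⟨-1, (apply_zpow_toPerm_mul_right ha hb 0 x).symm⟩)
  obtain ⟨col, hcol⟩ := exists_coloring_of_involutive (a := Quot.map a hmaps)
    (by rintro ⟨x⟩; exact congrArg (Quot.mk _) (ha x)) (by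
      rintro ⟨x⟩ h
      exact not_sameCycle_toPerm_mul_apply ha hb ha' hb' x
        (Quotient.exact (s := SameCycle.setoid π) h).symm)
  exact ⟨fun x => col (Quot.mk _ x), fun x => hcol (Quot.mk _ x),
    fun x => (congrArg col (hab x)).trans (hcol (Quot.mk _ x))⟩

/-- The relation whose classes are the orbits of the group generated by `a` and `b`. -/
def DihedralStep (a b : F → F) (x y : F) : Prop := a x = y ∨ b x = y

theorem eqvGen_dihedralStep_iff_sameCycle (ha : Involutive a) (hb : Involutive b) {x y : F}
    (hx : a x = x) :
    EqvGen (DihedralStep a b) x y ↔ (ha.toPerm * hb.toPerm).SameCycle x y := by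
  refine ⟨fun h => ?_, eqvGen_of_sameCycle fun z =>
    (EqvGen.rel z (b z) (Or.inr rfl)).trans _ _ _ (.rel _ _ (Or.inl rfl))⟩
  have ha_iff (z : F) (h : (ha.toPerm * hb.toPerm).SameCycle x z) :
      (ha.toPerm * hb.toPerm).SameCycle x (a z) := by
    obtain ⟨k, rfl⟩ := h
    exact ⟨-k, by rw [apply_zpow_toPerm_mul_left ha hb, hx]⟩
  have hb_iff (z : F) (h : (ha.toPerm * hb.toPerm).SameCycle x z) :
      (ha.toPerm * hb.toPerm).SameCycle x (b z) := by
    obtain ⟨k, rfl⟩ := h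
    exact ⟨-(k + 1), by rw [apply_zpow_toPerm_mul_right ha hb, hx]⟩
  refine (apply_eq_of_eqvGen (f := (ha.toPerm * hb.toPerm).SameCycle x) ?_ h).mp
    (SameCycle.refl _ _)
  rintro z w (rfl | rfl)
  · exact propext ⟨ha_iff z, fun h => ha z ▸ ha_iff _ h⟩
  · exact propext ⟨hb_iff z, fun h => hb z ▸ hb_iff _ h⟩

/- On the orbit, identified with `ℤ / n` so that `x` is `0`, the involutions are `k ↦ -k` and
`k ↦ -k - 1`. As the latter has no fixed point, `n` is even and the former fixes `0` and `n / 2`. -/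
theorem exists_other_fixed_point [Finite F] (ha : Involutive a) (hb : Involutive b)
    (hb' : ∀ x, b x ≠ x) {x : F} (hx : a x = x) :
    ∃ y, y ≠ x ∧ a y = y ∧ EqvGen (DihedralStep a b) x y ∧
      ∀ z, a z = z → EqvGen (DihedralStep a b) x z → z = x ∨ z = y := by
  simp only [eqvGen_dihedralStep_iff_sameCycle ha hb hx]
  set π := ha.toPerm * hb.toPerm
  have ha_zpow (k : ℤ) : a ((π ^ k) x) = (π ^ (-k)) x := by
    rw [apply_zpow_toPerm_mul_left ha hb, hx]
  have heven : ¬ Odd (minimalPeriod π x) := by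
    rintro ⟨k, hk⟩
    refine hb' ((π ^ (k : ℤ)) x) ?_
    rw [apply_zpow_toPerm_mul_right ha hb, hx, zpow_apply_eq_zpow_apply_iff]
    exact ⟨-1, by rw [hk]; push_cast; ring⟩
  obtain ⟨l, hl⟩ := Nat.not_odd_iff_even.1 heven
  have hl_pos : 0 < minimalPeriod π x :=
    minimalPeriod_pos_of_mem_periodicPts (π.injective.mem_periodicPts x)
  refine ⟨(π ^ (l : ℤ)) x, fun h => ?_, ?_, ⟨l, rfl⟩, ?_⟩
  · have hdvd := (zpow_apply_eq_zpow_apply_iff π x l 0).1 h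
    rw [sub_zero, Int.natCast_dvd_natCast] at hdvd
    have := Nat.le_of_dvd (by omega) hdvd
    omega
  · rw [ha_zpow, zpow_apply_eq_zpow_apply_iff, hl]
    exact ⟨-1, by push_cast; ring⟩
  · rintro _ hz ⟨k, rfl⟩
    rw [ha_zpow, zpow_apply_eq_zpow_apply_iff, hl] at hz
    obtain ⟨t, ht⟩ := hz
    have hk : k = -(l * t) := by push_cast at ht; linarith
    rcases Int.even_or_odd' t with ⟨u, rfl | rfl⟩
    · refine Or.inl ((zpow_apply_eq_zpow_apply_iff π x k 0).2 ⟨-u, ?_⟩)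
      rw [hk, hl]
      push_cast
      ring
    · refine Or.inr ((zpow_apply_eq_zpow_apply_iff π x k l).2 ⟨-u - 1, ?_⟩)
      rw [hk, hl]
      push_cast
      ring

end Involutions

/-! ### Strands -/

section Strands

open Relation Function

/-- The corners on the two sides of an edge are linked along the edge, crosswise if the edge is
twisted. The map `β` reverses the darts; its fixed points are loose ends. The classes of corners
generated by the links are the strands: for a suitable twist these are the circuits of a double
cover. -/
def Link {V : Type*} (β : V × Fin 3 → V × Fin 3) (T : V × Fin 3 → Bool) (p q : V × Fin 3) : Prop :=
  ∃ d b, β d ≠ d ∧ p = crn d b ∧ q = crn (β d) (xor (!b) (T d))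

/-- No strand passes twice through a vertex. -/
def StrandsValid {V : Type*} (β : V × Fin 3 → V × Fin 3) (T : V × Fin 3 → Bool) : Prop :=
  ∀ v i j, i ≠ j → ¬ EqvGen (Link β T) (v, i) (v, j)

/-- A flag is a side of a dart. It lies at a corner, and this is the other flag at that corner. -/
def otherFlag {V : Type*} (x : (V × Fin 3) × Bool) : (V × Fin 3) × Bool :=
  bif x.2 then ((x.1.1, x.1.2 + 1), false) else ((x.1.1, x.1.2 + 2), true)

section Corner

variable {V : Type*}

theorem otherFlag_involutive : Involutive (otherFlag (V := V)) := by
  rintro ⟨⟨v, i⟩, b⟩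
  cases b <;> simp [otherFlag, add_assoc, show (1 + 2 : Fin 3) = 0 from rfl,
    show (2 + 1 : Fin 3) = 0 from rfl]

theorem otherFlag_ne (x : (V × Fin 3) × Bool) : otherFlag x ≠ x := by
  obtain ⟨⟨v, i⟩, b⟩ := x
  cases b <;> simp [otherFlag]

theorem crn_otherFlag (x : (V × Fin 3) × Bool) :
    crn (otherFlag x).1 (otherFlag x).2 = crn x.1 x.2 := by
  obtain ⟨⟨v, i⟩, b⟩ := x
  cases b <;> simp [otherFlag, crn, add_assoc, show (1 + 1 : Fin 3) = 2 from rfl,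
    show (2 + 2 : Fin 3) = 1 from rfl]

theorem eq_or_eq_otherFlag_of_crn_eq {x y : (V × Fin 3) × Bool}
    (h : crn x.1 x.2 = crn y.1 y.2) : y = x ∨ y = otherFlag x := by
  obtain ⟨⟨v, i⟩, b⟩ := x
  obtain ⟨⟨w, j⟩, c⟩ := y
  obtain ⟨rfl, h⟩ := Prod.mk.inj h
  have hcases : ∀ (i j : Fin 3) (b c : Bool),
      (bif b then i + 2 else i + 1) = (bif c then j + 2 else j + 1) →
      (j = i ∧ c = b) ∨ (c = !b ∧ j = bif b then i + 1 else i + 2) := by decide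
  rcases hcases i j b c h with ⟨rfl, rfl⟩ | ⟨rfl, rfl⟩
  · exact Or.inl rfl
  · cases b <;> exact Or.inr rfl

end Corner

section Flags

variable {V : Type*} [DecidableEq V] (β : V × Fin 3 → V × Fin 3) (T : V × Fin 3 → Bool)

/-- Crossing an edge along a strand; flags at loose ends are fixed. -/
def crossFlag (x : (V × Fin 3) × Bool) : (V × Fin 3) × Bool :=
  if β x.1 = x.1 then x else (β x.1, xor (!x.2) (T x.1))

variable {β T}

theorem crossFlag_eq_self_iff {x : (V × Fin 3) × Bool} :
    crossFlag β T x = x ↔ β x.1 = x.1 := by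
  refine ⟨fun h => ?_, fun h => if_pos h⟩
  by_contra hd
  rw [crossFlag, if_neg hd] at h
  exact hd (congrArg Prod.fst h)

theorem crossFlag_involutive (hβ : Involutive β) (hT : ∀ d, T (β d) = T d) :
    Involutive (crossFlag β T) := by
  rintro ⟨d, b⟩
  by_cases hd : β d = d
  · simp [crossFlag, hd]
  · have hcross : crossFlag β T (d, b) = (β d, xor (!b) (T d)) := if_neg hd
    rw [hcross, crossFlag, hβ d, if_neg (Ne.symm hd), hT]
    cases b <;> cases T d <;> rfl

theorem eqvGen_dihedralStep_of_crn_eq {x y : (V × Fin 3) × Bool}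
    (h : crn x.1 x.2 = crn y.1 y.2) :
    EqvGen (DihedralStep (crossFlag β T) otherFlag) x y := by
  rcases eq_or_eq_otherFlag_of_crn_eq h with rfl | rfl
  · exact .refl _
  · exact .rel _ _ (Or.inr rfl)

theorem eqvGen_dihedralStep_iff_eqvGen_link {x y : (V × Fin 3) × Bool} :
    EqvGen (DihedralStep (crossFlag β T) otherFlag) x y ↔
      EqvGen (Link β T) (crn x.1 x.2) (crn y.1 y.2) := by
  have hequiv := EqvGen.is_equivalence (DihedralStep (crossFlag β T) otherFlag)
  constructor
  · refine eqvGen_map (f := fun x : (V × Fin 3) × Bool => crn x.1 x.2) ?_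
    rintro x y (rfl | rfl)
    · by_cases hd : β x.1 = x.1
      · rw [crossFlag_eq_self_iff.2 hd]
        exact .refl _
      · rw [crossFlag, if_neg hd]
        exact .rel _ _ ⟨x.1, x.2, hd, rfl, rfl⟩
    · rw [crn_otherFlag]
      exact .refl _
  · choose flag hflag using crn_false_surjective (V := V)
    have hflag' {x : (V × Fin 3) × Bool} : EqvGen (DihedralStep (crossFlag β T) otherFlag)
        (flag (crn x.1 x.2), false) x := eqvGen_dihedralStep_of_crn_eq (hflag _)
    intro h
    refine hequiv.trans (hequiv.symm hflag') (hequiv.trans ?_ hflag')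
    refine eqvGen_map (f := fun p => (flag p, false)) ?_ h
    rintro _ _ ⟨d, b, hd, rfl, rfl⟩
    have hcross : crossFlag β T (d, b) = (β d, xor (!b) (T d)) := if_neg hd
    exact hequiv.trans (hflag' (x := (d, b))) (hequiv.trans (.rel _ _ (Or.inl hcross))
      (hequiv.symm (hflag' (x := (β d, xor (!b) (T d))))))

end Flags

/-- A cubic map with `k` loose ends. -/
structure OpenMap (V : Type*) (k : ℕ) where
  /-- Reversing a dart; loose ends are fixed. -/
  inv : V × Fin 3 → V × Fin 3
  inv_involutive : Involutive inv
  /-- The loose ends. -/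
  leg : Fin k → V × Fin 3
  leg_injective : Injective leg
  inv_eq_self_iff : ∀ d, inv d = d ↔ ∃ i, leg i = d

/-- The label of a strand end `(i, b)` on the side `b` of the `i`-th loose end. Every strand has
exactly one end `(i, ε i)`, which gives it the label `i`; the strand ending at `(i, !ε i)` has the
label `p i`. -/
def pathLabel {K : Type*} (p : K → K) (ε : K → Bool) (x : K × Bool) : K :=
  if x.2 = ε x.1 then x.1 else p x.1

/- Colour the ends so that the two ends at a loose end, and also the two ends of a strand, get
different colours, and select the ends of colour `true`. -/
theorem exists_snd_eq_iff_snd_ne_of_involutive {K : Type*} {ρ : K × Bool → K × Bool}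
    (hρ : Involutive ρ) (hρ_ne : ∀ x, ρ x ≠ x) :
    ∃ ε : K → Bool, ∀ x, (ρ x).2 = ε (ρ x).1 ↔ x.2 ≠ ε x.1 := by
  obtain ⟨col, hcol_not, hcol_ρ⟩ := exists_common_coloring_of_involutive
    (a := fun x : K × Bool => (x.1, !x.2)) (b := ρ) (fun x => by simp) hρ
    (fun x h => by simpa using congrArg Prod.snd h) hρ_ne
  have hcol (x : K × Bool) : x.2 = col (x.1, true) ↔ col x = true := by
    obtain ⟨i, b⟩ := x
    have hfalse : col (i, false) = !col (i, true) := hcol_not (i, true)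
    cases b
    · rw [hfalse, Bool.not_eq_true', eq_comm]
    · exact eq_comm
  refine ⟨fun i => col (i, true), fun x => ?_⟩
  rw [hcol, ne_eq, hcol, hcol_ρ, Bool.not_eq_true', Bool.not_eq_true]

/- Each strand is labelled by its selected end. -/
theorem exists_pathLabel_eq_iff_of_involutive {K : Type*} {ρ : K × Bool → K × Bool}
    (hρ : Involutive ρ) (hρ_ne : ∀ x, ρ x ≠ x) :
    ∃ (p : K → K) (ε : K → Bool), Injective p ∧
      ∀ x y, pathLabel p ε x = pathLabel p ε y ↔ y = x ∨ y = ρ x := by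
  obtain ⟨ε, hε⟩ := exists_snd_eq_iff_snd_ne_of_involutive hρ hρ_ne
  let top (x : K × Bool) : K × Bool := if x.2 = ε x.1 then x else ρ x
  have htop_mem (x : K × Bool) : (top x).2 = ε (top x).1 := by
    by_cases hx : x.2 = ε x.1
    · simpa only [top, if_pos hx] using hx
    · simpa only [top, if_neg hx] using (hε x).2 hx
  have htop_inj {x y : K × Bool} (h : (top x).1 = (top y).1) : top x = top y :=
    Prod.ext h (by rw [htop_mem x, htop_mem y, h])
  have htop_ρ (x : K × Bool) : top (ρ x) = top x := by
    by_cases hx : x.2 = ε x.1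
    · simp only [top, if_pos hx, if_neg fun h => (hε x).1 h hx, hρ x]
    · simp only [top, if_neg hx, if_pos ((hε x).2 hx)]
  have htop_not (i : K) : top (i, !ε i) = ρ (i, !ε i) := if_neg (Bool.not_ne_self _)
  have hlabel (x : K × Bool) : pathLabel (fun i => (top (i, !ε i)).1) ε x = (top x).1 := by
    obtain ⟨i, b⟩ := x
    by_cases hb : b = ε i
    · simp only [pathLabel, if_pos hb, top]
    · simp only [pathLabel, hb, if_false, ← Bool.eq_not.2 hb]
  refine ⟨fun i => (top (i, !ε i)).1, ε, fun i j hij => ?_, fun x y => ?_⟩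
  · have h := htop_inj hij
    rw [htop_not, htop_not] at h
    exact congrArg Prod.fst (hρ.injective h)
  rw [hlabel, hlabel]
  refine ⟨fun h => ?_, ?_⟩
  · have h := htop_inj h
    simp only [top] at h
    split_ifs at h
    exacts [Or.inl h.symm, Or.inr (by rw [h, hρ]), Or.inr h.symm, Or.inl (hρ.injective h.symm)]
  · rintro (rfl | rfl)
    exacts [rfl, (congrArg Prod.fst (htop_ρ x)).symm]

namespace OpenMap

variable {V : Type*} {k : ℕ} {O : OpenMap V k}

variable (O) in
/-- The two corners at a loose end. -/
def legEnd (x : Fin k × Bool) : V × Fin 3 := crn (O.leg x.1) x.2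

theorem exists_pairing [Finite V] {T : V × Fin 3 → Bool} (hT : ∀ d, T (O.inv d) = T d) :
    ∃ ρ : Fin k × Bool → Fin k × Bool, Involutive ρ ∧ (∀ x, ρ x ≠ x) ∧
      ∀ x y, EqvGen (Link O.inv T) (O.legEnd x) (O.legEnd y) ↔ y = x ∨ y = ρ x := by
  classical
  let flag (x : Fin k × Bool) : (V × Fin 3) × Bool := (O.leg x.1, x.2)
  have hflag_inj : Injective flag := fun x y h =>
    Prod.ext (O.leg_injective (Prod.mk.inj h).1) (Prod.mk.inj h).2
  have hflag (f : (V × Fin 3) × Bool) : crossFlag O.inv T f = f ↔ ∃ x, flag x = f := by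
    rw [crossFlag_eq_self_iff, O.inv_eq_self_iff]
    exact ⟨fun ⟨i, hi⟩ => ⟨(i, f.2), Prod.ext hi rfl⟩, fun ⟨x, hx⟩ => ⟨x.1, congrArg Prod.fst hx⟩⟩
  have hother (x : Fin k × Bool) :
      ∃ y, y ≠ x ∧ EqvGen (Link O.inv T) (O.legEnd x) (O.legEnd y) ∧
        ∀ z, EqvGen (Link O.inv T) (O.legEnd x) (O.legEnd z) → z = x ∨ z = y := by
    obtain ⟨f, hne, hf, hjoin, hunique⟩ := exists_other_fixed_point
      (crossFlag_involutive O.inv_involutive hT) otherFlag_involutive otherFlag_ne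
      ((hflag (flag x)).2 ⟨x, rfl⟩)
    obtain ⟨y, rfl⟩ := (hflag f).1 hf
    exact ⟨y, fun h => hne (congrArg flag h), eqvGen_dihedralStep_iff_eqvGen_link.1 hjoin,
      fun z hz => (hunique (flag z) ((hflag _).2 ⟨z, rfl⟩)
        (eqvGen_dihedralStep_iff_eqvGen_link.2 hz)).imp (fun h => hflag_inj h)
        fun h => hflag_inj h⟩
  choose ρ hne hjoin hunique using hother
  refine ⟨ρ, fun x => ?_, hne, fun x y => ⟨hunique x y, ?_⟩⟩
  · exact ((hunique (ρ x) x (hjoin x).symm).resolve_left (hne x).symm).symm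
  · rintro (rfl | rfl)
    exacts [.refl _, hjoin x]

/-- The labels given by `p` and `ε` distinguish the strands that reach a loose end. -/
def IsStrandLabel (O : OpenMap V k) (T : V × Fin 3 → Bool) (p : Fin k → Fin k)
    (ε : Fin k → Bool) : Prop :=
  ∀ x y, EqvGen (Link O.inv T) (O.legEnd x) (O.legEnd y) ↔ pathLabel p ε x = pathLabel p ε y

theorem exists_isStrandLabel [Finite V] {T : V × Fin 3 → Bool} (hT : ∀ d, T (O.inv d) = T d) :
    ∃ (p : Fin k → Fin k) (ε : Fin k → Bool), Injective p ∧ O.IsStrandLabel T p ε := by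
  obtain ⟨ρ, hρ, hρ_ne, hjoin⟩ := exists_pairing hT
  obtain ⟨p, ε, hp, hlabel⟩ := exists_pathLabel_eq_iff_of_involutive hρ hρ_ne
  exact ⟨p, ε, hp, fun x y => (hjoin x y).trans (hlabel x y).symm⟩

end OpenMap

end Strands

/-! ### Gluing gadgets to the loose ends of a map -/

section Gadgets

open Relation Function

/-- The ends available to the edges of a gadget with `m` vertices that is glued to `k` loose ends:
the darts of the gadget and the loose ends. -/
abbrev Port (k m : ℕ) : Type := (Fin m × Fin 3) ⊕ Fin k

/-- A gadget that can be glued to `k` loose ends: a cubic graph with `order` vertices and some edges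
leading to the loose ends, given by a list of edges that uses every port exactly once. -/
structure Gadget (k : ℕ) where
  /-- The number of vertices. -/
  order : ℕ
  /-- The edges. -/
  edges : List (Port k order × Port k order)
  port_bijective : Bijective fun x : Fin edges.length × Bool =>
    bif x.2 then (edges.get x.1).2 else (edges.get x.1).1

namespace Gadget

variable {k : ℕ} (g : Gadget k)

/-- The two ends of an edge. -/
def port (x : Fin g.edges.length × Bool) : Port k g.order :=
  bif x.2 then (g.edges.get x.1).2 else (g.edges.get x.1).1

/-- The number of the strand on a side of a port. The outer strands are numbered by their labels
below `k`, and the corner `(w, i)` of the gadget has the number `k + 3 * w + i`. -/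
def node {k m : ℕ} (p : Fin k → Fin k) (ε : Fin k → Bool) : Port k m → Bool → ℕ
  | Sum.inl d, c => k + 3 * d.1 + (crn d c).2
  | Sum.inr i, c => (pathLabel p ε (i, c)).val

/-- The links along the edges of a gadget with twists `b`. -/
def NodeLink (p : Fin k → Fin k) (ε : Fin k → Bool) (b : Fin g.edges.length → Bool)
    (x y : ℕ) : Prop :=
  ∃ e c, x = node p ε (g.edges.get e).1 c ∧ y = node p ε (g.edges.get e).2 (xor (!c) (b e))

/-- The twists `b` of a gadget are admissible if no vertex of the gadget is passed twice by a strand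
and no two conflicting outer strands are joined. -/
def Admissible (p : Fin k → Fin k) (ε : Fin k → Bool) (κ : Fin k → Fin k → Prop)
    (b : Fin g.edges.length → Bool) : Prop :=
  (∀ (w : Fin g.order) (i j : Fin 3), i ≠ j →
    ¬ EqvGen (g.NodeLink p ε b) (k + 3 * w + i) (k + 3 * w + j)) ∧
  ∀ x y : Fin k, κ x y → ¬ EqvGen (g.NodeLink p ε b) x y

/-- The number of admissible twists. -/
noncomputable def count (p : Fin k → Fin k) (ε : Fin k → Bool) (κ : Fin k → Fin k → Prop) : ℕ :=
  Nat.card {b : Fin g.edges.length → Bool // g.Admissible p ε κ b}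

end Gadget

/-- The twists of a cubic map for which no strand passes twice through a vertex. They correspond to
the circuit double covers. -/
abbrev CubicMap.ValidTwists {V : Type*} (M : CubicMap V) : Type _ :=
  {T : V × Fin 3 → Bool // (∀ d, T (M.inv d) = T d) ∧ StrandsValid M.inv T}

/-- The number of valid twists. -/
noncomputable def CubicMap.numCovers {V : Type*} (M : CubicMap V) : ℕ := Nat.card M.ValidTwists

/-- A realisation of the vertices of an open map and a gadget as the vertices of a single map. -/
structure Placement (V : Type*) {W : Type*} {k : ℕ} (O : OpenMap W k) (g : Gadget k) where
  /-- The identification of the vertices. -/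
  vertexEquiv : W ⊕ Fin g.order ≃ V
  /-- The shift of the numbering of the darts at the gadget vertices. -/
  shift : Fin g.order → Fin 3

namespace Placement

variable {V W : Type*} {k : ℕ} {O : OpenMap W k} {g : Gadget k} (P : Placement V O g)

/-- The darts of the open map as darts of the glued map. -/
def outerDart (d : W × Fin 3) : V × Fin 3 := (P.vertexEquiv (Sum.inl d.1), d.2)

/-- The ports of the gadget as darts of the glued map. -/
def portDart : Port k g.order → V × Fin 3 :=
  Sum.elim (fun d => (P.vertexEquiv (Sum.inr d.1), d.2 + P.shift d.1))
    fun i => P.outerDart (O.leg i)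

theorem outerDart_injective : Injective P.outerDart := by
  rintro ⟨u, i⟩ ⟨v, j⟩ h
  simpa [outerDart] using h

theorem portDart_injective : Injective P.portDart := by
  rintro (⟨u, i⟩ | i) (⟨v, j⟩ | j) h
  · simp only [portDart, Sum.elim_inl, Prod.mk.injEq, EmbeddingLike.apply_eq_iff_eq,
      Sum.inr.injEq] at h
    obtain ⟨rfl, h⟩ := h
    rw [add_right_cancel h]
  · simp [portDart, outerDart] at h
  · simp [portDart, outerDart] at h
  · rw [O.leg_injective (P.outerDart_injective h)]

theorem outerDart_ne_portDart {d : W × Fin 3} (hd : O.inv d ≠ d) (z : Port k g.order) :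
    P.outerDart d ≠ P.portDart z := by
  rcases z with w | i
  · simp [outerDart, portDart]
  · exact fun h => hd ((O.inv_eq_self_iff d).2 ⟨i, (P.outerDart_injective h).symm⟩)

theorem exists_outerDart_eq_or_exists_portDart_eq (d : V × Fin 3) :
    (∃ d', O.inv d' ≠ d' ∧ P.outerDart d' = d) ∨ ∃ x, P.portDart (g.port x) = d := by
  have hport (z : Port k g.order) : ∃ x, P.portDart (g.port x) = P.portDart z := by
    obtain ⟨x, hx⟩ := g.port_bijective.surjective z
    exact ⟨x, congrArg P.portDart hx⟩
  obtain ⟨v, i⟩ := d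
  obtain ⟨u | w, rfl⟩ := P.vertexEquiv.surjective v
  · by_cases hd : O.inv (u, i) = (u, i)
    · obtain ⟨l, hl⟩ := (O.inv_eq_self_iff _).1 hd
      have hdart : P.portDart (Sum.inr l) = (P.vertexEquiv (Sum.inl u), i) :=
        congrArg P.outerDart hl
      exact Or.inr (hdart ▸ hport _)
    · exact Or.inl ⟨_, hd, rfl⟩
  · have hdart : P.portDart (Sum.inl (w, i - P.shift w)) = (P.vertexEquiv (Sum.inr w), i) := by
      simp [portDart]
    exact Or.inr (hdart ▸ hport _)

theorem dart_bijective : Bijective (Sum.elim (fun d : {d // O.inv d ≠ d} => P.outerDart d)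
    fun x : Fin g.edges.length × Bool => P.portDart (g.port x)) := by
  refine ⟨Injective.sumElim (P.outerDart_injective.comp Subtype.val_injective)
    (P.portDart_injective.comp g.port_bijective.injective)
    fun d x => P.outerDart_ne_portDart d.2 _, fun d => ?_⟩
  rcases P.exists_outerDart_eq_or_exists_portDart_eq d with ⟨d', hd', rfl⟩ | ⟨x, rfl⟩
  · exact ⟨Sum.inl ⟨d', hd'⟩, rfl⟩
  · exact ⟨Sum.inr x, rfl⟩

/-- The darts of the glued map are the darts of the open map that are not loose ends and the ends of
the edges of the gadget. -/
noncomputable def dartEquiv : {d // O.inv d ≠ d} ⊕ (Fin g.edges.length × Bool) ≃ V × Fin 3 :=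
  Equiv.ofBijective _ P.dart_bijective

theorem dartEquiv_inl (d : {d // O.inv d ≠ d}) : P.dartEquiv (Sum.inl d) = P.outerDart d := rfl

theorem dartEquiv_inr (x : Fin g.edges.length × Bool) :
    P.dartEquiv (Sum.inr x) = P.portDart (g.port x) := rfl

theorem forall_dart {S : V × Fin 3 → Prop} (houter : ∀ d, O.inv d ≠ d → S (P.outerDart d))
    (hport : ∀ x, S (P.portDart (g.port x))) (d : V × Fin 3) : S d := by
  rcases P.exists_outerDart_eq_or_exists_portDart_eq d with ⟨d', hd', rfl⟩ | ⟨x, rfl⟩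
  exacts [houter d' hd', hport x]

theorem crn_outerDart (d : W × Fin 3) (c : Bool) :
    crn (P.outerDart d) c = P.outerDart (crn d c) := rfl

theorem crn_portDart_inl (d : Fin g.order × Fin 3) (c : Bool) :
    crn (P.portDart (Sum.inl d)) c =
      (P.vertexEquiv (Sum.inr d.1), (crn d c).2 + P.shift d.1) := by
  cases c <;> simp [portDart, crn, add_right_comm]

theorem crn_portDart_inr (i : Fin k) (c : Bool) :
    crn (P.portDart (Sum.inr i)) c = P.outerDart (O.legEnd (i, c)) := rfl

/-- The function on the corners of the glued map that is composed of functions on the corners of its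
parts. -/
def cornerElim {ι : Type*} (f : W × Fin 3 → ι) (h : Fin g.order × Fin 3 → ι) (q : V × Fin 3) : ι :=
  Sum.elim (fun u => f (u, q.2)) (fun w => h (w, q.2 - P.shift w)) (P.vertexEquiv.symm q.1)

theorem cornerElim_outerDart {ι : Type*} (f : W × Fin 3 → ι) (h : Fin g.order × Fin 3 → ι)
    (u : W × Fin 3) : P.cornerElim f h (P.outerDart u) = f u := by
  simp [cornerElim, outerDart]

theorem cornerElim_inr {ι : Type*} (f : W × Fin 3 → ι) (h : Fin g.order × Fin 3 → ι)
    (w : Fin g.order) (i : Fin 3) :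
    P.cornerElim f h (P.vertexEquiv (Sum.inr w), i) = h (w, i - P.shift w) := by
  simp [cornerElim]

/-- The twist of the glued map that is composed of twists of its parts. -/
noncomputable def twist (T : W × Fin 3 → Bool) (b : Fin g.edges.length → Bool)
    (d : V × Fin 3) : Bool :=
  Sum.elim (fun d : {d // O.inv d ≠ d} => T d) (fun x => b x.1) (P.dartEquiv.symm d)

theorem twist_outerDart (T : W × Fin 3 → Bool) (b : Fin g.edges.length → Bool) {d : W × Fin 3}
    (hd : O.inv d ≠ d) : P.twist T b (P.outerDart d) = T d := by
  rw [← P.dartEquiv_inl ⟨d, hd⟩, twist, Equiv.symm_apply_apply, Sum.elim_inl]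

theorem twist_portDart (T : W × Fin 3 → Bool) (b : Fin g.edges.length → Bool)
    (x : Fin g.edges.length × Bool) : P.twist T b (P.portDart (g.port x)) = b x.1 := by
  rw [← P.dartEquiv_inr, twist, Equiv.symm_apply_apply, Sum.elim_inr]

end Placement

/-- The cubic map `M` arises by gluing the gadget `g` to the loose ends of `O`. -/
structure Gluing {V W : Type*} {k : ℕ} (M : CubicMap V) (O : OpenMap W k) (g : Gadget k) extends
    Placement V O g where
  inv_outerDart : ∀ {d}, O.inv d ≠ d →
    M.inv (toPlacement.outerDart d) = toPlacement.outerDart (O.inv d)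
  inv_portDart : ∀ e ∈ g.edges, M.inv (toPlacement.portDart e.1) = toPlacement.portDart e.2

namespace Gluing

open Placement

variable {V W : Type*} {k : ℕ} {M : CubicMap V} {O : OpenMap W k} {g : Gadget k}
  (G : Gluing M O g) {T : W × Fin 3 → Bool} {p : Fin k → Fin k} {ε : Fin k → Bool}

theorem inv_portDart_port (x : Fin g.edges.length × Bool) :
    M.inv (G.portDart (g.port x)) = G.portDart (g.port (x.1, !x.2)) := by
  obtain ⟨e, b⟩ := x
  have h : M.inv (G.portDart (g.edges.get e).1) = G.portDart (g.edges.get e).2 :=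
    G.inv_portDart _ (List.get_mem _ _)
  cases b
  · exact h
  · exact (congrArg M.inv h.symm).trans (M.inv_inv _)

theorem twist_inv (hT : ∀ d, T (O.inv d) = T d) (b : Fin g.edges.length → Bool)
    (d : V × Fin 3) : G.twist T b (M.inv d) = G.twist T b d := by
  revert d
  refine G.forall_dart (fun d hd => ?_) fun x => ?_
  · rw [G.inv_outerDart hd, G.twist_outerDart T b hd, G.twist_outerDart T b, hT]
    exact O.inv_involutive.injective.ne hd
  · rw [G.inv_portDart_port, twist_portDart, twist_portDart]

theorem eqvGen_link_outerDart (b : Fin g.edges.length → Bool) {q q' : W × Fin 3}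
    (h : EqvGen (Link O.inv T) q q') :
    EqvGen (Link M.inv (G.twist T b)) (G.outerDart q) (G.outerDart q') := by
  refine eqvGen_map ?_ h
  rintro _ _ ⟨d, c, hd, rfl, rfl⟩
  refine .rel _ _ ⟨G.outerDart d, c, M.inv_ne _, rfl, ?_⟩
  rw [G.inv_outerDart hd, G.twist_outerDart T b hd]
  rfl

theorem strandsValid_of_strandsValid_twist {b : Fin g.edges.length → Bool}
    (h : StrandsValid M.inv (G.twist T b)) : StrandsValid O.inv T :=
  fun _ i j hij he => h _ i j hij (G.eqvGen_link_outerDart b he)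

theorem eqvGen_link_of_node_eq (hlabel : O.IsStrandLabel T p ε) (b : Fin g.edges.length → Bool)
    {z z' : Port k g.order} {c c' : Bool} (h : Gadget.node p ε z c = Gadget.node p ε z' c') :
    EqvGen (Link M.inv (G.twist T b)) (crn (G.portDart z) c) (crn (G.portDart z') c') := by
  rcases z with d | i <;> rcases z' with d' | i' <;> simp only [Gadget.node] at h
  · have hlt := (crn d c).2.isLt
    have hlt' := (crn d' c').2.isLt
    have hvertex : d.1 = d'.1 := Fin.ext (by omega)
    have hcorner : (crn d c).2 = (crn d' c').2 := Fin.ext (by rw [hvertex] at h; omega)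
    rw [crn_portDart_inl, crn_portDart_inl, hvertex, hcorner]
    exact .refl _
  · exact absurd (pathLabel p ε (i', c')).isLt (by omega)
  · exact absurd (pathLabel p ε (i, c)).isLt (by omega)
  · rw [crn_portDart_inr, crn_portDart_inr]
    exact G.eqvGen_link_outerDart b ((hlabel _ _).2 (Fin.ext h))

theorem eqvGen_link_edge (T : W × Fin 3 → Bool) (b : Fin g.edges.length → Bool)
    (e : Fin g.edges.length) (c : Bool) :
    EqvGen (Link M.inv (G.twist T b)) (crn (G.portDart (g.edges.get e).1) c)
      (crn (G.portDart (g.edges.get e).2) (xor (!c) (b e))) := by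
  refine .rel _ _ ⟨G.portDart (g.edges.get e).1, c, M.inv_ne _, rfl, ?_⟩
  rw [G.inv_portDart _ (List.get_mem _ _)]
  exact congrArg (fun t => crn _ (xor (!c) t)) (G.twist_portDart T b (e, false)).symm

theorem eqvGen_link_of_eqvGen_nodeLink (hlabel : O.IsStrandLabel T p ε)
    (b : Fin g.edges.length → Bool) {z z' : Port k g.order} {c c' : Bool}
    (h : EqvGen (g.NodeLink p ε b) (Gadget.node p ε z c) (Gadget.node p ε z' c')) :
    EqvGen (Link M.inv (G.twist T b)) (crn (G.portDart z) c) (crn (G.portDart z') c') := by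
  have hequiv := EqvGen.is_equivalence (Link M.inv (G.twist T b))
  let strand (n : ℕ) : Set (V × Fin 3) := {q | ∃ z c, Gadget.node p ε z c = n ∧
    EqvGen (Link M.inv (G.twist T b)) (crn (G.portDart z) c) q}
  have mem_strand (z c q) : q ∈ strand (Gadget.node p ε z c) ↔
      EqvGen (Link M.inv (G.twist T b)) (crn (G.portDart z) c) q :=
    ⟨fun ⟨_, _, hnode, hq⟩ => hequiv.trans (G.eqvGen_link_of_node_eq hlabel b hnode.symm) hq,
      fun hq => ⟨z, c, rfl, hq⟩⟩
  have hstrand := apply_eq_of_eqvGen (f := strand) ?_ h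
  · rw [← mem_strand, hstrand, mem_strand]
    exact .refl _
  · rintro _ _ ⟨e, c, rfl, rfl⟩
    ext q
    rw [mem_strand, mem_strand]
    have hlink := G.eqvGen_link_edge T b e c
    exact ⟨hequiv.trans (hequiv.symm hlink), hequiv.trans hlink⟩

open Classical in
/-- The strand through a corner of the open map: it is described by its label if it reaches a loose
end. -/
noncomputable def outerClass (O : OpenMap W k) (T : W × Fin 3 → Bool) (p : Fin k → Fin k)
    (ε : Fin k → Bool) (b : Fin g.edges.length → Bool) (u : W × Fin 3) :
    Quot (g.NodeLink p ε b) ⊕ Quot (Link O.inv T) :=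
  if h : ∃ x, EqvGen (Link O.inv T) u (O.legEnd x) then
    Sum.inl (Quot.mk _ (pathLabel p ε h.choose).val)
  else Sum.inr (Quot.mk _ u)

theorem outerClass_of_eqvGen (hlabel : O.IsStrandLabel T p ε) (b : Fin g.edges.length → Bool)
    {u : W × Fin 3} {x : Fin k × Bool} (h : EqvGen (Link O.inv T) u (O.legEnd x)) :
    outerClass O T p ε b u = Sum.inl (Quot.mk _ (pathLabel p ε x).val) := by
  have hex : ∃ x, EqvGen (Link O.inv T) u (O.legEnd x) := ⟨x, h⟩
  have hpath : pathLabel p ε hex.choose = pathLabel p ε x :=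
    (hlabel _ _).1 (hex.choose_spec.symm.trans _ _ _ h)
  rw [outerClass, dif_pos hex, hpath]

theorem outerClass_of_not_exists (b : Fin g.edges.length → Bool) {u : W × Fin 3}
    (h : ¬ ∃ x, EqvGen (Link O.inv T) u (O.legEnd x)) :
    outerClass O T p ε b u = Sum.inr (Quot.mk _ u) := dif_neg h

theorem outerClass_eq_of_eqvGen (hlabel : O.IsStrandLabel T p ε) (b : Fin g.edges.length → Bool)
    {u v : W × Fin 3} (h : EqvGen (Link O.inv T) u v) :
    outerClass O T p ε b u = outerClass O T p ε b v := by
  by_cases hu : ∃ x, EqvGen (Link O.inv T) u (O.legEnd x)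
  · obtain ⟨x, hx⟩ := hu
    rw [outerClass_of_eqvGen hlabel b hx, outerClass_of_eqvGen hlabel b (h.symm.trans _ _ _ hx)]
  · rw [outerClass_of_not_exists b hu, Quot.eqvGen_sound h, outerClass_of_not_exists b
      fun ⟨x, hx⟩ => hu ⟨x, h.trans _ _ _ hx⟩]

/-- The strand through a corner of the glued map, computed separately in the gadget and in the open
map. -/
noncomputable def cornerClass (T : W × Fin 3 → Bool) (p : Fin k → Fin k) (ε : Fin k → Bool)
    (b : Fin g.edges.length → Bool) :
    V × Fin 3 → Quot (g.NodeLink p ε b) ⊕ Quot (Link O.inv T) :=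
  G.cornerElim (outerClass O T p ε b) fun d => Sum.inl (Quot.mk _ (k + 3 * d.1 + d.2))

theorem cornerClass_outerDart (b : Fin g.edges.length → Bool) (u : W × Fin 3) :
    G.cornerClass T p ε b (G.outerDart u) = outerClass O T p ε b u :=
  G.cornerElim_outerDart _ _ u

theorem cornerClass_inr (b : Fin g.edges.length → Bool) (w : Fin g.order) (i : Fin 3) :
    G.cornerClass T p ε b (G.vertexEquiv (Sum.inr w), i) =
      Sum.inl (Quot.mk _ (k + 3 * w + (i - G.shift w : Fin 3))) :=
  G.cornerElim_inr _ _ w i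

theorem cornerClass_crn_portDart (hlabel : O.IsStrandLabel T p ε)
    (b : Fin g.edges.length → Bool) (z : Port k g.order) (c : Bool) :
    G.cornerClass T p ε b (crn (G.portDart z) c) =
      Sum.inl (Quot.mk _ (Gadget.node p ε z c)) := by
  rcases z with d | i
  · rw [crn_portDart_inl, cornerClass_inr, add_sub_cancel_right]
    rfl
  · rw [crn_portDart_inr, cornerClass_outerDart, outerClass_of_eqvGen hlabel b (.refl _)]
    rfl

theorem cornerClass_eq_of_eqvGen (hlabel : O.IsStrandLabel T p ε)
    (b : Fin g.edges.length → Bool) {q q' : V × Fin 3}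
    (h : EqvGen (Link M.inv (G.twist T b)) q q') :
    G.cornerClass T p ε b q = G.cornerClass T p ε b q' := by
  refine apply_eq_of_eqvGen ?_ h
  rintro _ _ ⟨d, c, -, rfl, rfl⟩
  revert d
  refine G.forall_dart (fun d hd => ?_) ?_
  · rw [G.inv_outerDart hd, G.twist_outerDart T b hd, crn_outerDart, crn_outerDart,
      cornerClass_outerDart, cornerClass_outerDart]
    exact outerClass_eq_of_eqvGen hlabel b (.rel _ _ ⟨d, c, hd, rfl, rfl⟩)
  · rintro ⟨e, side⟩
    rw [G.inv_portDart_port, G.twist_portDart, G.cornerClass_crn_portDart hlabel,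
      G.cornerClass_crn_portDart hlabel]
    refine congrArg Sum.inl ?_
    cases side
    · exact Quot.sound ⟨e, c, rfl, rfl⟩
    · refine (Quot.sound ⟨e, xor (!c) (b e), rfl, ?_⟩).symm
      simp only [Gadget.port, cond_true]
      cases c <;> cases b e <;> rfl

/-- Two outer strands conflict if they pass through different corners of a vertex. -/
def Conflict (O : OpenMap W k) (T : W × Fin 3 → Bool) (p : Fin k → Fin k) (ε : Fin k → Bool)
    (x y : Fin k) : Prop :=
  ∃ v i j, i ≠ j ∧ ∃ s t, EqvGen (Link O.inv T) (v, i) (O.legEnd s) ∧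
    EqvGen (Link O.inv T) (v, j) (O.legEnd t) ∧ pathLabel p ε s = x ∧ pathLabel p ε t = y

theorem admissible_of_strandsValid (hlabel : O.IsStrandLabel T p ε)
    {b : Fin g.edges.length → Bool} (h : StrandsValid M.inv (G.twist T b)) :
    g.Admissible p ε (Conflict O T p ε) b := by
  have hequiv := EqvGen.is_equivalence (Link M.inv (G.twist T b))
  constructor
  · intro w i j hij hjoin
    obtain ⟨⟨wi, i'⟩, hi⟩ := crn_false_surjective (w, i)
    obtain ⟨⟨wj, j'⟩, hj⟩ := crn_false_surjective (w, j)
    obtain ⟨rfl, rfl⟩ := Prod.mk.inj hi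
    obtain ⟨rfl, rfl⟩ := Prod.mk.inj hj
    have hlink := G.eqvGen_link_of_eqvGen_nodeLink hlabel b (z := Sum.inl (wj, i'))
      (z' := Sum.inl (wj, j')) (c := false) (c' := false) hjoin
    rw [crn_portDart_inl, crn_portDart_inl] at hlink
    exact h _ _ _ (fun hsum => hij (add_right_cancel hsum)) hlink
  · rintro x y ⟨v, i, j, hij, s, t, hs, ht, rfl, rfl⟩ hjoin
    have hlink := G.eqvGen_link_of_eqvGen_nodeLink hlabel b (z := Sum.inr s.1)
      (z' := Sum.inr t.1) (c := s.2) (c' := t.2) hjoin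
    exact h _ i j hij (hequiv.trans (G.eqvGen_link_outerDart b hs)
      (hequiv.trans hlink (hequiv.symm (G.eqvGen_link_outerDart b ht))))

theorem outerClass_ne (hlabel : O.IsStrandLabel T p ε) (hT : StrandsValid O.inv T)
    {b : Fin g.edges.length → Bool} (hb : g.Admissible p ε (Conflict O T p ε) b) (u : W)
    {i j : Fin 3} (hij : i ≠ j) :
    outerClass O T p ε b (u, i) ≠ outerClass O T p ε b (u, j) := by
  intro hclass
  by_cases hi : ∃ x, EqvGen (Link O.inv T) (u, i) (O.legEnd x) <;>
    by_cases hj : ∃ x, EqvGen (Link O.inv T) (u, j) (O.legEnd x)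
  · obtain ⟨x, hx⟩ := hi
    obtain ⟨y, hy⟩ := hj
    rw [outerClass_of_eqvGen hlabel b hx, outerClass_of_eqvGen hlabel b hy] at hclass
    exact hb.2 _ _ ⟨u, i, j, hij, x, y, hx, hy, rfl, rfl⟩
      (Quot.eqvGen_exact (Sum.inl.inj hclass))
  · obtain ⟨x, hx⟩ := hi
    rw [outerClass_of_eqvGen hlabel b hx, outerClass_of_not_exists b hj] at hclass
    exact Sum.inl_ne_inr hclass
  · obtain ⟨y, hy⟩ := hj
    rw [outerClass_of_not_exists b hi, outerClass_of_eqvGen hlabel b hy] at hclass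
    exact Sum.inr_ne_inl hclass
  · rw [outerClass_of_not_exists b hi, outerClass_of_not_exists b hj] at hclass
    exact hT u i j hij (Quot.eqvGen_exact (Sum.inr.inj hclass))

theorem strandsValid_twist_iff (hlabel : O.IsStrandLabel T p ε) (hT : StrandsValid O.inv T)
    (b : Fin g.edges.length → Bool) :
    StrandsValid M.inv (G.twist T b) ↔ g.Admissible p ε (Conflict O T p ε) b := by
  refine ⟨G.admissible_of_strandsValid hlabel, fun hb v i j hij hjoin => ?_⟩
  have hclass := G.cornerClass_eq_of_eqvGen hlabel b hjoin
  obtain ⟨u | w, rfl⟩ := G.vertexEquiv.surjective v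
  · rw [← outerDart.eq_1 G.toPlacement (u, i), ← outerDart.eq_1 G.toPlacement (u, j),
      cornerClass_outerDart, cornerClass_outerDart] at hclass
    exact outerClass_ne hlabel hT hb u hij hclass
  · rw [cornerClass_inr, cornerClass_inr] at hclass
    exact hb.1 w _ _ (fun h => hij (sub_left_injective h))
      (Quot.eqvGen_exact (Sum.inl.inj hclass))

end Gluing

/-- The twists of an open map, normalised to vanish at the loose ends. -/
abbrev OpenMap.Twists {W : Type*} {k : ℕ} (O : OpenMap W k) : Type _ :=
  {T : W × Fin 3 → Bool // (∀ d, T (O.inv d) = T d) ∧ ∀ d, O.inv d = d → T d = false}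

namespace Gluing

open Placement

variable {V W : Type*} {k : ℕ} {M : CubicMap V} {O : OpenMap W k} {g : Gadget k}
  (G : Gluing M O g)

theorem eq_and_eq_of_twist_eq {T T' : O.Twists} {b b' : Fin g.edges.length → Bool}
    (h : G.twist T.1 b = G.twist T'.1 b') : T = T' ∧ b = b' := by
  constructor
  · refine Subtype.ext (funext fun d => ?_)
    by_cases hd : O.inv d = d
    · rw [T.2.2 d hd, T'.2.2 d hd]
    · rw [← G.twist_outerDart T.1 b hd, h, G.twist_outerDart T'.1 b' hd]
  · funext e
    rw [← G.twist_portDart T.1 b (e, false), h, G.twist_portDart T'.1 b' (e, false)]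

theorem exists_twist_eq {T : V × Fin 3 → Bool} (hT : ∀ d, T (M.inv d) = T d) :
    ∃ (T₀ : O.Twists) (b : Fin g.edges.length → Bool), G.twist T₀.1 b = T := by
  classical
  refine ⟨⟨fun d => if O.inv d = d then false else T (G.outerDart d), fun d => ?_,
    fun d hd => if_pos hd⟩, fun e => T (G.portDart (g.port (e, false))),
    funext (G.forall_dart (fun d hd => ?_) ?_)⟩
  · by_cases hd : O.inv d = d
    · rw [hd]
    · simp only [hd, O.inv_involutive.injective.ne hd, if_false, ← G.inv_outerDart hd, hT]
  · rw [G.twist_outerDart _ _ hd]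
    exact if_neg hd
  · rintro ⟨e, side⟩
    rw [G.twist_portDart]
    cases side
    · rfl
    · rw [← hT, G.inv_portDart_port]
      rfl

theorem numCovers_eq_sum [Finite V] [Fintype O.Twists] :
    M.numCovers = ∑ T : O.Twists,
      Nat.card {b : Fin g.edges.length → Bool // StrandsValid M.inv (G.twist T.1 b)} := by
  rw [← Nat.card_sigma, CubicMap.numCovers]
  symm
  refine Nat.card_eq_of_bijective (β := M.ValidTwists)
    (fun x => ⟨G.twist x.1.1 x.2.1, G.twist_inv x.1.2.1 _, x.2.2⟩) ⟨?_, ?_⟩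
  · rintro ⟨T, b, hb⟩ ⟨T', b', hb'⟩ h
    obtain ⟨rfl, rfl⟩ := G.eq_and_eq_of_twist_eq (congrArg Subtype.val h)
    rfl
  · rintro ⟨T, hT, hvalid⟩
    obtain ⟨T₀, b, rfl⟩ := G.exists_twist_eq hT
    exact ⟨⟨T₀, b, hvalid⟩, rfl⟩

end Gluing

/-- The properties shared by the conflicts of all systems of outer strands: the strands with the
labels `i` and `p i` leave through the same loose end, so they conflict. -/
structure IsConflictSystem {k : ℕ} (p : Fin k → Fin k) (κ : Fin k → Fin k → Prop) : Prop where
  injective : Injective p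
  rel_apply : ∀ i, κ i (p i)
  symm : ∀ {x y}, κ x y → κ y x
  irrefl : ∀ x, ¬ κ x x

theorem isConflictSystem_conflict {W : Type*} {k : ℕ} {O : OpenMap W k} {T : W × Fin 3 → Bool}
    {p : Fin k → Fin k} {ε : Fin k → Bool} (hp : Injective p) (hlabel : O.IsStrandLabel T p ε)
    (hT : StrandsValid O.inv T) : IsConflictSystem p (Gluing.Conflict O T p ε) where
  injective := hp
  rel_apply i := by
    refine ⟨(O.leg i).1, _, _, ?_, (i, ε i), (i, !ε i), .refl _, .refl _, by simp [pathLabel],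
      by simp [pathLabel]⟩
    cases ε i <;> simp
  symm := fun ⟨v, i, j, hij, s, t, hs, ht, hx, hy⟩ => ⟨v, j, i, hij.symm, t, s, ht, hs, hy, hx⟩
  irrefl := fun x ⟨v, i, j, hij, s, t, hs, ht, hx, hy⟩ => hT v i j hij
    (hs.trans _ _ _ (((hlabel s t).2 (hx.trans hy.symm)).trans _ _ _ ht.symm))

theorem sum_numCovers_le {k : ℕ} {W V : Type*} [Finite W] [Finite V] {O : OpenMap W k}
    {ι : Type*} [Fintype ι] {V' : ι → Type*} [∀ i, Finite (V' i)] {M : CubicMap V} {g : Gadget k}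
    (G : Gluing M O g) {M' : ∀ i, CubicMap (V' i)} {g' : ι → Gadget k}
    (G' : ∀ i, Gluing (M' i) O (g' i)) (m n : ℕ)
    (h : ∀ p ε κ, IsConflictSystem p κ → m * ∑ i, (g' i).count p ε κ ≤ n * g.count p ε κ) :
    m * ∑ i, (M' i).numCovers ≤ n * M.numCovers := by
  have : Fintype O.Twists := Fintype.ofFinite _
  rw [G.numCovers_eq_sum, Finset.sum_congr rfl fun i _ => (G' i).numCovers_eq_sum,
    Finset.sum_comm, Finset.mul_sum, Finset.mul_sum]
  refine Finset.sum_le_sum fun T _ => ?_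
  by_cases hT : StrandsValid O.inv T.1
  · obtain ⟨p, ε, hp, hlabel⟩ := O.exists_isStrandLabel T.2.1
    simpa only [Gluing.strandsValid_twist_iff _ hlabel hT, Gadget.count] using
      h p ε _ (isConflictSystem_conflict hp hlabel hT)
  · have hempty (i : ι) : IsEmpty {b : Fin (g' i).edges.length → Bool //
        StrandsValid (M' i).inv ((G' i).twist T.1 b)} :=
      ⟨fun b => hT ((G' i).strandsValid_of_strandsValid_twist b.2)⟩
    simp only [Nat.card_of_isEmpty, Finset.sum_const_zero, mul_zero, Nat.zero_le]

end Gadgets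

/-! ### Equivalence relations as bit matrices -/

namespace BitMatrix

open Relation Function

/-- The number with the given bits. -/
def setBits (l : List ℕ) : ℕ := l.foldr (fun i s => 2 ^ i ||| s) 0

/-- The bits in the first column of an `N × N` matrix. Here and below, a relation on `{0, …, N - 1}`
is stored as a natural number whose bit `N * x + y` says whether `x` is related to `y`. -/
def columnMask (N : ℕ) : ℕ := setBits ((List.range N).map (N * ·))

/-- The matrix of the equality relation. -/
def diagonal (N : ℕ) : ℕ := setBits ((List.range N).map fun x => N * x + x)

/-- The matrix of the pairs `(x, y)` with `x` related to `a` and `b` related to `y`. It is the outer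
product of the column of `a` and the row of `b`, computed as a product of numbers: the bits of the
column are `N` apart and the row has `N` bits, so there are no carries. -/
def block (N M a b : ℕ) : ℕ := (M >>> a &&& columnMask N) * ((M >>> (N * b)) % 2 ^ N)

/-- The matrix in which the classes of `a` and `b` are joined. -/
def join (N M a b : ℕ) : ℕ := M ||| (block N M a b ||| block N M b a)

/-- The matrix `M` represents the equivalence relation generated by `r`. -/
def Represents (N M : ℕ) (r : ℕ → ℕ → Prop) : Prop :=
  ∀ x y, x < N → y < N → (M.testBit (N * x + y) = true ↔ EqvGen r x y)

theorem Represents.congr {N M : ℕ} {r s : ℕ → ℕ → Prop} (h : Represents N M r)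
    (hrs : ∀ x y, r x y ↔ s x y) : Represents N M s := by
  obtain rfl : r = s := funext₂ fun x y => propext (hrs x y)
  exact h

theorem testBit_setBits {l : List ℕ} {j : ℕ} : (setBits l).testBit j = true ↔ j ∈ l := by
  induction l with
  | nil => simp [setBits]
  | cons i l ih =>
    rw [setBits, List.foldr_cons, ← setBits, Nat.testBit_or, Bool.or_eq_true, ih,
      Nat.testBit_two_pow, decide_eq_true_iff, List.mem_cons, eq_comm]

theorem land_eq_zero_iff {M F : ℕ} :
    M &&& F = 0 ↔ ∀ j, F.testBit j = true → M.testBit j = false := by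
  refine ⟨fun h j hj => by simpa [hj] using congrArg (Nat.testBit · j) h, fun h => ?_⟩
  refine Nat.eq_of_testBit_eq fun j => ?_
  rw [Nat.testBit_and, Nat.zero_testBit]
  cases hj : F.testBit j
  · rw [Bool.and_false]
  · rw [h j hj, Bool.false_and]

theorem eq_two_pow_mul_shiftRight_add {N c : ℕ} (hN : 0 < N)
    (hc : ∀ j, c.testBit j = true → N ∣ j) :
    c = 2 ^ N * (c >>> N) + (c.testBit 0).toNat := by
  have hmod : c % 2 ^ N = (c.testBit 0).toNat := by
    refine Nat.eq_of_testBit_eq fun j => ?_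
    rw [Nat.testBit_mod_two_pow]
    rcases Nat.eq_zero_or_pos j with rfl | hj
    · cases c.testBit 0 <;> simp [hN]
    · have hlow : (c.testBit 0).toNat.testBit j = false :=
        Nat.testBit_lt_two_pow ((Bool.toNat_le _).trans_lt (Nat.one_lt_two_pow hj.ne'))
      rw [hlow, Bool.and_eq_false_imp, decide_eq_true_iff, Bool.eq_false_iff]
      exact fun hlt h => (Nat.le_of_dvd hj (hc j h)).not_gt hlt
  rw [← hmod, Nat.shiftRight_eq_div_pow, Nat.div_add_mod]

theorem testBit_mul_eq_ite {N r c : ℕ} (hN : 0 < N) (hr : r < 2 ^ N)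
    (hc : ∀ j, c.testBit j = true → N ∣ j) (j : ℕ) : (c * r).testBit j =
      if j < N then c.testBit 0 && r.testBit j else (c >>> N * r).testBit (j - N) := by
  have hlt : (c.testBit 0).toNat * r < 2 ^ N := by
    cases c.testBit 0
    · simp
    · simpa using hr
  have hsplit : c * r = 2 ^ N * (c >>> N * r) + (c.testBit 0).toNat * r := by
    rw [← mul_assoc, ← add_mul, ← eq_two_pow_mul_shiftRight_add hN hc]
  rw [hsplit, Nat.testBit_two_pow_mul_add _ hlt]
  cases c.testBit 0 <;> simp

theorem testBit_mul {N r y c : ℕ} (hr : r < 2 ^ N) (hy : y < N)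
    (hc : ∀ j, c.testBit j = true → N ∣ j) (x : ℕ) :
    (c * r).testBit (N * x + y) = (c.testBit (N * x) && r.testBit y) := by
  have hN : 0 < N := by omega
  induction x generalizing c with
  | zero => rw [testBit_mul_eq_ite hN hr hc, mul_zero, zero_add, if_pos hy]
  | succ x ih =>
    have hc' (j : ℕ) (hj : (c >>> N).testBit j = true) : N ∣ j := by
      rw [Nat.testBit_shiftRight] at hj
      exact (Nat.dvd_add_right (dvd_refl N)).1 (hc _ hj)
    have hsucc : N * (x + 1) + y = N + (N * x + y) := by ring
    rw [testBit_mul_eq_ite hN hr hc, hsucc, if_neg (by omega), Nat.add_sub_cancel_left, ih hc',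
      Nat.testBit_shiftRight, mul_add_one, add_comm N]

theorem testBit_block (M : ℕ) {N a b x y : ℕ} (hx : x < N) (hy : y < N) :
    (block N M a b).testBit (N * x + y) = (M.testBit (N * x + a) && M.testBit (N * b + y)) := by
  have hmask (j : ℕ) : (columnMask N).testBit j = true ↔ ∃ z < N, N * z = j := by
    simp only [columnMask, testBit_setBits, List.mem_map, List.mem_range]
  have hdvd (j : ℕ) (hj : (M >>> a &&& columnMask N).testBit j = true) : N ∣ j := by
    rw [Nat.testBit_and, Bool.and_eq_true, hmask] at hj
    obtain ⟨-, z, -, rfl⟩ := hj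
    exact dvd_mul_right N z
  rw [block, testBit_mul (Nat.mod_lt _ (by positivity)) hy hdvd, Nat.testBit_and,
    (hmask _).2 ⟨x, hx, rfl⟩, Bool.and_true, Nat.testBit_shiftRight, Nat.testBit_mod_two_pow,
    Nat.testBit_shiftRight, decide_eq_true hy, Bool.true_and, add_comm a]

theorem testBit_join (M : ℕ) {N a b x y : ℕ} (hx : x < N) (hy : y < N) :
    (join N M a b).testBit (N * x + y) = (M.testBit (N * x + y) ||
      (M.testBit (N * x + a) && M.testBit (N * b + y) ||
        M.testBit (N * x + b) && M.testBit (N * a + y))) := by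
  rw [join, Nat.testBit_or, Nat.testBit_or, testBit_block M hx hy, testBit_block M hx hy]

theorem testBit_join_of_testBit {N M a b j : ℕ} (h : M.testBit j = true) :
    (join N M a b).testBit j = true := by
  rw [join, Nat.testBit_or, h, Bool.true_or]

theorem represents_diagonal (N : ℕ) : Represents N (diagonal N) fun _ _ => False := by
  intro x y hx hy
  have hrel : EqvGen (fun _ _ : ℕ => False) x y ↔ x = y :=
    ⟨fun h => apply_eq_of_eqvGen (f := id) (fun _ _ h => h.elim) h, fun h => h ▸ .refl _⟩
  rw [hrel, diagonal, testBit_setBits, List.mem_map]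
  constructor
  · rintro ⟨z, hz, h⟩
    rw [List.mem_range] at hz
    have hdiv := congrArg (· / N) h
    have hmod := congrArg (· % N) h
    simp only [Nat.mul_add_div (z.zero_le.trans_lt hz), Nat.mul_add_mod, Nat.div_eq_of_lt hz,
      Nat.div_eq_of_lt hy, Nat.mod_eq_of_lt hz, Nat.mod_eq_of_lt hy, Nat.add_zero] at hdiv hmod
    exact hdiv.symm.trans hmod
  · rintro rfl
    exact ⟨x, List.mem_range.2 hx, rfl⟩

theorem Represents.join {N M : ℕ} {r : ℕ → ℕ → Prop} (h : Represents N M r) {a b : ℕ}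
    (ha : a < N) (hb : b < N) : Represents N (join N M a b) (withPairs r [(a, b)]) := by
  intro x y hx hy
  have hnil : withPairs r [] = r := by
    ext
    simp [withPairs]
  have hequiv := EqvGen.is_equivalence r
  have hequiv' := EqvGen.is_equivalence (withPairs r [(a, b)])
  have hab : EqvGen (withPairs r [(a, b)]) a b := eqvGen_withPairs_cons_self
  simp only [testBit_join M hx hy, Bool.or_eq_true, Bool.and_eq_true, h x y hx hy, h x a hx ha,
    h x b hx hb, h a y ha hy, h b y hb hy]
  constructor
  · rintro (hxy | ⟨hxa, hby⟩ | ⟨hxb, hay⟩)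
    · exact eqvGen_withPairs_of_eqvGen hxy
    · exact hequiv'.trans (eqvGen_withPairs_of_eqvGen hxa)
        (hequiv'.trans hab (eqvGen_withPairs_of_eqvGen hby))
    · exact hequiv'.trans (eqvGen_withPairs_of_eqvGen hxb)
        (hequiv'.trans (hequiv'.symm hab) (eqvGen_withPairs_of_eqvGen hay))
  · intro hxy
    have hcases := eqvGen_or_of_withPairs_cons hxy
    rw [hnil] at hcases
    rcases hcases with hxy | ⟨hxa | hxb, hya | hyb⟩
    · exact Or.inl hxy
    · exact Or.inl (hequiv.trans hxa (hequiv.symm hya))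
    · exact Or.inr (Or.inl ⟨hxa, hequiv.symm hyb⟩)
    · exact Or.inr (Or.inr ⟨hxb, hequiv.symm hya⟩)
    · exact Or.inl (hequiv.trans hxb (hequiv.symm hyb))

section search

variable {Q : Type*} {N : ℕ} {nd : Q → Bool → ℕ}

/-- The matrix after joining the classes on the two sides of an edge `e` with twist `t`. The
classes on the sides of an end `z` of an edge are those of `nd z false` and `nd z true`. -/
def link (N : ℕ) (nd : Q → Bool → ℕ) (M : ℕ) (e : Q × Q) (t : Bool) : ℕ :=
  join N (join N M (nd e.1 false) (nd e.2 (!t))) (nd e.1 true) (nd e.2 t)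

/-- The matrix after adding all edges of a list with given twists. -/
def linkAll (N : ℕ) (nd : Q → Bool → ℕ) :
    (es : List (Q × Q)) → ℕ → (Fin es.length → Bool) → ℕ
  | [], M, _ => M
  | e :: es, M, b => linkAll N nd es (link N nd M e (b 0)) fun i => b i.succ

/-- All matrices that arise from twists of the given edges and avoid the bits of `F`, found by a
search that abandons a choice of twists as soon as a bit of `F` is set. -/
def leaves (N : ℕ) (nd : Q → Bool → ℕ) (F : ℕ) : List (Q × Q) → ℕ → List ℕ
  | [], M => [M]
  | e :: es, M =>
    (if link N nd M e false &&& F = 0 then leaves N nd F es (link N nd M e false) else []) ++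
      if link N nd M e true &&& F = 0 then leaves N nd F es (link N nd M e true) else []

theorem Represents.link (hnd : ∀ z c, nd z c < N) {M : ℕ} {r : ℕ → ℕ → Prop}
    (h : Represents N M r) (e : Q × Q) (t : Bool) : Represents N (link N nd M e t) fun x y =>
      r x y ∨ ∃ c, x = nd e.1 c ∧ y = nd e.2 (xor (!c) t) := by
  refine ((h.join (hnd e.1 false) (hnd e.2 (!t))).join (hnd e.1 true) (hnd e.2 t)).congr ?_
  simp [withPairs, or_assoc]

theorem Represents.linkAll (hnd : ∀ z c, nd z c < N) (es : List (Q × Q)) {M : ℕ}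
    {r : ℕ → ℕ → Prop} (h : Represents N M r) (b : Fin es.length → Bool) :
    Represents N (linkAll N nd es M b) fun x y => r x y ∨ ∃ (e : Fin es.length) (c : Bool),
      x = nd (es.get e).1 c ∧ y = nd (es.get e).2 (xor (!c) (b e)) := by
  induction es generalizing M r with
  | nil => simpa [BitMatrix.linkAll] using h
  | cons e es ih =>
    refine (ih (h.link hnd e (b 0)) fun i => b i.succ).congr fun x y => ?_
    rw [or_assoc]
    exact or_congr_right (Fin.exists_fin_succ (P := fun i => ∃ c, x = nd ((e :: es).get i).1 c ∧
      y = nd ((e :: es).get i).2 (xor (!c) (b i)))).symm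

theorem land_eq_zero_of_land_linkAll_eq_zero {F : ℕ} (es : List (Q × Q)) {M : ℕ}
    (b : Fin es.length → Bool) (h : linkAll N nd es M b &&& F = 0) : M &&& F = 0 := by
  have hle (j : ℕ) : M.testBit j = true → (linkAll N nd es M b).testBit j = true := by
    induction es generalizing M with
    | nil => exact id
    | cons e es ih =>
      exact fun hj => ih _ h (testBit_join_of_testBit (testBit_join_of_testBit hj))
  rw [land_eq_zero_iff] at h ⊢
  exact fun j hj => Bool.eq_false_iff.2 fun hM => Bool.eq_false_iff.1 (h j hj) (hle j hM)

theorem natCard_subtype_fin_succ {n : ℕ} (P : (Fin (n + 1) → Bool) → Prop) :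
    Nat.card {b // P b} = Nat.card {b : Fin n → Bool // P (Fin.cons false b)} +
      Nat.card {b : Fin n → Bool // P (Fin.cons true b)} := by
  have e : {b // P b} ≃ Σ t : Bool, {b : Fin n → Bool // P (Fin.cons t b)} :=
    ((Fin.consEquiv fun _ => Bool).subtypeEquiv fun _ => Iff.rfl).symm.trans
      (Equiv.subtypeProdEquivSigmaSubtype fun t b => P (Fin.cons t b))
  rw [Nat.card_congr e, Nat.card_sigma, Fintype.sum_bool, add_comm]

theorem countP_leaves {F : ℕ} (P : ℕ → Bool) (es : List (Q × Q)) {M : ℕ} (hM : M &&& F = 0) :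
    (leaves N nd F es M).countP P = Nat.card {b : Fin es.length → Bool //
      linkAll N nd es M b &&& F = 0 ∧ P (linkAll N nd es M b) = true} := by
  induction es generalizing M with
  | nil =>
    have : Unique (Fin ([] : List (Q × Q)).length → Bool) :=
      inferInstanceAs (Unique (Fin 0 → Bool))
    cases hP : P M <;> simp [leaves, linkAll, hP, hM]
  | cons e es ih =>
    have hbranch (t : Bool) :
        (if link N nd M e t &&& F = 0 then leaves N nd F es (link N nd M e t) else []).countP P =
          Nat.card {b : Fin es.length → Bool // linkAll N nd es (link N nd M e t) b &&& F = 0 ∧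
            P (linkAll N nd es (link N nd M e t) b) = true} := by
      split_ifs with h
      · exact ih h
      · have : IsEmpty {b : Fin es.length → Bool // linkAll N nd es (link N nd M e t) b &&& F = 0 ∧
            P (linkAll N nd es (link N nd M e t) b) = true} :=
          ⟨fun b => h (land_eq_zero_of_land_linkAll_eq_zero es b.1 b.2.1)⟩
        rw [Nat.card_of_isEmpty, List.countP_nil]
    rw [leaves, List.countP_append, hbranch, hbranch]
    exact (natCard_subtype_fin_succ (n := es.length) fun b =>
      linkAll N nd (e :: es) M b &&& F = 0 ∧ P (linkAll N nd (e :: es) M b) = true).symm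

end search

/-- The classes of `q.1` and `q.2` are distinct. -/
def apart (N : ℕ) (q : ℕ × ℕ) (M : ℕ) : Bool := !M.testBit (N * q.1 + q.2)

/-- The inequality `a * R ≤ b * S` holds for the numbers `R` and `S` of matrices in two lists that
separate the pairs in `s`, for every subset `s` of a list of pairs. -/
def compareApart (N a b : ℕ) : List (ℕ × ℕ) → List ℕ → List ℕ → Bool
  | [], R, S => a * R.length ≤ b * S.length
  | q :: qs, R, S => compareApart N a b qs R S &&
      compareApart N a b qs (R.filter (apart N q)) (S.filter (apart N q))

theorem mul_countP_le_of_compareApart {N a b : ℕ} (K : ℕ × ℕ → Bool) (qs : List (ℕ × ℕ))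
    (R S : List ℕ) (h : compareApart N a b qs R S = true) :
    a * R.countP (fun M => qs.all fun q => !K q || apart N q M) ≤
      b * S.countP (fun M => qs.all fun q => !K q || apart N q M) := by
  induction qs generalizing R S with
  | nil => simpa [compareApart] using h
  | cons q qs ih =>
    rw [compareApart, Bool.and_eq_true] at h
    cases hq : K q
    · simpa [hq] using ih R S h.1
    · simpa [hq, List.countP_filter, Bool.and_comm] using ih _ _ h.2

end BitMatrix

/-! ### Comparing the counts of gadgets -/

section GadgetCounts

open Relation Function BitMatrix

namespace Gadget

variable {k : ℕ}

/-- The pairs of strands that must not be joined, whatever the conflicts are. -/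
def forbiddenPairs (m : ℕ) (p : Fin k → Fin k) : List (ℕ × ℕ) :=
  ((List.finRange k).map fun i => (i.val, (p i).val)) ++
  (List.range m).flatMap fun w =>
    [(k + 3 * w, k + 3 * w + 1), (k + 3 * w, k + 3 * w + 2), (k + 3 * w + 1, k + 3 * w + 2)]

/-- The pairs of outer strands that do not meet at a loose end. -/
def freePairs (p : Fin k → Fin k) : List (ℕ × ℕ) :=
  (List.finRange k).flatMap fun y =>
    ((List.finRange k).filter fun x => x < y ∧ p x ≠ y ∧ p y ≠ x).map fun x => (x.val, y.val)

/-- The matrices of the strands of a gadget that do not join a forbidden pair. -/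
def matrices (N : ℕ) (g : Gadget k) (p : Fin k → Fin k) : List ℕ :=
  leaves N (node p fun _ => true)
    (setBits ((forbiddenPairs g.order p).map fun q => N * q.1 + q.2)) g.edges (diagonal N)

/-- The inequality `a * ∑ i, (g' i).count p ε κ ≤ b * g.count p ε κ` is verified for all `κ` by
enumeration. -/
def compareCounts {r : ℕ} (N a b : ℕ) (g' : Fin r → Gadget k) (g : Gadget k) (p : Fin k → Fin k) :
    Bool :=
  compareApart N a b (freePairs p) ((List.finRange r).flatMap fun i => (g' i).matrices N p)
    (g.matrices N p)

theorem mem_forbiddenPairs_iff {m : ℕ} {p : Fin k → Fin k} {q : ℕ × ℕ} :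
    q ∈ forbiddenPairs m p ↔ (∃ i : Fin k, q = (↑i, ↑(p i))) ∨
      ∃ (w : Fin m) (i j : Fin 3), i < j ∧ q = (k + 3 * w + i, k + 3 * w + j) := by
  have hlt (P : Fin 3 → Fin 3 → Prop) : (∃ i j, i < j ∧ P i j) ↔ P 0 1 ∨ P 0 2 ∨ P 1 2 := by
    simp [Fin.exists_fin_succ, or_assoc]
  simp only [forbiddenPairs, List.mem_append, List.mem_map, List.mem_finRange, true_and,
    List.mem_flatMap, List.mem_range, List.mem_cons, List.not_mem_nil, or_false, hlt,
    Fin.exists_iff (n := m), exists_prop, eq_comm (b := q)]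
  simp

theorem mem_freePairs_iff {p : Fin k → Fin k} {q : ℕ × ℕ} :
    q ∈ freePairs p ↔ ∃ x y : Fin k, (x < y ∧ p x ≠ y ∧ p y ≠ x) ∧ q = (↑x, ↑y) := by
  simp only [freePairs, List.mem_flatMap, List.mem_finRange, true_and, List.mem_map,
    List.mem_filter, decide_eq_true_eq]
  exact ⟨fun ⟨y, x, h, hq⟩ => ⟨x, y, h, hq.symm⟩, fun ⟨x, y, h, hq⟩ => ⟨y, x, h, hq.symm⟩⟩

theorem land_setBits_pairs_eq_zero_iff {N M : ℕ} {l : List (ℕ × ℕ)} :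
    M &&& setBits (l.map fun q => N * q.1 + q.2) = 0 ↔
      ∀ q ∈ l, M.testBit (N * q.1 + q.2) = false := by
  simp only [land_eq_zero_iff, testBit_setBits, List.forall_mem_map]

theorem node_lt {m : ℕ} (p : Fin k → Fin k) (ε : Fin k → Bool) (z : Port k m) (c : Bool) :
    node p ε z c < k + 3 * m := by
  rcases z with d | i
  · have := d.1.isLt
    have := (crn d c).2.isLt
    simp only [node]
    omega
  · exact (pathLabel p ε (i, c)).isLt.trans_le (Nat.le_add_right _ _)

/- Changing `ε` at a loose end exchanges the two strands there, which is undone by changing the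
twist of the edge at that loose end. -/
theorem count_eq_count_true (g : Gadget k) (p : Fin k → Fin k) (ε : Fin k → Bool)
    (κ : Fin k → Fin k → Prop) : g.count p ε κ = g.count p (fun _ => true) κ := by
  let flip : Port k g.order → Bool := Sum.elim (fun _ => false) fun i => !ε i
  have hnode (z : Port k g.order) (c : Bool) :
      node p ε z c = node p (fun _ => true) z (xor c (flip z)) := by
    rcases z with d | i
    · simp [node, flip]
    · cases h : ε i <;> cases c <;> simp [node, pathLabel, flip, h]
  let σ : (Fin g.edges.length → Bool) ≃ (Fin g.edges.length → Bool) :=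
    Involutive.toPerm
      (fun b e => xor (b e) (xor (flip (g.edges.get e).1) (flip (g.edges.get e).2)))
      fun b => funext fun e => by simp
  have hlink (b : Fin g.edges.length → Bool) :
      g.NodeLink p ε b = g.NodeLink p (fun _ => true) (σ b) := by
    funext x y
    refine propext (exists_congr fun e => ?_)
    have hflip (c : Bool) : xor (xor (!c) (b e)) (flip (g.edges.get e).2) =
        xor (!(xor c (flip (g.edges.get e).1))) (σ b e) := by
      change _ = xor _ (xor (b e) (xor (flip (g.edges.get e).1) (flip (g.edges.get e).2)))
      cases c <;> cases b e <;> cases flip (g.edges.get e).1 <;> simp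
    simp only [hnode, hflip]
    exact ⟨fun ⟨c, h⟩ => ⟨_, h⟩, fun ⟨c, h⟩ =>
      ⟨xor c (flip (g.edges.get e).1), by simpa only [Bool.xor_assoc, Bool.xor_self,
        Bool.xor_false] using h⟩⟩
  refine Nat.card_congr (σ.subtypeEquiv fun b => ?_)
  rw [Admissible, Admissible, hlink]

theorem admissible_iff {g : Gadget k} {p : Fin k → Fin k} {κ : Fin k → Fin k → Prop}
    (hκ : IsConflictSystem p κ) {ε : Fin k → Bool} {b : Fin g.edges.length → Bool} :
    g.Admissible p ε κ b ↔
      (∀ q ∈ forbiddenPairs g.order p, ¬ EqvGen (g.NodeLink p ε b) q.1 q.2) ∧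
        ∀ x y : Fin k, (x < y ∧ p x ≠ y ∧ p y ≠ x) → κ x y → ¬ EqvGen (g.NodeLink p ε b) x y := by
  constructor
  · refine fun ⟨hinner, houter⟩ => ⟨fun q hq => ?_, fun x y _ => houter x y⟩
    rcases mem_forbiddenPairs_iff.1 hq with ⟨i, rfl⟩ | ⟨w, i, j, hij, rfl⟩
    · exact houter _ _ (hκ.rel_apply i)
    · exact hinner w i j hij.ne
  · refine fun ⟨hforbidden, hfree⟩ => ⟨fun w i j hij h => ?_, fun x y hxy h => ?_⟩
    · rcases lt_or_gt_of_ne hij with hlt | hlt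
      · exact hforbidden _ (mem_forbiddenPairs_iff.2 (Or.inr ⟨w, i, j, hlt, rfl⟩)) h
      · exact hforbidden _ (mem_forbiddenPairs_iff.2 (Or.inr ⟨w, j, i, hlt, rfl⟩)) h.symm
    · have hp (i : Fin k) : ¬ EqvGen (g.NodeLink p ε b) i (p i) :=
        hforbidden _ (mem_forbiddenPairs_iff.2 (Or.inl ⟨i, rfl⟩))
      have hpx : p x ≠ y := fun hpx => hp x (hpx ▸ h)
      have hpy : p y ≠ x := fun hpy => hp y (hpy ▸ h.symm)
      rcases lt_trichotomy x y with hlt | rfl | hlt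
      · exact hfree x y ⟨hlt, hpx, hpy⟩ hxy h
      · exact hκ.irrefl x hxy
      · exact hfree y x ⟨hlt, hpy, hpx⟩ (hκ.symm hxy) h.symm

theorem forbiddenPairs_lt_and_ne {m : ℕ} {p : Fin k → Fin k} (hp : ∀ i, p i ≠ i) {q : ℕ × ℕ}
    (hq : q ∈ forbiddenPairs m p) : q.1 < k + 3 * m ∧ q.2 < k + 3 * m ∧ q.1 ≠ q.2 := by
  rcases mem_forbiddenPairs_iff.1 hq with ⟨i, rfl⟩ | ⟨w, i, j, hij, rfl⟩
  · have := Fin.val_ne_of_ne (hp i)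
    dsimp only
    omega
  · dsimp only
    omega

theorem count_eq_countP_matrices {N : ℕ} (g : Gadget k) (hN : k + 3 * g.order ≤ N)
    {p : Fin k → Fin k} {κ : Fin k → Fin k → Prop} (hκ : IsConflictSystem p κ)
    (K : ℕ × ℕ → Bool) (hK : ∀ x y : Fin k, K (x, y) = true ↔ κ x y) :
    g.count p (fun _ => true) κ = (g.matrices N p).countP
      fun M => (freePairs p).all fun q => !K q || apart N q M := by
  have hp (i : Fin k) : p i ≠ i := fun h => hκ.irrefl i (by simpa only [h] using hκ.rel_apply i)
  have hforbidden {q : ℕ × ℕ} (hq : q ∈ forbiddenPairs g.order p) :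
      q.1 < N ∧ q.2 < N ∧ q.1 ≠ q.2 :=
    have h := forbiddenPairs_lt_and_ne hp hq
    ⟨h.1.trans_le hN, h.2.1.trans_le hN, h.2.2⟩
  rw [matrices, countP_leaves, count]
  · refine Nat.card_congr (Equiv.subtypeEquivRight fun b => ?_)
    have hbit : Represents N (linkAll N (node p fun _ => true) g.edges (diagonal N) b)
        (g.NodeLink p (fun _ => true) b) :=
      ((represents_diagonal N).linkAll (fun z c => (node_lt _ _ z c).trans_le hN) g.edges b).congr
        fun x y => or_iff_right id
    rw [admissible_iff hκ, land_setBits_pairs_eq_zero_iff, List.all_eq_true]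
    refine and_congr (forall₂_congr fun q hq => ?_) ?_
    · rw [← hbit _ _ (hforbidden hq).1 (hforbidden hq).2.1, Bool.not_eq_true]
    · have hfree (x y : Fin k) : (!K (x, y) || apart N (x, y)
          (linkAll N (node p fun _ => true) g.edges (diagonal N) b)) = true ↔
          (κ x y → ¬ EqvGen (g.NodeLink p (fun _ => true) b) x y) := by
        rw [← hK, ← hbit _ _ (by omega) (by omega)]
        cases K (x, y) <;> simp [apart]
      refine ⟨fun h q hq => ?_, fun h x y hxy =>
        (hfree x y).1 (h _ (mem_freePairs_iff.2 ⟨x, y, hxy, rfl⟩))⟩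
      obtain ⟨x, y, hxy, rfl⟩ := mem_freePairs_iff.1 hq
      exact (hfree x y).2 (h x y hxy)
  · rw [land_setBits_pairs_eq_zero_iff]
    intro q hq
    obtain ⟨hx, hy, hne⟩ := hforbidden hq
    rw [Bool.eq_false_iff, Ne, represents_diagonal N _ _ hx hy]
    exact fun h => hne (apply_eq_of_eqvGen (f := id) (fun _ _ h => h.elim) h)

theorem mul_sum_count_le_of_compareCounts {r N a b : ℕ} {g' : Fin r → Gadget k} {g : Gadget k}
    (hN : k + 3 * g.order ≤ N) (hN' : ∀ i, k + 3 * (g' i).order ≤ N) {p : Fin k → Fin k}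
    {κ : Fin k → Fin k → Prop} (hκ : IsConflictSystem p κ)
    (h : compareCounts N a b g' g p = true) (ε : Fin k → Bool) :
    a * ∑ i, (g' i).count p ε κ ≤ b * g.count p ε κ := by
  classical
  let K (q : ℕ × ℕ) : Bool := decide (∃ x y : Fin k, κ x y ∧ q = (x.val, y.val))
  have hK (x y : Fin k) : K (x, y) = true ↔ κ x y := by
    simp [K, Fin.val_inj]
  have hcount (g : Gadget k) (hN : k + 3 * g.order ≤ N) : g.count p ε κ = _ :=
    (g.count_eq_count_true p ε κ).trans (g.count_eq_countP_matrices hN hκ K hK)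
  have hle := mul_countP_le_of_compareApart K _ _ _ h
  rw [List.countP_flatMap, ← List.ofFn_eq_map, List.sum_ofFn] at hle
  simpa only [hcount g hN, hcount (g' _) (hN' _), comp_apply] using hle

/- The bijections of `Fin k` are enumerated as the permutations of the list `0, …, k - 1`. -/
theorem mul_sum_count_le {r N a b : ℕ} {g' : Fin r → Gadget k} {g : Gadget k}
    (hN : k + 3 * g.order ≤ N) (hN' : ∀ i, k + 3 * (g' i).order ≤ N)
    (h : ∀ l ∈ (List.finRange k).permutations', (∀ i : Fin k, l.getD i i ≠ i) →
      compareCounts N a b g' g (fun i => l.getD i i) = true)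
    (p : Fin k → Fin k) (ε : Fin k → Bool) (κ : Fin k → Fin k → Prop)
    (hκ : IsConflictSystem p κ) :
    a * ∑ i, (g' i).count p ε κ ≤ b * g.count p ε κ := by
  have hgetD (i : Fin k) : (List.ofFn p).getD i i = p i := by simp
  have hp (i : Fin k) : p i ≠ i := fun h => hκ.irrefl i (by simpa only [h] using hκ.rel_apply i)
  have hperm : (List.ofFn p).Perm (List.finRange k) := by
    rw [← List.ofFn_id]
    exact Equiv.Perm.ofFn_comp_perm
      (Equiv.ofBijective p (Finite.injective_iff_bijective.1 hκ.injective)) id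
  have hcompare := h _ (List.mem_permutations'.2 hperm) fun i => by rw [hgetD]; exact hp i
  simp only [hgetD] at hcompare
  exact mul_sum_count_le_of_compareCounts hN hN' hκ hcompare ε

end Gadget

/-! ### The gadgets for short faces -/

theorem bijective_port {k m : ℕ} {edges : List (Port k m × Port k m)}
    (hlength : 2 * edges.length = 3 * m + k) (hmem : ∀ z, ∃ e ∈ edges, e.1 = z ∨ e.2 = z) :
    Bijective fun x : Fin edges.length × Bool =>
      bif x.2 then (edges.get x.1).2 else (edges.get x.1).1 := by
  refine (Fintype.bijective_iff_surjective_and_card _).2 ⟨fun z => ?_, ?_⟩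
  · obtain ⟨e, he, hz⟩ := hmem z
    obtain ⟨i, rfl⟩ := List.mem_iff_get.1 he
    rcases hz with hz | hz
    · exact ⟨(i, false), hz⟩
    · exact ⟨(i, true), hz⟩
  · simp only [Fintype.card_prod, Fintype.card_fin, Fintype.card_bool, Fintype.card_sum]
    omega

/-- A cycle of length `k` with a loose end at each vertex. -/
def cycleGadget (k : ℕ) [NeZero k] : Gadget k where
  order := k
  edges := (List.finRange k).flatMap fun i =>
    [(Sum.inl (i, 1), Sum.inl (i + 1, 0)), (Sum.inl (i, 2), Sum.inr i)]
  port_bijective := by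
    refine bijective_port (by simp; ring) fun z => ?_
    simp only [List.mem_flatMap, List.mem_finRange, true_and, List.mem_cons, List.not_mem_nil,
      or_false]
    rcases z with ⟨i, j⟩ | i
    · fin_cases j
      · exact ⟨_, ⟨i - 1, Or.inl rfl⟩, by simp⟩
      · exact ⟨_, ⟨i, Or.inl rfl⟩, by simp⟩
      · exact ⟨_, ⟨i, Or.inr rfl⟩, by simp⟩
    · exact ⟨_, ⟨i, Or.inr rfl⟩, by simp⟩

/-- Two loose ends are joined. -/
def edgeGadget : Gadget 2 where
  order := 0
  edges := [(Sum.inr 0, Sum.inr 1)]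
  port_bijective := by decide

/-- Three loose ends are joined to a new vertex. -/
def clawGadget : Gadget 3 where
  order := 1
  edges := [(Sum.inl (0, 0), Sum.inr 2), (Sum.inl (0, 1), Sum.inr 1), (Sum.inl (0, 2), Sum.inr 0)]
  port_bijective := by decide

/-- Four loose ends are joined by two edges. -/
def edgesGadget (j : Fin 4) : Gadget 4 where
  order := 0
  edges := [(Sum.inr j, Sum.inr (j + 1)), (Sum.inr (j + 2), Sum.inr (j + 3))]
  port_bijective := by decide +revert

/-- Two of five loose ends are joined, the others are joined to a new vertex. -/
def edgeClawGadget (j : Fin 5) : Gadget 5 where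
  order := 1
  edges := [(Sum.inr j, Sum.inr (j + 1)), (Sum.inl (0, 0), Sum.inr (j + 4)),
    (Sum.inl (0, 1), Sum.inr (j + 3)), (Sum.inl (0, 2), Sum.inr (j + 2))]
  port_bijective := by decide +revert +kernel

namespace Gadget

theorem two_mul_count_edgeGadget_le (p : Fin 2 → Fin 2) (ε : Fin 2 → Bool)
    (κ : Fin 2 → Fin 2 → Prop) (hκ : IsConflictSystem p κ) :
    2 * ∑ _i : Fin 1, edgeGadget.count p ε κ ≤ 1 * (cycleGadget 2).count p ε κ :=
  mul_sum_count_le (N := 8) (by decide) (by decide) (by decide +kernel) p ε κ hκ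

theorem two_mul_count_clawGadget_le (p : Fin 3 → Fin 3) (ε : Fin 3 → Bool)
    (κ : Fin 3 → Fin 3 → Prop) (hκ : IsConflictSystem p κ) :
    2 * ∑ _i : Fin 1, clawGadget.count p ε κ ≤ 1 * (cycleGadget 3).count p ε κ :=
  mul_sum_count_le (N := 12) (by decide) (by decide) (by decide +kernel) p ε κ hκ

theorem two_mul_sum_count_edgesGadget_le (p : Fin 4 → Fin 4) (ε : Fin 4 → Bool)
    (κ : Fin 4 → Fin 4 → Prop) (hκ : IsConflictSystem p κ) :
    2 * ∑ i : Fin 2, (edgesGadget (Fin.castLE (by decide) i)).count p ε κ ≤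
      1 * (cycleGadget 4).count p ε κ :=
  mul_sum_count_le (N := 16) (by decide) (by decide) (by decide +kernel) p ε κ hκ

theorem sum_count_edgeClawGadget_le (p : Fin 5 → Fin 5) (ε : Fin 5 → Bool)
    (κ : Fin 5 → Fin 5 → Prop) (hκ : IsConflictSystem p κ) :
    1 * ∑ i : Fin 5, (edgeClawGadget i).count p ε κ ≤ 2 * (cycleGadget 5).count p ε κ :=
  mul_sum_count_le (N := 20) (by decide) (by decide) (by decide +kernel) p ε κ hκ

end Gadget

end GadgetCounts

/-! ### Connectivity and planarity of glued maps -/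

section GluedMaps

open Relation Function Finset

namespace Placement

variable {V W : Type*} {k : ℕ} {O : OpenMap W k} {g : Gadget k}

/-- The reversal of the darts of a glued map. -/
def swap : {d // O.inv d ≠ d} ⊕ (Fin g.edges.length × Bool) →
    {d // O.inv d ≠ d} ⊕ (Fin g.edges.length × Bool) :=
  Sum.map (fun d => ⟨O.inv d.1, O.inv_involutive.injective.ne d.2⟩) fun x => (x.1, !x.2)

theorem swap_swap (x : {d // O.inv d ≠ d} ⊕ (Fin g.edges.length × Bool)) : swap (swap x) = x := by
  rcases x with d | x
  · simp [swap, O.inv_involutive d.1]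
  · simp [swap]

theorem swap_ne (x : {d // O.inv d ≠ d} ⊕ (Fin g.edges.length × Bool)) : swap x ≠ x := by
  rcases x with d | x
  · simpa [swap, Subtype.ext_iff] using d.2
  · simp [swap, Prod.ext_iff]

variable (P : Placement V O g)

/-- The map that arises by gluing a gadget to the loose ends of a map. -/
noncomputable def glue : CubicMap V where
  inv d := P.dartEquiv (swap (P.dartEquiv.symm d))
  inv_inv d := by rw [Equiv.symm_apply_apply, swap_swap, Equiv.apply_symm_apply]
  inv_ne d h := swap_ne _ ((Equiv.eq_symm_apply _).2 h)

theorem inv_glue_dartEquiv (x : {d // O.inv d ≠ d} ⊕ (Fin g.edges.length × Bool)) :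
    P.glue.inv (P.dartEquiv x) = P.dartEquiv (swap x) :=
  congrArg (fun y => P.dartEquiv (swap y)) (P.dartEquiv.symm_apply_apply x)

/-- The map `P.glue` as a gluing. -/
noncomputable def gluing : Gluing P.glue O g where
  toPlacement := P
  inv_outerDart {d} hd := P.inv_glue_dartEquiv (Sum.inl ⟨d, hd⟩)
  inv_portDart e he := by
    obtain ⟨i, rfl⟩ := List.get_of_mem he
    exact P.inv_glue_dartEquiv (Sum.inr (i, false))

/-- The vertices of the glued map that are selected by `x` and `y`. -/
def vertexSet [Fintype V] (x : W → Bool) (y : Fin g.order → Bool) : Finset V :=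
  {v | Sum.elim x y (P.vertexEquiv.symm v) = true}

variable [Fintype V]

theorem vertexEquiv_mem_vertexSet {x : W → Bool} {y : Fin g.order → Bool} {z : W ⊕ Fin g.order} :
    P.vertexEquiv z ∈ P.vertexSet x y ↔ Sum.elim x y z = true := by
  simp [vertexSet]

theorem exists_vertexSet_eq (X : Finset V) : ∃ x y, P.vertexSet x y = X := by
  classical
  refine ⟨fun u => decide (P.vertexEquiv (Sum.inl u) ∈ X),
    fun i => decide (P.vertexEquiv (Sum.inr i) ∈ X), Finset.ext fun v => ?_⟩
  obtain ⟨u | i, rfl⟩ := P.vertexEquiv.surjective v <;>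
  simp [vertexEquiv_mem_vertexSet]

theorem vertexSet_eq_univ_iff {x : W → Bool} {y : Fin g.order → Bool} :
    P.vertexSet x y = univ ↔ (∀ u, x u = true) ∧ ∀ i, y i = true := by
  simp [eq_univ_iff_forall, ← P.vertexEquiv.forall_congr_right, vertexEquiv_mem_vertexSet]

theorem vertexSet_eq_empty_iff {x : W → Bool} {y : Fin g.order → Bool} :
    P.vertexSet x y = ∅ ↔ (∀ u, x u = false) ∧ ∀ i, y i = false := by
  simp [eq_empty_iff_forall_notMem, ← P.vertexEquiv.forall_congr_right, vertexEquiv_mem_vertexSet]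

end Placement

namespace Placement

variable {V W : Type*} {k : ℕ} [NeZero k] {O : OpenMap W k} (P : Placement V O (cycleGadget k))

/-- The dart `j` at the vertex `i` of a glued cycle: `0` and `1` lead to the vertices `i - 1` and
`i + 1`, and `2` to the loose end `i`. -/
def cycleDart (i : Fin k) (j : Fin 3) : V × Fin 3 := P.portDart (Sum.inl (i, j))

theorem crn_cycleDart_false (i : Fin k) (j : Fin 3) :
    crn (P.cycleDart i j) false = crn (P.cycleDart i (j + 2)) true := by
  have hcrn (j : Fin 3) : j + 1 = j + 2 + 2 := by
    fin_cases j <;> rfl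
  simp only [crn, cycleDart, portDart, Sum.elim_inl, cond_false, cond_true, hcrn,
    add_right_comm j 2]

theorem exists_outerDart_eq_or_exists_crn_cycleDart_eq (q : V × Fin 3) :
    (∃ u, P.outerDart u = q) ∨ ∃ i j, crn (P.cycleDart i j) true = q := by
  obtain ⟨v, j⟩ := q
  obtain ⟨u | i, rfl⟩ := P.vertexEquiv.surjective v
  · exact Or.inl ⟨(u, j), rfl⟩
  · refine Or.inr ⟨i, j - P.shift i - 2, ?_⟩
    simp [crn, cycleDart, portDart, add_right_comm _ (P.shift _)]

end Placement

namespace Gadget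

variable {k : ℕ}

/-- The truth value at the vertex of a port. -/
def side {m : ℕ} (y : Fin m → Bool) (w : Fin k → Bool) : Port k m → Bool :=
  Sum.elim (fun d => y d.1) w

/-- The number of edges of the gadget whose ends have different truth values. -/
def cut (g : Gadget k) (y : Fin g.order → Bool) (w : Fin k → Bool) : ℕ :=
  ∑ e : Fin g.edges.length, if side y w (g.edges.get e).1 = side y w (g.edges.get e).2 then 0 else 1

/-- For every set of vertices of `g'` there is one of `g` that is left by at most as many edges,
or by at most two more if it contains two vertices and avoids two others. -/
def CutDominates (g g' : Gadget k) : Prop :=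
  ∀ (y' : Fin g'.order → Bool) (w : Fin k → Bool), ∃ y : Fin g.order → Bool,
    (g.cut y w ≤ g'.cut y' w ∧ ∀ c, (∀ i, y i = c) → (∀ i, w i = c) → ∀ i, y' i = c) ∨
    (g.cut y w ≤ g'.cut y' w + 2 ∧ ∀ c, 2 ≤ #{i | y i = c})

end Gadget

/-- The number of edges of the open map that leave a set of vertices. -/
def OpenMap.cut {W : Type*} [Fintype W] [DecidableEq W] {k : ℕ} (O : OpenMap W k) (x : W → Bool) :
    ℕ :=
  ∑ d : {d // O.inv d ≠ d}, if x d.1.1 = true ∧ x (O.inv d).1 = false then 1 else 0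

namespace Gluing

open Placement

variable {V V' W : Type*} [Fintype V] [DecidableEq V] [Fintype V'] [DecidableEq V'] {k : ℕ}
  {M : CubicMap V} {M' : CubicMap V'} {O : OpenMap W k} {g g' : Gadget k}

theorem cut_vertexSet [Fintype W] [DecidableEq W] (G : Gluing M O g) (x : W → Bool)
    (y : Fin g.order → Bool) :
    M.cut (G.vertexSet x y) = O.cut x + g.cut y fun i => x (O.leg i).1 := by
  have hport (z : Port k g.order) : (G.portDart z).1 ∈ G.vertexSet x y ↔
      Gadget.side y (fun i => x (O.leg i).1) z = true := by
    rcases z with d | i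
    exacts [G.vertexEquiv_mem_vertexSet, G.vertexEquiv_mem_vertexSet]
  have houter (d : W × Fin 3) : (G.outerDart d).1 ∈ G.vertexSet x y ↔ x d.1 = true :=
    G.vertexEquiv_mem_vertexSet
  rw [CubicMap.cut, card_filter, ← Equiv.sum_comp G.dartEquiv, Fintype.sum_sum_type,
    Fintype.sum_prod_type]
  congr 1
  · refine sum_congr rfl fun d _ => ?_
    simp only [dartEquiv_inl, G.inv_outerDart d.2, houter, Bool.not_eq_true]
  · refine sum_congr rfl fun e _ => ?_
    simp only [Fintype.sum_bool, dartEquiv_inr, G.inv_portDart_port, hport]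
    simp only [Gadget.port, Bool.not_true, Bool.not_false, cond_true, cond_false]
    generalize Gadget.side y _ (g.edges.get e).1 = a, Gadget.side y _ (g.edges.get e).2 = b
    cases a <;> cases b <;> rfl

/- A vertex set of `M'` that is left by fewer than two edges gives such a set of `M`, or one that is
left by at most three edges and divides the atom `A`. -/
theorem twoConn (G : Gluing M O g) (G' : Gluing M' O g') (hM : M.TwoConn) {A : Finset V}
    (hA : M.IsAtom A) (hmem : ∀ i, G.vertexEquiv (Sum.inr i) ∈ A) (h : g.CutDominates g') :
    M'.TwoConn := by
  classical
  have : Fintype W := Fintype.ofInjective _ (G.vertexEquiv.injective.comp Sum.inl_injective)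
  intro X' hne huniv
  obtain ⟨x, y', rfl⟩ := G'.exists_vertexSet_eq X'
  rw [nonempty_iff_ne_empty, Ne, vertexSet_eq_empty_iff] at hne
  rw [Ne, vertexSet_eq_univ_iff] at huniv
  rw [cut_vertexSet]
  obtain ⟨y, ⟨hle, hconst⟩ | ⟨hle, hcard⟩⟩ := h y' fun i => x (O.leg i).1
  · have hcut : 2 ≤ M.cut (G.vertexSet x y) := by
      refine hM _ (nonempty_iff_ne_empty.2 fun hX => ?_) fun hX => ?_
      · rw [vertexSet_eq_empty_iff] at hX
        exact hne ⟨hX.1, hconst false hX.2 fun i => hX.1 _⟩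
      · rw [vertexSet_eq_univ_iff] at hX
        exact huniv ⟨hX.1, hconst true hX.2 fun i => hX.1 _⟩
    rw [cut_vertexSet] at hcut
    omega
  · by_contra! hlt
    have hcut : M.cut (G.vertexSet x y) ≤ 3 := by
      rw [cut_vertexSet]
      omega
    have hinj : Injective fun i => G.vertexEquiv (Sum.inr i) :=
      G.vertexEquiv.injective.comp Sum.inr_injective
    have hinter : #{i | y i = true} ≤ #(A ∩ G.vertexSet x y) :=
      card_le_card_of_injOn _ (fun i hi => by
        simpa [hmem, vertexEquiv_mem_vertexSet] using hi) hinj.injOn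
    have hsdiff : #{i | y i = false} ≤ #(A \ G.vertexSet x y) :=
      card_le_card_of_injOn _ (fun i hi => by
        simpa [hmem, vertexEquiv_mem_vertexSet] using hi) hinj.injOn
    have := hcard true
    have := hcard false
    rcases hA.card_inter_le_one_or_card_sdiff_le_one hM hcut with hA | hA <;> omega

end Gluing

namespace Gadget

variable {k : ℕ} [NeZero k]

/-- The face on a side of a port; the face between the loose ends `i` and `i + 1` has number `i`. -/
def faceIndex {m : ℕ} (a : Fin m × Fin 3 → Fin k) : Port k m → Bool → Fin k
  | Sum.inl d, c => a (crn d c)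
  | Sum.inr i, c => bif c then i else i - 1

/-- The faces around a gadget that replaces a cycle are given by `a`, after identification of the
faces `s` and `t`. -/
def FaceCompatible (g : Gadget k) (a : Fin g.order × Fin 3 → Fin k) (s t : Fin k) : Prop :=
  ∀ e ∈ g.edges, ∀ c : Bool,
    update id s t (faceIndex a e.1 c) = update id s t (faceIndex a e.2 (!c))

end Gadget

theorem update_id_apply_eq_of_update_id_eq {α β : Type*} [DecidableEq α] [DecidableEq β]
    (f : α → β) {s t a b : α} (h : update id s t a = update id s t b) :
    update id (f s) (f t) (f a) = update id (f s) (f t) (f b) := by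
  have hf (a : α) : update id (f s) (f t) (f a) = update id (f s) (f t) (f (update id s t a)) := by
    by_cases ha : a = s
    · by_cases hst : f t = f s <;> simp [ha, hst]
    · simp [ha]
  rw [hf, h, ← hf]

theorem card_le_card_image_update_id_add {α : Type*} [DecidableEq α] (S : Finset α) (a b : α) :
    #S ≤ #(S.image (update id a b)) + if a = b then 0 else 1 := by
  split_ifs with hab
  · have hid : update id a b = (id : α → α) := by rw [← hab, update_eq_self_iff, id]
    rw [hid, image_id, Nat.add_zero]
  · refine (card_le_card fun x hx => ?_).trans (card_insert_le a _)
    by_cases hxa : x = a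
    · exact hxa ▸ mem_insert_self _ _
    · exact mem_insert_of_mem (mem_image.2 ⟨x, hx, update_of_ne hxa _ _⟩)

namespace CubicMap.IsFaceLabelling

variable {V W ι : Type*} {k : ℕ} {M : CubicMap V} {O : OpenMap W k} {L : V × Fin 3 → ι}

theorem crn_portDart (hL : M.IsFaceLabelling L) {g : Gadget k} (G : Gluing M O g)
    {e : Port k g.order × Port k g.order} (he : e ∈ g.edges) (c : Bool) :
    L (crn (G.portDart e.1) c) = L (crn (G.portDart e.2) (!c)) := by
  rw [hL, G.inv_portDart e he]

variable [NeZero k]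

theorem crn_cycleDart_one (hL : M.IsFaceLabelling L) (G : Gluing M O (cycleGadget k)) (i : Fin k)
    (c : Bool) : L (crn (G.cycleDart i 1) c) = L (crn (G.cycleDart (i + 1) 0) (!c)) :=
  hL.crn_portDart G (e := (Sum.inl (i, 1), Sum.inl ((i + 1 : Fin k), 0)))
    (List.mem_flatMap.2 ⟨i, List.mem_finRange i, List.mem_cons_self⟩) c

theorem crn_cycleDart_two (hL : M.IsFaceLabelling L) (G : Gluing M O (cycleGadget k)) (i : Fin k)
    (c : Bool) : L (crn (G.cycleDart i 2) c) = L (crn (G.portDart (Sum.inr i)) (!c)) :=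
  hL.crn_portDart G (e := (Sum.inl (i, 2), Sum.inr i))
    (List.mem_flatMap.2 ⟨i, List.mem_finRange i, List.mem_cons_of_mem _ List.mem_cons_self⟩) c

theorem crn_leg_false (hL : M.IsFaceLabelling L) (G : Gluing M O (cycleGadget k)) (i : Fin k) :
    L (crn (G.portDart (Sum.inr i)) false) = L (crn (G.portDart (Sum.inr (i - 1))) true) :=
  calc L (crn (G.portDart (Sum.inr i)) false)
    _ = L (crn (G.cycleDart i 2) true) := (hL.crn_cycleDart_two G i true).symm
    _ = L (crn (G.cycleDart i 0) false) := congrArg L (G.crn_cycleDart_false i 0).symm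
    _ = L (crn (G.cycleDart (i - 1) 1) true) := by
      rw [hL.crn_cycleDart_one, sub_add_cancel, Bool.not_true]
    _ = L (crn (G.cycleDart (i - 1) 2) false) :=
      congrArg L (G.crn_cycleDart_false (i - 1) 2).symm
    _ = L (crn (G.portDart (Sum.inr (i - 1))) true) := hL.crn_cycleDart_two G (i - 1) false

open Fin.NatCast Fin.CommRing in
theorem crn_cycleDart_zero_true_eq (hL : M.IsFaceLabelling L) (G : Gluing M O (cycleGadget k))
    (i : Fin k) : L (crn (G.cycleDart i 0) true) = L (crn (G.cycleDart 0 0) true) := by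
  rw [← Fin.cast_val_eq_self i]
  induction i.val with
  | zero => rw [Nat.cast_zero]
  | succ n ih =>
    calc L (crn (G.cycleDart ((n + 1 : ℕ) : Fin k) 0) true)
      _ = L (crn (G.cycleDart n 1) false) := by
        rw [hL.crn_cycleDart_one, Nat.cast_succ, Bool.not_false]
      _ = L (crn (G.cycleDart n 0) true) := congrArg L (G.crn_cycleDart_false n 1)
      _ = L (crn (G.cycleDart 0 0) true) := ih

theorem card_image_le_card_image_outerDart_add_one [Fintype V] [Fintype W] [DecidableEq ι]
    (hL : M.IsFaceLabelling L) (G : Gluing M O (cycleGadget k)) :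
    #(univ.image L) ≤ #(univ.image (L ∘ G.outerDart)) + 1 := by
  refine (card_le_card fun x hx => ?_).trans (card_insert_le (L (crn (G.cycleDart 0 0) true)) _)
  obtain ⟨q, -, rfl⟩ := mem_image.1 hx
  have houter (u : W × Fin 3) : L (G.outerDart u) ∈ univ.image (L ∘ G.outerDart) :=
    mem_image_of_mem _ (mem_univ u)
  have hleg (i : Fin k) (c : Bool) :
      L (crn (G.cycleDart i 2) c) ∈ univ.image (L ∘ G.outerDart) := by
    rw [hL.crn_cycleDart_two, Placement.crn_portDart_inr]
    exact houter _
  rcases G.exists_outerDart_eq_or_exists_crn_cycleDart_eq q with ⟨u, rfl⟩ | ⟨i, j, rfl⟩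
  · exact mem_insert_of_mem (houter u)
  · fin_cases j
    · exact mem_insert.2 (Or.inl (hL.crn_cycleDart_zero_true_eq G i))
    · exact mem_insert_of_mem (G.crn_cycleDart_false i 2 ▸ hleg i false)
    · exact mem_insert_of_mem (hleg i true)

/- The labels of the faces outside the cycle are kept, except that those of `s` and `t` are
identified. -/
theorem cornerElim_of_faceCompatible [DecidableEq ι] (hL : M.IsFaceLabelling L)
    (G : Gluing M O (cycleGadget k)) {V' : Type*} {M' : CubicMap V'} {g' : Gadget k}
    (G' : Gluing M' O g') {a : Fin g'.order × Fin 3 → Fin k} {s t : Fin k}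
    (h : g'.FaceCompatible a s t) {lab : Fin k → ι}
    (hlab : ∀ i, lab i = L (crn (G.portDart (Sum.inr i)) true)) :
    M'.IsFaceLabelling (update id (lab s) (lab t) ∘
      G'.cornerElim (L ∘ G.outerDart) (lab ∘ a)) := by
  have hport (z : Port k g'.order) (c : Bool) :
      G'.cornerElim (L ∘ G.outerDart) (lab ∘ a) (crn (G'.portDart z) c) =
        lab (Gadget.faceIndex a z c) := by
    rcases z with d | i
    · rw [Placement.crn_portDart_inl, Placement.cornerElim_inr, add_sub_cancel_right]
      rfl
    · rw [Placement.crn_portDart_inr, Placement.cornerElim_outerDart, hlab]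
      cases c
      exacts [hL.crn_leg_false G i, rfl]
  have hedge (e : Fin g'.edges.length) (c : Bool) :
      update id (lab s) (lab t) (lab (Gadget.faceIndex a (g'.edges.get e).1 c)) =
        update id (lab s) (lab t) (lab (Gadget.faceIndex a (g'.edges.get e).2 (!c))) :=
    update_id_apply_eq_of_update_id_eq lab (h _ (List.get_mem _ _) c)
  refine G'.forall_dart (fun d hd c => ?_) ?_
  · have hd' := hL (G.outerDart d) c
    rw [G.inv_outerDart hd, Placement.crn_outerDart, Placement.crn_outerDart] at hd'
    simp only [comp_apply, G'.inv_outerDart hd, Placement.crn_outerDart,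
      Placement.cornerElim_outerDart, hd']
  · rintro ⟨e, b⟩ c
    rw [G'.inv_portDart_port, comp_apply, comp_apply, hport, hport]
    cases b
    · exact hedge e c
    · have hc := hedge e (!c)
      rw [Bool.not_not] at hc
      exact hc.symm

end CubicMap.IsFaceLabelling

theorem Placement.card_eq {V W : Type*} [Fintype V] [Fintype W] {k : ℕ} {O : OpenMap W k}
    {g : Gadget k} (P : Placement V O g) : Fintype.card V = Fintype.card W + g.order := by
  rw [← Fintype.card_congr P.vertexEquiv, Fintype.card_sum, Fintype.card_fin]

/- Replacing the cycle loses its inner face and, if `s ≠ t`, one of the faces around it. -/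
theorem CubicMap.Planar.of_faceCompatible {V V' W : Type*} [Fintype V] [Fintype V'] {k : ℕ}
    [NeZero k] {M : CubicMap V} {M' : CubicMap V'} {O : OpenMap W k} {g' : Gadget k}
    (hM : M.Planar) (G : Gluing M O (cycleGadget k)) (G' : Gluing M' O g')
    {a : Fin g'.order × Fin 3 → Fin k} {s t : Fin k} (h : g'.FaceCompatible a s t)
    (hcard : g'.order + 2 + (if s = t then 0 else 2) ≤ k) : M'.Planar := by
  have : Fintype W := @Fintype.ofFinite W
    (Finite.of_injective _ (G.vertexEquiv.injective.comp Sum.inl_injective))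
  obtain ⟨L, hL, hLcard⟩ := hM
  let lab (i : Fin k) : ℕ := L (crn (G.portDart (Sum.inr i)) true)
  refine ⟨_, hL.cornerElim_of_faceCompatible G G' h (lab := lab) fun _ => rfl, ?_⟩
  have hcardV : Fintype.card V = Fintype.card W + k := G.card_eq
  have hcardV' := G'.card_eq
  have hinner := hL.card_image_le_card_image_outerDart_add_one G
  have hmerge := card_le_card_image_update_id_add (univ.image (L ∘ G.outerDart)) (lab s) (lab t)
  have himage : (univ.image (L ∘ G.outerDart)).image (update id (lab s) (lab t)) ⊆
      univ.image (update id (lab s) (lab t) ∘ G'.cornerElim (L ∘ G.outerDart) (lab ∘ a)) := by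
    rw [image_image]
    refine image_subset_iff.2 fun u _ => mem_image.2 ⟨G'.outerDart u, mem_univ _, ?_⟩
    simp only [comp_apply, Placement.cornerElim_outerDart]
  have hsubset := card_le_card himage
  by_cases hst : s = t
  · rw [if_pos hst] at hcard
    rw [if_pos (congrArg lab hst)] at hmerge
    omega
  · rw [if_neg hst] at hcard
    split_ifs at hmerge <;> omega

end GluedMaps

/-! ### Face cycles -/

namespace CubicMap

open Relation Function Finset

section FaceCycle

variable {V : Type*} {M : CubicMap V} {k : ℕ} [NeZero k] {D : Fin k → V × Fin 3}

/-- The darts `D 0, …, D (k - 1)` run once or several times around a face. -/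
def IsFaceWalk (M : CubicMap V) (D : Fin k → V × Fin 3) : Prop := ∀ i, M.face (D i) = D (i + 1)

/-- The dart at the vertex of `d` that lies neither on `d` nor on the edge preceding `d` on its
face. -/
def sideDart (d : V × Fin 3) : V × Fin 3 := (d.1, d.2 + 1)

/-- The darts `D 0, …, D (k - 1)` run around a face whose boundary is an induced cycle. -/
structure IsFaceCycle (M : CubicMap V) (D : Fin k → V × Fin 3) : Prop where
  isFaceWalk : M.IsFaceWalk D
  fst_injective : Injective fun i => (D i).1
  inv_sideDart_fst_ne : ∀ i j, (D j).1 ≠ (M.inv (sideDart (D i))).1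

theorem eq_or_eq_sideDart_or_eq_of_fst_eq {d e : V × Fin 3} (h : e.1 = d.1) :
    e = d ∨ e = sideDart d ∨ e = (d.1, d.2 + 2) := by
  have hcases : ∀ i j : Fin 3, i = j ∨ i = j + 1 ∨ i = j + 2 := by decide
  simpa [sideDart, Prod.ext_iff, h] using hcases e.2 d.2

namespace IsFaceWalk

theorem inv_apply (hD : M.IsFaceWalk D) (i : Fin k) :
    M.inv (D i) = ((D (i + 1)).1, (D (i + 1)).2 + 2) := by
  have hadd : ∀ x : Fin 3, x = x + 1 + 2 := by decide
  rw [← hD, face_apply]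
  exact Prod.ext rfl (hadd _)

theorem inv_add_two (hD : M.IsFaceWalk D) (i : Fin k) :
    M.inv ((D i).1, (D i).2 + 2) = D (i - 1) := by
  have h := hD.inv_apply (i - 1)
  rw [sub_add_cancel] at h
  rw [← h, M.inv_inv]

theorem inv_sideDart_eq_sideDart (hD : M.IsFaceWalk D) (hinj : Injective fun i => (D i).1)
    {a b : Fin k} (hab : (D b).1 = (M.inv (sideDart (D a))).1) :
    M.inv (sideDart (D a)) = sideDart (D b) := by
  have hne_one : ∀ x : Fin 3, x + 1 ≠ x := by decide
  have hne_two : ∀ x : Fin 3, x + 1 ≠ x + 2 := by decide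
  rcases eq_or_eq_sideDart_or_eq_of_fst_eq hab.symm with h | h | h
  · have hside := M.inv_inv (sideDart (D a))
    rw [h, hD.inv_apply] at hside
    obtain rfl : b + 1 = a := hinj (Prod.ext_iff.1 hside).1
    exact absurd (Prod.ext_iff.1 hside).2.symm (hne_two _)
  · exact h
  · have hside := M.inv_inv (sideDart (D a))
    rw [h, hD.inv_add_two] at hside
    obtain rfl : b - 1 = a := hinj (Prod.ext_iff.1 hside).1
    exact absurd (Prod.ext_iff.1 hside).2.symm (hne_one _)

/- If a face visits a vertex twice, it traverses one of the edges at the vertex in both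
directions. -/
theorem fst_injective (hD : M.IsFaceWalk D) (hinj : Injective D)
    (hloop : ∀ d, (M.inv d).1 ≠ d.1)
    (hk : ∀ i j : Fin k, i ≠ j → i + 1 = j ∨ j + 1 = i ∨ i + 1 = j - 1 ∨ i + 1 + 1 = j - 1) :
    Injective fun i => (D i).1 := by
  have hstep (i) : (D (i + 1)).1 ≠ (D i).1 := fun h => hloop (D i) (by rw [hD.inv_apply, h])
  have hside (i j) (hij : i ≠ j) : D j ≠ sideDart (D i) := by
    intro hj
    have hback : D (j - 1) = M.inv (D i) := by
      apply M.face.injective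
      rw [hD, sub_add_cancel, hj, face_inv, sideDart]
    rcases hk i j hij with rfl | rfl | h | h
    · exact hstep i (Prod.ext_iff.1 hj).1
    · exact hstep j (Prod.ext_iff.1 hj).1.symm
    · have hne : ∀ x : Fin 3, x ≠ x + 2 := by decide
      rw [← h, hD.inv_apply] at hback
      exact hne _ (Prod.ext_iff.1 hback).2
    · rw [← h, hD.inv_apply] at hback
      exact hstep (i + 1) (Prod.ext_iff.1 hback).1
  intro i j h
  by_contra hij
  rcases eq_or_eq_sideDart_or_eq_of_fst_eq h with h | h | h
  · exact hij (hinj h)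
  · exact hside j i (Ne.symm hij) h
  · have hadd : ∀ x : Fin 3, x = x + 2 + 1 := by decide
    refine hside i j hij (h ▸ ?_)
    exact Prod.ext rfl (hadd _)

end IsFaceWalk

theorem exists_isFaceWalk (M : CubicMap V) {d : V × Fin 3} {n : ℕ} (hn : 0 < n)
    (hd : (M.face ^ n) d = d) : ∃ (k : ℕ) (_ : NeZero k) (D : Fin k → V × Fin 3),
      k ≤ n ∧ Injective D ∧ M.IsFaceWalk D ∧ ∀ i, M.face.SameCycle d (D i) := by
  have hper : IsPeriodicPt M.face n d := by
    rwa [IsPeriodicPt, IsFixedPt, Equiv.Perm.iterate_eq_pow]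
  refine ⟨minimalPeriod M.face d, ⟨(hper.minimalPeriod_pos hn).ne'⟩,
    fun i => M.face^[i] d, hper.minimalPeriod_le hn, fun i j hij => ?_, fun i => ?_, fun i => ?_⟩
  · exact Fin.ext (iterate_injOn_Iio_minimalPeriod i.2 j.2 hij)
  · dsimp only
    rw [← iterate_succ_apply' M.face, ← iterate_mod_minimalPeriod_eq, Fin.val_add, Fin.val_one',
      Nat.add_mod_mod]
  · exact ⟨i, by simp only [zpow_natCast, Equiv.Perm.iterate_eq_pow]⟩

end FaceCycle

namespace IsFaceCycle

section Outer

variable {V : Type*} {M : CubicMap V} {k : ℕ} {D : Fin k → V × Fin 3}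

/-- The vertices outside a face. -/
abbrev Outer (D : Fin k → V × Fin 3) : Type _ := {v // ∀ i, (D i).1 ≠ v}

open Classical in
/-- The reversal of the darts after the vertices of a face have been removed. -/
noncomputable def outerInv (M : CubicMap V) (D : Fin k → V × Fin 3) (d : Outer D × Fin 3) :
    Outer D × Fin 3 :=
  if h : ∀ i, (D i).1 ≠ (M.inv (d.1.1, d.2)).1 then (⟨_, h⟩, (M.inv (d.1.1, d.2)).2) else d

theorem prodMap_val_injective : Injective (Prod.map Subtype.val id : Outer D × Fin 3 → V × Fin 3) :=
  Subtype.val_injective.prodMap injective_id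

theorem val_outerInv {d : Outer D × Fin 3} (h : ∀ i, (D i).1 ≠ (M.inv (d.1.1, d.2)).1) :
    (outerInv M D d).map Subtype.val id = M.inv (d.map Subtype.val id) := by
  rw [outerInv, dif_pos h]
  rfl

theorem outerInv_involutive : Involutive (outerInv M D) := by
  intro d
  by_cases h : ∀ i, (D i).1 ≠ (M.inv (d.1.1, d.2)).1
  · have hinv := val_outerInv h
    have hback : M.inv ((outerInv M D d).map Subtype.val id) = d.map Subtype.val id := by
      rw [hinv, M.inv_inv]
    refine prodMap_val_injective ((val_outerInv fun i hi => ?_).trans hback)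
    exact d.1.2 i (hi.trans (Prod.ext_iff.1 hback).1)
  · have hfix : outerInv M D d = d := dif_neg h
    rw [hfix, hfix]

theorem outerInv_eq_self_iff {d : Outer D × Fin 3} :
    outerInv M D d = d ↔ ∃ i, (D i).1 = (M.inv (d.1.1, d.2)).1 := by
  refine ⟨fun hd => ?_, fun ⟨i, hi⟩ => dif_neg fun h => h i hi⟩
  by_contra! h
  have hinv := val_outerInv h
  rw [hd] at hinv
  exact M.inv_ne _ hinv.symm

end Outer

variable {V : Type*} {M : CubicMap V} {k : ℕ} [NeZero k] {D : Fin k → V × Fin 3}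

/-- The map without the vertices of a face. -/
noncomputable def openMap (hD : M.IsFaceCycle D) : OpenMap (Outer D) k where
  inv := outerInv M D
  inv_involutive := outerInv_involutive
  leg i := (⟨_, hD.inv_sideDart_fst_ne i⟩, (M.inv (sideDart (D i))).2)
  leg_injective i j h := hD.fst_injective <|
    (Prod.ext_iff.1 (M.inv_involutive.injective (congrArg (Prod.map Subtype.val id) h))).1
  inv_eq_self_iff d := by
    rw [outerInv_eq_self_iff]
    constructor
    · rintro ⟨i, hi⟩
      refine ⟨i, prodMap_val_injective ?_⟩
      have hback := M.inv_inv (d.1.1, d.2)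
      rcases eq_or_eq_sideDart_or_eq_of_fst_eq hi.symm with h | h | h
      · rw [h, hD.isFaceWalk.inv_apply] at hback
        exact absurd (Prod.ext_iff.1 hback).1 (d.1.2 _)
      · rwa [h] at hback
      · rw [h, hD.isFaceWalk.inv_add_two] at hback
        exact absurd (Prod.ext_iff.1 hback).1 (d.1.2 _)
    · rintro ⟨i, rfl⟩
      exact ⟨i, (Prod.ext_iff.1 (M.inv_inv (sideDart (D i)))).1.symm⟩

theorem vertex_bijective (hD : M.IsFaceCycle D) :
    Bijective (Sum.elim Subtype.val fun i => (D i).1 : Outer D ⊕ Fin k → V) := by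
  refine ⟨Subtype.val_injective.sumElim hD.fst_injective fun u i h => u.2 i h.symm, fun v => ?_⟩
  by_cases h : ∀ i, (D i).1 ≠ v
  · exact ⟨Sum.inl ⟨v, h⟩, rfl⟩
  · obtain ⟨i, hi⟩ := not_forall_not.1 h
    exact ⟨Sum.inr i, hi⟩

/-- A map arises from the outside of a face by gluing a cycle. -/
noncomputable def gluing (hD : M.IsFaceCycle D) : Gluing M hD.openMap (cycleGadget k) where
  vertexEquiv := Equiv.ofBijective _ hD.vertex_bijective
  shift i := (D i).2 + 2
  inv_outerDart {d} hd := by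
    refine (val_outerInv fun i hi => ?_).symm
    exact hd (outerInv_eq_self_iff.2 ⟨i, hi⟩)
  inv_portDart e he := by
    obtain ⟨i, -, he⟩ := List.mem_flatMap.1 he
    rcases List.mem_cons.1 he with rfl | he
    · have hadd : ∀ x : Fin 3, 1 + (x + 2) = x := by decide
      change M.inv ((D i).1, 1 + ((D i).2 + 2)) = ((D (i + 1)).1, 0 + ((D (i + 1)).2 + 2))
      rw [hadd, zero_add]
      exact hD.isFaceWalk.inv_apply i
    · have hadd : ∀ x : Fin 3, 2 + (x + 2) = x + 1 := by decide
      obtain rfl := List.mem_singleton.1 he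
      change M.inv ((D i).1, 2 + ((D i).2 + 2)) = M.inv ((D i).1, (D i).2 + 1)
      rw [hadd]

end IsFaceCycle

section Chord

variable {k : ℕ} [inst : NeZero k]

/-- The number of darts at the vertices `I` of a face that may lead elsewhere if the face has a
chord between `a` and `b`. The dart `(i, 0)` follows the face, `(i, 1)` is the side dart, and
`(i, 2)` goes back along the face. -/
def chordCut (I : Finset (Fin k)) (a b : Fin k) : ℕ :=
  #{q : Fin k × Fin 3 | q.1 ∈ I ∧ ¬ (q.2 = 0 ∧ q.1 + 1 ∈ I) ∧ ¬ (q.2 = 2 ∧ q.1 - 1 ∈ I) ∧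
    ¬ (q.2 = 1 ∧ (q.1 = a ∨ q.1 = b))}

/- The shorter of the two arcs between `a` and `b` has at most one inner vertex. -/
theorem exists_chordCut_le (hk : 2 ≤ k) (hk' : k ≤ 5) :
    ∀ a b : Fin k, a ≠ b → ∃ I : Finset (Fin k), a ∈ I ∧ b ∈ I ∧
      (#I < k ∧ chordCut I a b ≤ 3 ∨ k = 2 ∧ chordCut I a b = 0) := by
  interval_cases k <;> (obtain rfl : inst = ⟨by decide⟩ := rfl; decide +kernel)

theorem add_one_eq_or_of_ne (hk : k ≤ 5) : ∀ i j : Fin k, i ≠ j →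
    i + 1 = j ∨ j + 1 = i ∨ i + 1 = j - 1 ∨ i + 1 + 1 = j - 1 := by
  have hpos := NeZero.pos k
  interval_cases k <;> (obtain rfl : inst = ⟨by decide⟩ := rfl; decide)

variable {V : Type*} [Fintype V] [DecidableEq V] {M : CubicMap V} {D : Fin k → V × Fin 3}

theorem IsFaceWalk.cut_image_le (hD : M.IsFaceWalk D) {a b : Fin k}
    (hab : M.inv (sideDart (D a)) = sideDart (D b)) {I : Finset (Fin k)} (ha : a ∈ I)
    (hb : b ∈ I) : M.cut (I.image fun i => (D i).1) ≤ chordCut I a b := by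
  refine (card_le_card ?_).trans
    (card_image_le (f := fun q : Fin k × Fin 3 => ((D q.1).1, q.2 + (D q.1).2)))
  rintro ⟨v, x⟩ hd
  simp only [mem_filter, mem_univ, true_and] at hd
  obtain ⟨hv, hout⟩ := hd
  obtain ⟨i, hi, rfl⟩ := mem_image.1 hv
  have hmem {j} (hj : j ∈ I) : (D j).1 ∈ I.image fun i => (D i).1 := mem_image_of_mem _ hj
  refine mem_image.2 ⟨(i, x - (D i).2), ?_, by simp⟩
  simp only [mem_filter, mem_univ, true_and, sub_eq_iff_eq_add', add_zero]
  refine ⟨hi, ?_, ?_, ?_⟩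
  · rintro ⟨rfl, hI⟩
    rw [Prod.mk.eta, hD.inv_apply] at hout
    exact hout (hmem hI)
  · rintro ⟨rfl, hI⟩
    rw [hD.inv_add_two] at hout
    exact hout (hmem hI)
  · rintro ⟨rfl, rfl | rfl⟩
    · exact hout ((Prod.ext_iff.1 hab).1 ▸ hmem hb)
    · rw [show ((D i).1, (D i).2 + 1) = sideDart (D i) from rfl, ← hab, M.inv_inv] at hout
      exact hout (hmem ha)

theorem TwoConn.inv_fst_ne (hM : M.TwoConn) (hV : 2 ≤ Fintype.card V) (d : V × Fin 3) :
    (M.inv d).1 ≠ d.1 := by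
  have hcut : 2 ≤ M.cut {d.1} := by
    refine hM _ (singleton_nonempty _) fun h => ?_
    rw [← card_univ, ← h, card_singleton] at hV
    omega
  have heven := M.even_cut_add_card {d.1}
  have hcard := card_filter_fst_mem {d.1}
  rw [card_singleton] at heven hcard
  have hleaves : ∀ e ∈ ({e : V × Fin 3 | e.1 ∈ ({d.1} : Finset V)} : Finset _),
      (M.inv e).1 ∉ ({d.1} : Finset V) := by
    rw [← filter_eq_self, filter_filter]
    refine eq_of_subset_of_card_le (monotone_filter_right _ fun _ _ h => h.1) ?_
    change _ ≤ M.cut {d.1}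
    rw [Nat.even_iff] at heven
    omega
  simpa using hleaves d (by simp)

/- A chord of the face would cut off a vertex set left by fewer edges than the minimality of `A`
permits. -/
theorem IsAtom.isFaceCycle {A : Finset V} (hA : M.IsAtom A) (hM : M.TwoConn)
    (hV : 3 ≤ Fintype.card V) (hD : M.IsFaceWalk D) (hinj : Injective fun i => (D i).1)
    (hmem : ∀ i, (D i).1 ∈ A) (hk : 2 ≤ k) (hk' : k ≤ 5) : M.IsFaceCycle D := by
  refine ⟨hD, hinj, fun a b hb => ?_⟩
  have hab := hD.inv_sideDart_eq_sideDart hinj hb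
  have hne : a ≠ b := by
    rintro rfl
    exact M.inv_ne _ hab
  obtain ⟨I, ha, hb, hI⟩ := exists_chordCut_le hk hk' a b hne
  have hcut := hD.cut_image_le hab ha hb
  have hcard (J : Finset (Fin k)) : #(J.image fun i => (D i).1) = #J :=
    card_image_of_injective _ hinj
  rcases hI with ⟨hlt, hchord⟩ | ⟨rfl, hchord⟩
  · have hsub : I.image (fun i => (D i).1) ⊂ A := by
      refine ((image_ssubset_image hinj).2 (ssubset_univ_iff.2 ?_)).trans_subset
        (image_subset_iff.2 fun i _ => hmem i)
      rintro rfl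
      simp at hlt
    have := hA.four_le_cut _ hsub (hcard I ▸ one_lt_card.2 ⟨a, ha, b, hb, hne⟩)
    omega
  · have := hM (I.image fun i => (D i).1) ⟨_, mem_image_of_mem _ ha⟩ fun h => by
      have hle := card_le_univ I
      rw [← hcard, h, card_univ, Fintype.card_fin] at hle
      omega
    omega

end Chord

theorem exists_isFaceCycle {V : Type*} [Fintype V] [DecidableEq V] {M : CubicMap V}
    (hM : M.TwoConn) (hP : M.Planar) (hV : 3 ≤ Fintype.card V) :
    ∃ A, M.IsAtom A ∧ ∃ (k : ℕ) (_ : NeZero k) (D : Fin k → V × Fin 3), 2 ≤ k ∧ k ≤ 5 ∧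
      M.IsFaceCycle D ∧ ∀ i, (D i).1 ∈ A := by
  obtain ⟨A, hA⟩ := M.exists_isAtom (by omega)
  obtain ⟨d, hd, n, hn, hn', hper⟩ := hA.exists_short_face hM hP
  obtain ⟨k, hk, D, hkn, hinj, hD, hcycle⟩ := M.exists_isFaceWalk hn hper
  have hloop := hM.inv_fst_ne (by omega)
  have hmem (i) : (D i).1 ∈ A := mem_innerDarts.1 hd _ (hcycle i)
  have hk2 : 2 ≤ k := by
    by_contra hlt
    obtain rfl : k = 1 := by
      have := hk.out
      omega
    have hinv := hD.inv_apply 0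
    rw [Subsingleton.elim (0 + 1 : Fin 1) 0] at hinv
    exact hloop (D 0) (Prod.ext_iff.1 hinv).1
  have hfst := hD.fst_injective hinj hloop (add_one_eq_or_of_ne (by omega))
  exact ⟨A, hA, k, hk, D, hk2, by omega, hA.isFaceCycle hM hV hD hfst hmem hk2 (by omega), hmem⟩

end CubicMap

/-! ### The induction -/

section Induction

open Relation Function Finset

namespace Gadget

/-- Replacing a facial cycle by this gadget preserves planarity and, for cycles inside an atom,
2-edge-connectedness. -/
structure IsReduction {k : ℕ} [NeZero k] (g : Gadget k) : Prop where
  cutDominates : (cycleGadget k).CutDominates g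
  exists_faceCompatible : ∃ a s t, g.FaceCompatible a s t ∧
    g.order + 2 + (if s = t then 0 else 2) ≤ k

theorem IsReduction.order_lt {k : ℕ} [NeZero k] {g : Gadget k} (h : g.IsReduction) :
    g.order < k := by
  obtain ⟨_, _, _, _, hle⟩ := h.exists_faceCompatible
  omega

theorem isReduction_edgeGadget : edgeGadget.IsReduction where
  cutDominates := by unfold CutDominates; decide +kernel
  exists_faceCompatible :=
    ⟨fun _ => 0, 0, 0, by unfold FaceCompatible; decide +kernel, by decide⟩

theorem isReduction_clawGadget : clawGadget.IsReduction where
  cutDominates := by unfold CutDominates; decide +kernel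
  exists_faceCompatible := ⟨fun d => if d.2 = 0 then 0 else if d.2 = 1 then 2 else 1, 0, 0,
    by unfold FaceCompatible; decide +kernel, by decide⟩

theorem isReduction_edgesGadget (j : Fin 4) : (edgesGadget j).IsReduction where
  cutDominates := by unfold CutDominates; decide +kernel +revert
  exists_faceCompatible :=
    ⟨fun _ => 0, j + 3, j + 1, by unfold FaceCompatible; decide +kernel +revert, by decide +revert⟩

theorem isReduction_edgeClawGadget (j : Fin 5) : (edgeClawGadget j).IsReduction where
  cutDominates := by unfold CutDominates; decide +kernel +revert
  exists_faceCompatible :=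
    ⟨fun d => if d.2 = 0 then j + 2 else if d.2 = 1 then j + 1 else j + 3, j + 4, j + 1,
      by unfold FaceCompatible; decide +kernel +revert, by decide +revert⟩

end Gadget

namespace CubicMap

/-- A proper colouring of the edges with three colours. -/
structure IsEdgeColoring {V : Type*} (M : CubicMap V) (f : V × Fin 3 → Fin 3) : Prop where
  apply_inv : ∀ d, f (M.inv d) = f d
  injective : ∀ v, Injective fun i => f (v, i)

namespace IsEdgeColoring

variable {V : Type*} {M : CubicMap V} {f : V × Fin 3 → Fin 3}

theorem apply_crn_ne (hf : M.IsEdgeColoring f) (d : V × Fin 3) (b : Bool) :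
    f (crn d b) ≠ f d := by
  have hne : ∀ (x : Fin 3) (b : Bool), (bif b then x + 2 else x + 1) ≠ x := by decide
  exact fun h => hne d.2 b (hf.injective d.1 h)

theorem apply_crn_false_ne (hf : M.IsEdgeColoring f) (d : V × Fin 3) :
    f (crn d false) ≠ f (crn d true) := by
  have hne : ∀ x : Fin 3, x + 1 ≠ x + 2 := by decide
  exact fun h => hne d.2 (hf.injective d.1 h)

/-- The twist for which a strand leaving a corner stays on the edges of the same two colours. -/
def twist (M : CubicMap V) (f : V × Fin 3 → Fin 3) (d : V × Fin 3) : Bool :=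
  decide (f (crn d false) = f (crn (M.inv d) false))

theorem twist_inv (d : V × Fin 3) : twist M f (M.inv d) = twist M f d := by
  simp only [twist, M.inv_inv]
  exact decide_eq_decide.2 eq_comm

theorem apply_crn_eq (hf : M.IsEdgeColoring f) (d : V × Fin 3) (b : Bool) :
    f (crn d b) = f (crn (M.inv d) (xor (!b) (twist M f d))) := by
  have hcolors : ∀ x y z y' z' : Fin 3, (y ≠ x ∧ z ≠ x ∧ y ≠ z) ∧ y' ≠ x ∧ z' ≠ x ∧ y' ≠ z' →
      (y = y' → z = z') ∧ (y ≠ y' → y = z' ∧ z = y') := by decide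
  obtain ⟨hpos, hneg⟩ := hcolors _ _ _ _ _
    ⟨⟨hf.apply_crn_ne d false, hf.apply_crn_ne d true, hf.apply_crn_false_ne d⟩,
      hf.apply_inv d ▸ hf.apply_crn_ne (M.inv d) false,
      hf.apply_inv d ▸ hf.apply_crn_ne (M.inv d) true, hf.apply_crn_false_ne (M.inv d)⟩
  by_cases heq : f (crn d false) = f (crn (M.inv d) false)
  · rw [twist, decide_eq_true heq]
    cases b
    exacts [heq, hpos heq]
  · rw [twist, decide_eq_false heq]
    cases b
    exacts [(hneg heq).1, (hneg heq).2]

theorem numCovers_pos [Finite V] (hf : M.IsEdgeColoring f) : 0 < M.numCovers := by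
  have : Nonempty M.ValidTwists := by
    refine ⟨twist M f, twist_inv, fun v i j hij h => ?_⟩
    refine hij (hf.injective v (apply_eq_of_eqvGen ?_ h))
    rintro _ _ ⟨d, b, -, rfl, rfl⟩
    exact hf.apply_crn_eq d b
  exact Nat.card_pos

end IsEdgeColoring

section

variable {V : Type*} [Fintype V] {M : CubicMap V}

theorem two_le_card_of_planar (hP : M.Planar) : 2 ≤ Fintype.card V := by
  classical
  obtain ⟨L, -, hL⟩ := hP
  have hle := card_image_le (s := (univ : Finset (V × Fin 3))) (f := L)
  rw [card_univ, Fintype.card_prod, Fintype.card_fin] at hle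
  have heven := M.even_cut_add_card univ
  rw [cut_univ, zero_add, card_univ, Nat.even_iff] at heven
  omega

variable [DecidableEq V]

theorem TwoConn.exists_isEdgeColoring (hM : M.TwoConn) (hV : Fintype.card V = 2) :
    ∃ f, M.IsEdgeColoring f := by
  have hloop := hM.inv_fst_ne hV.ge
  rw [← card_univ, Finset.card_eq_two] at hV
  obtain ⟨u, v, huv, huniv⟩ := hV
  have hor (w : V) : w = u ∨ w = v := by simpa [huniv] using mem_univ w
  have hu {d : V × Fin 3} (hd : d.1 = v) : (M.inv d).1 = u :=
    (hor _).resolve_right fun h => hloop d (h.trans hd.symm)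
  refine ⟨fun d => if d.1 = u then d.2 else (M.inv d).2, fun d => ?_, fun w i j hij => ?_⟩
  · rcases hor d.1 with hd | hd
    · have h : (M.inv d).1 ≠ u := fun h => hloop d (h.trans hd.symm)
      simp only [hd, h, if_true, if_false, M.inv_inv]
    · have h : d.1 ≠ u := fun h => huv (h.symm.trans hd)
      simp only [hu hd, h, if_true, if_false]
  · dsimp only at hij
    rcases hor w with rfl | rfl
    · simpa using hij
    · rw [if_neg huv.symm, if_neg huv.symm] at hij
      have hinv : M.inv (w, i) = M.inv (w, j) := Prod.ext ((hu rfl).trans (hu rfl).symm) hij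
      exact (Prod.ext_iff.1 (M.inv_involutive.injective hinv)).2

end

namespace IsFaceCycle

variable {V : Type*} {M : CubicMap V} {k : ℕ} [NeZero k] {D : Fin k → V × Fin 3}

/-- The placement of a gadget in the outside of a face, without identifying or shifting
anything. -/
def placement (hD : M.IsFaceCycle D) (g : Gadget k) :
    Placement (Outer D ⊕ Fin g.order) hD.openMap g :=
  ⟨Equiv.refl _, fun _ => 0⟩

/-- The map with the vertices of a face replaced by a gadget. -/
noncomputable def replace (hD : M.IsFaceCycle D) (g : Gadget k) :
    CubicMap (Outer D ⊕ Fin g.order) :=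
  (hD.placement g).glue

end IsFaceCycle

/-- The lower bound `(5/2)^(n/4 - 1/2)` for the number of covers. -/
noncomputable def coverBound (n : ℕ) : ℝ := (5 / 2 : ℝ) ^ ((n : ℝ) / 4 - 1 / 2)

theorem coverBound_pos (n : ℕ) : 0 < coverBound n := by
  unfold coverBound
  positivity

theorem coverBound_add_four (n : ℕ) : coverBound (n + 4) = 5 / 2 * coverBound n := by
  have hexp : ((n + 4 : ℕ) : ℝ) / 4 - 1 / 2 = (n / 4 - 1 / 2) + 1 := by
    push_cast
    ring
  rw [coverBound, hexp, Real.rpow_add_one (by norm_num), mul_comm, coverBound]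

theorem coverBound_add_two_le (n : ℕ) : coverBound (n + 2) ≤ 2 * coverBound n := by
  have hsq : coverBound (n + 2) ^ 2 = coverBound (n + 4) * coverBound n := by
    simp only [coverBound]
    rw [sq, ← Real.rpow_add (by norm_num), ← Real.rpow_add (by norm_num)]
    congr 1
    push_cast
    ring
  have hpos := coverBound_pos n
  refine le_of_sq_le_sq ?_ (by positivity)
  rw [hsq, coverBound_add_four]
  nlinarith

theorem coverBound_two : coverBound 2 = 1 := by
  norm_num [coverBound]

universe u

variable {V : Type u} [Fintype V] [DecidableEq V] {M : CubicMap V}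

theorem IsFaceCycle.mul_coverBound_le {k : ℕ} [NeZero k] {D : Fin k → V × Fin 3}
    (hD : M.IsFaceCycle D) (hM : M.TwoConn) (hP : M.Planar) {A : Finset V} (hA : M.IsAtom A)
    (hmem : ∀ i, (D i).1 ∈ A)
    (ih : ∀ {V' : Type u} [Fintype V'] [DecidableEq V'] {M' : CubicMap V'},
      Fintype.card V' < Fintype.card V → M'.TwoConn → M'.Planar →
      coverBound (Fintype.card V') ≤ M'.numCovers)
    {ι : Type*} [Fintype ι] {g : ι → Gadget k} (hg : ∀ i, (g i).IsReduction) {m n : ℕ}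
    (hcount : ∀ p ε κ, IsConflictSystem p κ →
      m * ∑ i, (g i).count p ε κ ≤ n * (cycleGadget k).count p ε κ)
    {N : ℕ} (hN : ∀ i, N + k = Fintype.card V + (g i).order) :
    m * (Fintype.card ι * coverBound N) ≤ n * M.numCovers := by
  classical
  have : Fintype (Outer D) := Fintype.ofFinite _
  have hcard : Fintype.card V = Fintype.card (Outer D) + k := hD.gluing.card_eq
  have hreplace (i : ι) : coverBound N ≤ (hD.replace (g i)).numCovers := by
    obtain ⟨a, s, t, hface, hle⟩ := (hg i).exists_faceCompatible
    have hlt := (hg i).order_lt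
    have hcard' : Fintype.card (Outer D ⊕ Fin (g i).order) = N := by
      rw [Fintype.card_sum, Fintype.card_fin]
      have := hN i
      omega
    have hM' := hD.gluing.twoConn (hD.placement (g i)).gluing hM hA hmem (hg i).cutDominates
    have hP' := hP.of_faceCompatible hD.gluing (hD.placement (g i)).gluing hface hle
    have hih := ih (by rw [Fintype.card_sum, Fintype.card_fin]; omega) hM' hP'
    rwa [hcard'] at hih
  have hsum := sum_numCovers_le hD.gluing (fun i => (hD.placement (g i)).gluing) m n hcount
  calc (m * (Fintype.card ι * coverBound N) : ℝ)
      ≤ m * ∑ i, ((hD.replace (g i)).numCovers : ℝ) := by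
        gcongr
        rw [← nsmul_eq_mul, ← card_univ]
        exact card_nsmul_le_sum _ _ _ fun i _ => hreplace i
    _ ≤ n * M.numCovers := by exact_mod_cast hsum

theorem coverBound_le_numCovers (hM : M.TwoConn) (hP : M.Planar) :
    coverBound (Fintype.card V) ≤ M.numCovers := by
  induction hn : Fintype.card V using Nat.strong_induction_on generalizing V with | _ n IH
  subst hn
  have htwo := two_le_card_of_planar hP
  rcases htwo.eq_or_lt with htwo | htwo
  · obtain ⟨f, hf⟩ := hM.exists_isEdgeColoring htwo.symm
    rw [← htwo, coverBound_two]
    exact_mod_cast hf.numCovers_pos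
  obtain ⟨A, hA, k, hk, D, hk2, hk5, hD, hmem⟩ := exists_isFaceCycle hM hP htwo
  have hkV : k ≤ Fintype.card V := by
    simpa using Fintype.card_le_of_injective _ hD.fst_injective
  have hle {ι : Type} [Fintype ι] {g : ι → Gadget k} {m n : ℕ} :=
    hD.mul_coverBound_le (g := g) (m := m) (n := n) hM hP hA hmem
      fun hlt hM' hP' => IH _ hlt hM' hP' rfl
  obtain ⟨N, hN⟩ : ∃ N, Fintype.card V = N + 2 := ⟨_, (Nat.sub_add_cancel htwo.le).symm⟩
  rw [hN]
  interval_cases k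
  · have h := hle (fun _ => Gadget.isReduction_edgeGadget) Gadget.two_mul_count_edgeGadget_le
      (N := N) fun _ => by rw [hN]; rfl
    norm_num at h
    exact (coverBound_add_two_le N).trans h
  · have h := hle (fun _ => Gadget.isReduction_clawGadget) Gadget.two_mul_count_clawGadget_le
      (N := N) fun _ => by rw [hN]; rfl
    norm_num at h
    exact (coverBound_add_two_le N).trans h
  · obtain ⟨N, rfl⟩ : ∃ N', N = N' + 2 := ⟨N - 2, by omega⟩
    have h := hle (fun i => Gadget.isReduction_edgesGadget _)
      Gadget.two_mul_sum_count_edgesGadget_le (N := N) fun _ => by rw [hN]; rfl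
    norm_num at h
    rw [coverBound_add_four]
    linarith [coverBound_pos N]
  · obtain ⟨N, rfl⟩ : ∃ N', N = N' + 2 := ⟨N - 2, by omega⟩
    have h := hle Gadget.isReduction_edgeClawGadget
      Gadget.sum_count_edgeClawGadget_le (N := N) fun _ => by rw [hN]; rfl
    norm_num at h
    rw [coverBound_add_four]
    linarith

end CubicMap

end Induction

/-! ### Rotation systems of cubic graphs -/

section RotationSystem

open Function Graph
open Equiv (Perm)
open Equiv.Perm (SameCycle)

theorem setOf_sameCycle_eq_orbit {D : Type*} (f : Perm D) (x : D) :
    {y | f.SameCycle x y} = MulAction.orbit (Subgroup.zpowers f) x := by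
  ext y
  exact ⟨fun ⟨i, hi⟩ => ⟨⟨f ^ i, i, rfl⟩, hi⟩, fun ⟨⟨_, i, hf⟩, hi⟩ => ⟨i, by subst hf; exact hi⟩⟩

theorem minimalPeriod_eq_of_encard_sameCycle_eq {D : Type*} {f : Perm D} {x : D} {n : ℕ}
    (h : {y | f.SameCycle x y}.encard = n) : minimalPeriod f x = n := by
  rw [setOf_sameCycle_eq_orbit] at h
  have : Fintype (MulAction.orbit (Subgroup.zpowers f) x) :=
    (Set.finite_of_encard_eq_coe h).fintype
  rw [Set.encard_eq_coe_toFinset_card, Nat.cast_inj, Set.toFinset_card] at h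
  exact (MulAction.minimalPeriod_eq_card f x).trans h

theorem exists_lt_minimalPeriod_iterate_eq_of_sameCycle {D : Type*} {f : Perm D} {x y : D}
    (hx : 0 < minimalPeriod f x) (h : f.SameCycle x y) : ∃ i < minimalPeriod f x, f^[i] x = y := by
  obtain ⟨j, rfl⟩ := h
  have hnonneg := Int.emod_nonneg j (Nat.cast_ne_zero.2 hx.ne')
  refine ⟨(j % minimalPeriod f x).toNat, ?_, ?_⟩
  · have := Int.emod_lt_of_pos j (Nat.cast_pos.2 hx)
    omega
  · rw [← Perm.coe_pow, ← zpow_natCast, Int.toNat_of_nonneg hnonneg]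
    exact MulAction.zpow_smul_mod_minimalPeriod f x j

theorem CubicMap.planar_of_surjective {V ι : Type*} [Fintype V] {M : CubicMap V}
    {L : V × Fin 3 → ι} (hL : M.IsFaceLabelling L) (hsurj : L.Surjective)
    (hcard : Fintype.card V + 4 ≤ 2 * Nat.card ι) : M.Planar := by
  have : Finite ι := .of_surjective L hsurj
  have hinj := Fin.val_injective.comp (Finite.equivFin ι).injective
  refine ⟨(Fin.val ∘ Finite.equivFin ι) ∘ L, fun d b => congrArg (Fin.val ∘ _) (hL d b),
    hcard.trans_eq ?_⟩
  classical
  have : Fintype ι := .ofFinite ι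
  rw [← Finset.image_image, Finset.image_univ_of_surjective hsurj,
    Finset.card_image_of_injective _ hinj, Finset.card_univ, Nat.card_eq_fintype_card]

variable {α β : Type*} {G : Graph α β}

theorem flip_flip (d : G.Darts) : G.flip (G.flip d) = d := Prod.ext rfl (Bool.not_not _)

theorem flip_ne (d : G.Darts) : G.flip d ≠ d := fun h => Bool.not_ne_self _ (Prod.ext_iff.1 h).2

theorem eq_or_eq_flip {d d' : G.Darts} (h : d'.1 = d.1) : d' = d ∨ d' = G.flip d :=
  (Bool.eq_or_eq_not d'.2 d.2).imp (Prod.ext h) (Prod.ext h)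

variable (R : G.RotationSystem)

theorem isLink_tail (d : G.Darts) : G.IsLink d.1 (R.tail d) (R.tail (G.flip d)) := by
  obtain ⟨e, _ | _⟩ := d
  · exact R.isLink e
  · exact (R.isLink e).symm

theorem tail_mem (d : G.Darts) : R.tail d ∈ G.vertexSet := (isLink_tail R d).left_mem

theorem incidenceSet_eq_image_tail (v : α) : G.incidenceSet v =
    Subtype.val '' ({e | R.tail (e, false) = v} ∪ {e | R.tail (e, true) = v}) := by
  ext e
  constructor
  · intro he
    have hmem : e ∈ G.edgeSet := Inc.edge_mem he
    exact ⟨⟨e, hmem⟩, (Inc.eq_or_eq_of_isLink he (R.isLink ⟨e, hmem⟩)).imp Eq.symm Eq.symm, rfl⟩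
  · rintro ⟨e, rfl | rfl, rfl⟩
    · exact (R.isLink e).inc_left
    · exact (R.isLink e).inc_right

theorem loopSet_eq_image_tail (v : α) : G.loopSet v =
    Subtype.val '' ({e | R.tail (e, false) = v} ∩ {e | R.tail (e, true) = v}) := by
  ext e
  constructor
  · intro he
    have hmem : e ∈ G.edgeSet := IsLoopAt.edge_mem he
    exact ⟨⟨e, hmem⟩, ((R.isLink ⟨e, hmem⟩).eq_and_eq_or_eq_and_eq he).elim id id, rfl⟩
  · rintro ⟨e, ⟨hfalse, htrue⟩, rfl⟩
    have hlink := R.isLink e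
    rw [Set.mem_ofPred_eq] at hfalse htrue
    rwa [hfalse, htrue] at hlink

theorem encard_setOf_tail_eq (v : α) : {d | R.tail d = v}.encard = G.eDegree v := by
  have hdarts : {d | R.tail d = v} = {e | R.tail (e, false) = v} ×ˢ {false} ∪
      {e | R.tail (e, true) = v} ×ˢ {true} := by
    ext ⟨e, _ | _⟩ <;> simp
  have hdisj : Disjoint ({e | R.tail (e, false) = v} ×ˢ {false})
      ({e | R.tail (e, true) = v} ×ˢ {true}) :=
    Set.disjoint_prod.2 (Or.inr (by simp))
  rw [hdarts, Set.encard_union_eq hdisj, Set.encard_prod, Set.encard_prod, Set.encard_singleton,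
    Set.encard_singleton, mul_one, mul_one, eDegree, incidenceSet_eq_image_tail R,
    loopSet_eq_image_tail R, Subtype.val_injective.encard_image,
    Subtype.val_injective.encard_image, Set.encard_union_add_encard_inter]

theorem setOf_sameCycle_rot_eq (d : G.Darts) :
    {d' | R.rot.SameCycle d d'} = {d' | R.tail d' = R.tail d} := by
  ext d'
  exact (R.sameCycle_iff d d').trans eq_comm

/-- A numbering of the darts at every vertex along the rotation. -/
structure DartNumbering extends G.vertexSet × Fin 3 ≃ G.Darts where
  tail_apply : ∀ d, R.tail (toFun d) = d.1
  rot_apply : ∀ d, R.rot (toFun d) = toFun (d.1, d.2 + 1)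

theorem nonempty_dartNumbering (hcubic : G.IsRegular 3) : Nonempty (DartNumbering R) := by
  have hcard (v : G.vertexSet) : {d | R.tail d = v}.encard = (3 : ℕ) := by
    rw [encard_setOf_tail_eq, hcubic v v.2]
  have hdart (v : G.vertexSet) : ∃ d, R.tail d = v :=
    Set.nonempty_of_encard_ne_zero (s := {d | R.tail d = v}) (by rw [hcard v]; decide)
  choose base hbase using hdart
  have hperiod (v : G.vertexSet) : minimalPeriod R.rot (base v) = 3 :=
    minimalPeriod_eq_of_encard_sameCycle_eq (by
      rw [setOf_sameCycle_rot_eq, hbase, hcard])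
  have htail (v : G.vertexSet) (i : ℕ) : R.tail (R.rot^[i] (base v)) = v := by
    rw [← hbase v, ← R.sameCycle_iff, ← Perm.coe_pow]
    exact Perm.sameCycle_pow_left.2 (.refl _ _)
  refine ⟨Equiv.ofBijective (fun d => R.rot^[d.2] (base d.1)) ⟨?_, fun d => ?_⟩,
    fun d => htail d.1 d.2, fun d => ?_⟩
  · rintro ⟨v, i⟩ ⟨w, j⟩ h
    obtain rfl : v = w :=
      Subtype.ext ((htail v i).symm.trans ((congrArg R.tail h).trans (htail w j)))
    have hij := iterate_injOn_Iio_minimalPeriod (f := R.rot) (x := base v)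
      (by simp [hperiod]) (by simp [hperiod]) h
    exact Prod.ext rfl (Fin.ext hij)
  · obtain ⟨i, hi, hid⟩ := exists_lt_minimalPeriod_iterate_eq_of_sameCycle
      (by rw [hperiod]; decide) ((R.sameCycle_iff _ d).2 (hbase ⟨R.tail d, tail_mem R d⟩))
    exact ⟨(_, ⟨i, hperiod _ ▸ hi⟩), hid⟩
  · have hmod := iterate_mod_minimalPeriod_eq (f := R.rot) (x := base d.1) (n := d.2 + 1)
    rw [hperiod, iterate_succ_apply'] at hmod
    exact hmod.symm

theorem numCycles_rot_le [Fintype G.vertexSet] :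
    numCycles R.rot ≤ Fintype.card G.vertexSet := by
  rw [numCycles, ← Nat.card_eq_fintype_card]
  refine Nat.card_le_card_of_injective (Quotient.lift
    (fun d => (⟨R.tail d, tail_mem R d⟩ : G.vertexSet))
    fun d d' h => Subtype.ext ((R.sameCycle_iff d d').1 h)) ?_
  rintro ⟨d⟩ ⟨d'⟩ h
  exact Quotient.sound ((R.sameCycle_iff d d').2 (congrArg Subtype.val h))

theorem card_edgeSet_le_numCycles_flip [Finite G.Darts] :
    Nat.card G.edgeSet ≤ numCycles G.flip := by
  refine Nat.card_le_card_of_injective (fun e : G.edgeSet =>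
    Quotient.mk (SameCycle.setoid G.flip) (e, false)) fun e e' h => ?_
  exact apply_eq_of_sameCycle (f := G.flip) (g := Prod.fst) (fun _ => rfl) (Quotient.exact h)

theorem numComponents_pos [Finite G.Darts] [Nonempty G.Darts] : 0 < R.numComponents := by
  have : Finite (MulAction.orbitRel.Quotient (Subgroup.closure {R.rot, G.flip}) G.Darts) :=
    Quotient.finite _
  have : Nonempty (MulAction.orbitRel.Quotient (Subgroup.closure {R.rot, G.flip}) G.Darts) :=
    ⟨Quotient.mk _ (Classical.arbitrary _)⟩
  exact Nat.card_pos

/-- A cubic map with the vertices and the edges of `G`. -/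
structure CubicModel (G : Graph α β) where
  /-- The underlying map. -/
  map : CubicMap G.vertexSet
  /-- The edge of a dart. -/
  edge : G.vertexSet × Fin 3 → β
  isLink : ∀ d, G.IsLink (edge d) d.1 (map.inv d).1
  edge_eq_iff : ∀ d d', edge d' = edge d ↔ d' = d ∨ d' = map.inv d
  exists_edge_eq : ∀ e ∈ G.edgeSet, ∃ d, edge d = e

namespace DartNumbering

variable {R} (ψ : DartNumbering R)

/-- The map that a numbering of the darts along a rotation system defines. -/
def model : CubicModel G where
  map :=
    { inv := fun d => ψ.symm (G.flip (ψ.toEquiv d))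
      inv_inv := fun d => by rw [ψ.apply_symm_apply, flip_flip, ψ.symm_apply_apply]
      inv_ne := fun d h => flip_ne _ (ψ.symm_apply_eq.1 h) }
  edge d := (ψ.toEquiv d).1
  isLink d := by
    have hlink := isLink_tail R (ψ.toEquiv d)
    rw [← ψ.apply_symm_apply (G.flip (ψ.toEquiv d))] at hlink
    exact ψ.tail_apply d ▸ ψ.tail_apply (ψ.symm _) ▸ hlink
  edge_eq_iff d d' := by
    refine ⟨fun h => (eq_or_eq_flip (Subtype.ext h)).imp (fun h => ψ.injective h)
      fun h => (ψ.eq_symm_apply).2 h, ?_⟩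
    rintro (rfl | rfl)
    · rfl
    · rw [ψ.apply_symm_apply]
      rfl
  exists_edge_eq e he := ⟨ψ.symm (⟨e, he⟩, false), by rw [ψ.apply_symm_apply]⟩

theorem apply_inv (d : G.vertexSet × Fin 3) :
    ψ.toEquiv (ψ.model.map.inv d) = G.flip (ψ.toEquiv d) := ψ.apply_symm_apply _

theorem apply_face (d : G.vertexSet × Fin 3) :
    ψ.toEquiv (ψ.model.map.face d) = R.face (ψ.toEquiv d) := by
  rw [CubicMap.face_apply]
  exact (ψ.rot_apply _).symm.trans (congrArg R.rot (ψ.apply_inv d))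

/-- The face to which a corner belongs. -/
def faceOfCorner (q : G.vertexSet × Fin 3) : Quotient (SameCycle.setoid R.face) :=
  Quotient.mk _ (ψ.toEquiv (q.1, q.2 + 2))

theorem faceOfCorner_crn_false (d : G.vertexSet × Fin 3) :
    ψ.faceOfCorner (crn d false) = Quotient.mk _ (ψ.toEquiv d) := by
  have hthree : d.2 + 1 + 2 = d.2 := by rw [add_assoc]; exact add_zero _
  simp only [faceOfCorner, crn, cond_false, hthree]

theorem faceOfCorner_surjective : ψ.faceOfCorner.Surjective := fun φ => by
  obtain ⟨d, rfl⟩ := Quotient.mk_surjective φ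
  exact ⟨crn (ψ.symm d) false, by rw [faceOfCorner_crn_false, ψ.apply_symm_apply]⟩

theorem isFaceLabelling_faceOfCorner : ψ.model.map.IsFaceLabelling ψ.faceOfCorner := by
  have hside (d : G.vertexSet × Fin 3) :
      ψ.faceOfCorner (crn d false) = ψ.faceOfCorner (crn (ψ.model.map.inv d) true) := by
    rw [← CubicMap.crn_face, faceOfCorner_crn_false, faceOfCorner_crn_false, apply_face]
    exact Quotient.sound (Perm.sameCycle_apply_right.2 (.refl _ _))
  rintro d (_ | _)
  · exact hside d
  · simpa only [CubicMap.inv_inv, Bool.not_true] using (hside (ψ.model.map.inv d)).symm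

theorem planar_model [Fintype G.vertexSet] (hne : G.vertexSet.Nonempty) (hR : R.IsPlane) :
    ψ.model.map.Planar := by
  have : Finite G.Darts := .of_equiv _ ψ.toEquiv
  refine CubicMap.planar_of_surjective ψ.isFaceLabelling_faceOfCorner
    ψ.faceOfCorner_surjective ?_
  have hrot := numCycles_rot_le R
  have hflip := card_edgeSet_le_numCycles_flip (G := G)
  have hdarts : Nat.card G.Darts = 3 * Fintype.card G.vertexSet := by
    rw [← Nat.card_congr ψ.toEquiv, Nat.card_prod, Nat.card_eq_fintype_card, Nat.card_fin, mul_comm]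
  rw [Nat.card_prod, Nat.card_eq_fintype_card (α := Bool), Fintype.card_bool] at hdarts
  have hcomp : 0 < R.numComponents := by
    have : Nonempty G.Darts := ⟨ψ.toEquiv (⟨_, hne.some_mem⟩, 0)⟩
    exact numComponents_pos R
  have hplane : numCycles R.rot + numCycles R.face = numCycles G.flip + 2 * R.numComponents := hR
  change Fintype.card G.vertexSet + 4 ≤ 2 * numCycles R.face
  omega

end DartNumbering

end RotationSystem

/-! ### Strands and circuit double covers -/

section Strands

open Relation Function Graph

theorem exists_rel_of_reflTransGen {D : Type*} {r : D → D → Prop} {S : Set D} {x y : D}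
    (h : ReflTransGen r x y) (hx : x ∈ S) (hy : y ∉ S) : ∃ a b, r a b ∧ a ∈ S ∧ b ∉ S := by
  by_contra! hclosed
  have hmem (z : D) (hz : ReflTransGen r x z) : z ∈ S := by
    induction hz with
    | refl => exact hx
    | tail _ hab ih => exact hclosed _ _ hab ih
  exact hy (hmem y h)

variable {α β : Type*} {G : Graph α β}

theorem reachable_symm {x y : α} (h : G.Reachable x y) : G.Reachable y x :=
  have : Std.Symm G.Adj := ⟨fun _ _ h => h.symm⟩
  ReflTransGen.stdSymm.symm _ _ h

theorem finite_setOf_le (hV : G.vertexSet.Finite) (hE : G.edgeSet.Finite) :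
    {H : Graph α β | H ≤ G}.Finite := by
  refine Set.Finite.of_injOn (f := fun H => (H.vertexSet, H.edgeSet))
    (t := 𝒫 G.vertexSet ×ˢ 𝒫 G.edgeSet) (fun H hH => ⟨hH.vertexSet_mono, hH.edgeSet_mono⟩)
    (fun H hH H' hH' h => ?_) (hV.finite_subsets.prod hE.finite_subsets)
  obtain ⟨hvertex, hedge⟩ := Prod.ext_iff.1 h
  exact (Compatible.of_le_le hH hH').ext hvertex hedge

theorem edgeSet_nonempty_of_isRegular {k : ℕ} (hk : k ≠ 0) (hV : G.vertexSet.Nonempty)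
    (hreg : G.IsRegular k) : G.edgeSet.Nonempty := by
  obtain ⟨x, hx⟩ := hV
  by_contra! hempty
  have hincidence : G.incidenceSet x = ∅ :=
    Set.subset_empty_iff.1 (hempty ▸ G.incidenceSet_subset_edgeSet x)
  have hloop : G.loopSet x = ∅ :=
    Set.subset_empty_iff.1 (hincidence ▸ G.loopSet_subset_incidenceSet x)
  have hdegree := hreg x hx
  rw [eDegree, hincidence, hloop, Set.encard_empty, add_zero] at hdegree
  exact hk (by exact_mod_cast hdegree.symm)

theorem count_le_two_of_isCircuitDoubleCover [DecidableEq (Graph α β)]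
    {𝒞 : Multiset (Graph α β)} (h𝒞 : G.IsCircuitDoubleCover 𝒞) {C : Graph α β} (hC : C ∈ 𝒞) :
    𝒞.count C ≤ 2 := by
  classical
  obtain ⟨hle, hconn, hreg⟩ := h𝒞.1 C hC
  obtain ⟨e, he⟩ := edgeSet_nonempty_of_isRegular two_ne_zero hconn.1 hreg
  rw [← h𝒞.2 e (hle.edgeSet_mono he), Multiset.count, Multiset.countP_eq_card_filter,
    Multiset.countP_eq_card_filter]
  exact Multiset.card_le_card (Multiset.monotone_filter_right _ fun C' h => h ▸ he)

theorem finite_setOf_isCircuitDoubleCover (hV : G.vertexSet.Finite) (hE : G.edgeSet.Finite) :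
    {𝒞 : Multiset (Graph α β) | G.IsCircuitDoubleCover 𝒞}.Finite := by
  classical
  refine (Set.finite_Icc 0 (2 • (finite_setOf_le hV hE).toFinset.val)).subset fun 𝒞 h𝒞 =>
    ⟨Multiset.zero_le _, Multiset.le_iff_count.2 fun C => ?_⟩
  by_cases hC : C ∈ 𝒞
  · rw [Multiset.count_nsmul, Multiset.count_eq_one_of_mem (Finset.nodup _)
      (by simpa using (h𝒞.1 C hC).1)]
    exact count_le_two_of_isCircuitDoubleCover h𝒞 hC
  · rw [Multiset.count_eq_zero_of_notMem hC]
    exact Nat.zero_le _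

theorem exists_crn_eq_iff {V : Type*} {d q : V × Fin 3} :
    (∃ b, crn d b = q) ↔ q.1 = d.1 ∧ q.2 ≠ d.2 := by
  have hindex : ∀ i j : Fin 3, (i + 1 = j ∨ i + 2 = j) ↔ j ≠ i := by decide
  simp only [Bool.exists_bool, crn, cond_false, cond_true, Prod.ext_iff, ← and_or_left, hindex,
    eq_comm (a := d.1)]

namespace CubicModel

variable (N : CubicModel G)

theorem exists_dart {e : β} {x y : α} (h : G.IsLink e x y) :
    ∃ d, N.edge d = e ∧ (d.1 : α) = x ∧ ((N.map.inv d).1 : α) = y := by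
  obtain ⟨d, rfl⟩ := N.exists_edge_eq e h.edge_mem
  rcases (N.isLink d).eq_and_eq_or_eq_and_eq h with ⟨hx, hy⟩ | ⟨hy, hx⟩
  · exact ⟨d, rfl, hx, hy⟩
  · exact ⟨N.map.inv d, (N.edge_eq_iff d _).2 (Or.inr rfl), hx, by rw [N.map.inv_inv, hy]⟩

theorem edge_inv (d : G.vertexSet × Fin 3) : N.edge (N.map.inv d) = N.edge d :=
  (N.edge_eq_iff d _).2 (Or.inr rfl)

theorem edge_mk_injective (hloop : ∀ d, (N.map.inv d).1 ≠ d.1) (v : G.vertexSet) :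
    Injective fun i => N.edge (v, i) := fun _ _ h =>
  ((N.edge_eq_iff _ _).1 h).elim (fun h => (Prod.ext_iff.1 h).2)
    fun h => absurd (Prod.ext_iff.1 h).1.symm (hloop _)

theorem exists_dart_of_reachable {H : Graph α β} (hH : H ≤ G) {X : Set G.vertexSet}
    {x y : G.vertexSet} (h : H.Reachable x y) (hx : x ∈ X) (hy : y ∉ X) :
    ∃ d, N.edge d ∈ H.edgeSet ∧ d.1 ∈ X ∧ (N.map.inv d).1 ∉ X := by
  obtain ⟨_, _, ⟨e, he⟩, ⟨u, hu, rfl⟩, hw⟩ := exists_rel_of_reflTransGen h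
    (Set.mem_image_of_mem Subtype.val hx) (Subtype.val_injective.mem_set_image.not.2 hy)
  obtain ⟨d, rfl, hdu, hdw⟩ := N.exists_dart (he.mono hH)
  exact ⟨d, he.edge_mem, Subtype.ext hdu ▸ hu, fun hmem => hw ⟨_, hmem, hdw⟩⟩

theorem twoConn [Fintype G.vertexSet] [DecidableEq G.vertexSet] (hconn : G.IsConnected)
    (hbridgeless : G.IsBridgeless) : N.map.TwoConn := by
  intro X ⟨x, hx⟩ huniv
  obtain ⟨y, hy⟩ : ∃ y, y ∉ X := by simpa [Finset.eq_univ_iff_forall] using huniv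
  obtain ⟨d, -, hd, hd'⟩ := N.exists_dart_of_reachable (X := X) le_rfl
    (hconn.2 x x.2 y y.2) hx hy
  have hreach : (G.deleteEdges {N.edge d}).Reachable d.1 (N.map.inv d).1 :=
    by_contra fun h => hbridgeless (N.edge d) ⟨_, _, N.isLink d, h⟩
  obtain ⟨c, hcd, hc, hc'⟩ := N.exists_dart_of_reachable (X := X) deleteEdges_le hreach hd hd'
  have hne : c ≠ d := by
    rintro rfl
    simp at hcd
  refine Finset.one_lt_card.2 ⟨c, ?_, d, ?_, hne⟩ <;> simp_all

variable (T : G.vertexSet × Fin 3 → Bool)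

theorem mk_crn_eq (d : G.vertexSet × Fin 3) (b : Bool) :
    Quot.mk (Link N.map.inv T) (crn d b) = Quot.mk _ (crn (N.map.inv d) (xor (!b) (T d))) :=
  Quot.sound ⟨d, b, N.map.inv_ne d, rfl, rfl⟩

/-- The subgraph that a strand, a class of linked corners, passes through. -/
def strand (κ : Quot (Link N.map.inv T)) : Graph α β where
  vertexSet := {x | ∃ q : G.vertexSet × Fin 3, Quot.mk _ q = κ ∧ (q.1 : α) = x}
  IsLink e x y := G.IsLink e x y ∧ ∃ d b, N.edge d = e ∧ Quot.mk _ (crn d b) = κ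
  edgeSet := {e | ∃ d b, N.edge d = e ∧ Quot.mk _ (crn d b) = κ}
  isLink_symm e _ := ⟨fun _ _ h => ⟨h.1.symm, h.2⟩⟩
  eq_or_eq_of_isLink_of_isLink _ _ _ _ _ h h' := h.1.left_eq_or_eq h'.1
  edge_mem_iff_exists_isLink e := by
    refine ⟨?_, fun ⟨_, _, _, h⟩ => h⟩
    rintro ⟨d, b, rfl, h⟩
    exact ⟨_, _, N.isLink d, d, b, rfl, h⟩
  left_mem_of_isLink e x y := by
    rintro ⟨h, d, b, rfl, hκ⟩
    rcases h.left_eq_or_eq (N.isLink d) with rfl | rfl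
    · exact ⟨_, hκ, rfl⟩
    · exact ⟨_, (N.mk_crn_eq T d b).symm.trans hκ, rfl⟩

variable {N T}

theorem edge_mem_strand_iff {κ : Quot (Link N.map.inv T)} {v : G.vertexSet} {j : Fin 3} :
    N.edge (v, j) ∈ (N.strand T κ).edgeSet ↔ ∃ i ≠ j, Quot.mk _ (v, i) = κ := by
  have hside : (∃ b, Quot.mk _ (crn (v, j) b) = κ) ↔ ∃ i ≠ j, Quot.mk _ (v, i) = κ := by
    constructor
    · exact fun ⟨b, hb⟩ => ⟨_, (exists_crn_eq_iff.1 ⟨b, rfl⟩).2, hb⟩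
    · rintro ⟨i, hij, rfl⟩
      obtain ⟨b, hb⟩ := exists_crn_eq_iff.2 (⟨rfl, hij⟩ : (v, i).1 = (v, j).1 ∧ _)
      exact ⟨b, congrArg _ hb⟩
  rw [← hside]
  refine ⟨?_, fun ⟨b, hb⟩ => ⟨_, b, rfl, hb⟩⟩
  rintro ⟨d, b, he, rfl⟩
  rcases (N.edge_eq_iff _ _).1 he with rfl | rfl
  · exact ⟨b, rfl⟩
  · exact ⟨_, ((N.mk_crn_eq T _ b).trans (by rw [N.map.inv_inv])).symm⟩

theorem strand_le (κ : Quot (Link N.map.inv T)) : N.strand T κ ≤ G :=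
  ⟨fun _ ⟨q, _, hq⟩ => hq ▸ q.1.2, fun _ _ _ h => h.1⟩

theorem reachable_strand_of_eqvGen {p q : G.vertexSet × Fin 3}
    (h : EqvGen (Link N.map.inv T) p q) :
    (N.strand T (Quot.mk _ p)).Reachable p.1 q.1 := by
  induction h with
  | rel p q h =>
    obtain ⟨d, b, -, rfl, rfl⟩ := h
    exact ReflTransGen.single ⟨N.edge d, N.isLink d, d, b, rfl, rfl⟩
  | refl p => exact ReflTransGen.refl
  | symm p q h ih =>
    rw [← Quot.eqvGen_sound h]
    exact reachable_symm ih
  | trans p q r h _ ihpq ihqr =>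
    rw [← Quot.eqvGen_sound h] at ihqr
    exact ReflTransGen.trans ihpq ihqr

theorem strand_isConnected (κ : Quot (Link N.map.inv T)) : (N.strand T κ).IsConnected := by
  obtain ⟨p, rfl⟩ := Quot.exists_rep κ
  refine ⟨⟨p.1, p, rfl, rfl⟩, ?_⟩
  rintro _ ⟨q, hq, rfl⟩ _ ⟨r, hr, rfl⟩
  exact (reachable_symm (reachable_strand_of_eqvGen (Quot.eqvGen_exact hq.symm))).trans
    (reachable_strand_of_eqvGen (Quot.eqvGen_exact hr.symm))

theorem mk_corner_injective (hT : StrandsValid N.map.inv T) (v : G.vertexSet) :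
    Injective fun i => Quot.mk (Link N.map.inv T) (v, i) := fun i j h =>
  by_contra fun hij => hT v i j hij (Quot.eqvGen_exact h)

theorem edge_mem_strand_mk_iff (hT : StrandsValid N.map.inv T) {v : G.vertexSet} {i j : Fin 3} :
    N.edge (v, j) ∈ (N.strand T (Quot.mk _ (v, i))).edgeSet ↔ i ≠ j := by
  rw [edge_mem_strand_iff]
  refine ⟨fun ⟨k, hk, hki⟩ => ?_, fun hij => ⟨i, hij, rfl⟩⟩
  rwa [← mk_corner_injective hT v hki]

theorem strand_isRegular (hloop : ∀ d, (N.map.inv d).1 ≠ d.1) (hT : StrandsValid N.map.inv T)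
    (κ : Quot (Link N.map.inv T)) : (N.strand T κ).IsRegular 2 := by
  rintro _ ⟨⟨v, i⟩, rfl, rfl⟩
  have hloopSet : (N.strand T (Quot.mk _ (v, i))).loopSet v = ∅ := by
    refine Set.eq_empty_iff_forall_notMem.2 fun e he => ?_
    obtain ⟨d, -, hd, hd'⟩ := N.exists_dart he.1
    exact hloop d (Subtype.ext (hd'.trans hd.symm))
  have hincidenceSet : (N.strand T (Quot.mk _ (v, i))).incidenceSet v =
      (fun j => N.edge (v, j)) '' {i}ᶜ := by
    ext e
    constructor
    · rintro ⟨y, he, hmem⟩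
      obtain ⟨⟨w, j⟩, rfl, hw, -⟩ := N.exists_dart he
      obtain rfl : w = v := Subtype.ext hw
      exact ⟨j, ((edge_mem_strand_mk_iff hT).1 hmem).symm, rfl⟩
    · rintro ⟨j, hj, rfl⟩
      exact ⟨_, N.isLink (v, j), (edge_mem_strand_mk_iff hT).2 (Ne.symm hj)⟩
  rw [eDegree, hloopSet, hincidenceSet, (N.edge_mk_injective hloop v).encard_image,
    Set.encard_empty, add_zero, Set.encard_eq_coe_toFinset_card]
  simp [Finset.card_compl]

theorem eq_mk_crn_false_iff (hT : StrandsValid N.map.inv T) {κ : Quot (Link N.map.inv T)}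
    {d : G.vertexSet × Fin 3} : κ = Quot.mk _ (crn d false) ↔
      N.edge d ∈ (N.strand T κ).edgeSet ∧ N.edge (d.1, d.2 + 2) ∈ (N.strand T κ).edgeSet := by
  obtain ⟨v, j⟩ := d
  have hindex : ∀ i j : Fin 3, i ≠ j → i ≠ j + 2 → i = j + 1 := by decide
  have hindex' : ∀ j : Fin 3, j + 1 ≠ j ∧ j + 1 ≠ j + 2 := by decide
  constructor
  · rintro rfl
    exact (hindex' j).imp (edge_mem_strand_mk_iff hT).2 (edge_mem_strand_mk_iff hT).2
  · rintro ⟨hj, hj'⟩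
    obtain ⟨i, hij, rfl⟩ := edge_mem_strand_iff.1 hj
    rw [hindex i j hij ((edge_mem_strand_mk_iff hT).1 hj')]
    rfl

theorem twist_eq_true_iff_mk_eq (hT : StrandsValid N.map.inv T) (d : G.vertexSet × Fin 3) :
    T d = true ↔ Quot.mk (Link N.map.inv T) (crn d false) =
      Quot.mk _ (crn (N.map.inv d) false) := by
  have hindex : ∀ i : Fin 3, i + 2 ≠ i + 1 := by decide
  rw [N.mk_crn_eq T d false]
  cases T d
  · exact iff_of_false Bool.false_ne_true fun h => hindex _ (mk_corner_injective hT _ h)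
  · simp

variable (N T) in
/-- The circuits of the strands, with multiplicity. -/
noncomputable def strands [Finite G.vertexSet] : Multiset (Graph α β) :=
  letI : Fintype (Quot (Link N.map.inv T)) := Fintype.ofFinite _
  Finset.univ.val.map (N.strand T)

variable [Finite G.vertexSet]

theorem mem_strands {C : Graph α β} : C ∈ N.strands T ↔ ∃ κ, N.strand T κ = C := by
  simp [strands]

theorem isCircuitDoubleCover_strands (hloop : ∀ d, (N.map.inv d).1 ≠ d.1)
    (hT : StrandsValid N.map.inv T) : G.IsCircuitDoubleCover (N.strands T) := by
  classical
  let : Fintype (Quot (Link N.map.inv T)) := Fintype.ofFinite _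
  refine ⟨fun C hC => ?_, fun e he => ?_⟩
  · obtain ⟨κ, rfl⟩ := mem_strands.1 hC
    exact ⟨strand_le κ, strand_isConnected κ, strand_isRegular hloop hT κ⟩
  · obtain ⟨⟨v, j⟩, rfl⟩ := N.exists_edge_eq e he
    have hstrands : Finset.univ.filter (fun κ => N.edge (v, j) ∈ (N.strand T κ).edgeSet) =
        ({j}ᶜ : Finset (Fin 3)).image fun i => Quot.mk _ (v, i) := by
      ext κ
      simp [edge_mem_strand_iff]
    rw [strands, Multiset.countP_map, ← Finset.filter_val, ← Finset.card_def, hstrands,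
      Finset.card_image_of_injective _ (mk_corner_injective hT v), Finset.card_compl,
      Fintype.card_fin, Finset.card_singleton]

/- A twist on `d` is visible in the circuits: exactly then does one of them turn in the same
direction at both ends of `d`. -/
theorem twist_eq_true_iff (hT : StrandsValid N.map.inv T) (d : G.vertexSet × Fin 3) :
    T d = true ↔ ∃ C ∈ N.strands T, N.edge d ∈ C.edgeSet ∧ N.edge (d.1, d.2 + 2) ∈ C.edgeSet ∧
      N.edge ((N.map.inv d).1, (N.map.inv d).2 + 2) ∈ C.edgeSet := by
  rw [twist_eq_true_iff_mk_eq hT]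
  constructor
  · intro h
    obtain ⟨hd, hd'⟩ := (eq_mk_crn_false_iff hT).1 rfl
    exact ⟨_, mem_strands.2 ⟨_, rfl⟩, hd, hd', ((eq_mk_crn_false_iff hT).1 h).2⟩
  · rintro ⟨C, hC, hd, hd', hinv⟩
    obtain ⟨κ, rfl⟩ := mem_strands.1 hC
    rw [← (eq_mk_crn_false_iff hT).2 ⟨hd, hd'⟩]
    exact (eq_mk_crn_false_iff hT).2 ⟨(N.edge_inv d).symm ▸ hd, hinv⟩

theorem numCovers_le (hE : G.edgeSet.Finite) (hloop : ∀ d, (N.map.inv d).1 ≠ d.1) :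
    N.map.numCovers ≤ G.numCircuitDoubleCovers := by
  have := (finite_setOf_isCircuitDoubleCover (Set.toFinite G.vertexSet) hE).to_subtype
  rw [CubicMap.numCovers, numCircuitDoubleCovers, ← Nat.card_coe_set_eq]
  refine Nat.card_le_card_of_injective (fun T =>
    ⟨N.strands T.1, isCircuitDoubleCover_strands hloop T.2.2⟩) fun T T' h => ?_
  have hstrands : N.strands T.1 = N.strands T'.1 := congrArg Subtype.val h
  refine Subtype.ext (funext fun d => ?_)
  rw [Bool.eq_iff_iff, twist_eq_true_iff T.2.2, twist_eq_true_iff T'.2.2, hstrands]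

end CubicModel

end Strands

end CircuitDoubleCover

theorem theorem6p4 {α β : Type*} (G : Graph α β)
    (hV : G.vertexSet.Finite) (hE : G.edgeSet.Finite)
    (hconn : G.IsConnected) (hbridgeless : G.IsBridgeless) (hcubic : G.IsRegular 3)
    (hplanar : G.IsPlanar) :
    (5 / 2 : ℝ) ^ ((G.vertexSet.ncard : ℝ) / 4 - 1 / 2) ≤ (G.numCircuitDoubleCovers : ℝ) := by
  classical
  have : Fintype G.vertexSet := hV.fintype
  obtain ⟨R, hR⟩ := hplanar
  obtain ⟨ψ⟩ := CircuitDoubleCover.nonempty_dartNumbering R hcubic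
  have hP : ψ.model.map.Planar := ψ.planar_model hconn.1 hR
  have hM : ψ.model.map.TwoConn := ψ.model.twoConn hconn hbridgeless
  have hloop := hM.inv_fst_ne (CircuitDoubleCover.CubicMap.two_le_card_of_planar hP)
  rw [← Nat.card_coe_set_eq, Nat.card_eq_fintype_card]
  calc (5 / 2 : ℝ) ^ ((Fintype.card G.vertexSet : ℝ) / 4 - 1 / 2)
      ≤ ψ.model.map.numCovers := CircuitDoubleCover.CubicMap.coverBound_le_numCovers hM hP
    _ ≤ G.numCircuitDoubleCovers := mod_cast CircuitDoubleCover.CubicModel.numCovers_le hE hloop
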